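/- Let $n\ge 1$, $N>n$, $T>0$ and $x\in\{1,2,\dots,N-n+1\}$. Let $L^{(1)},\dots,L^{(n)}$ be independent rate-$1$ Poisson processes on $\mathbb Z$, with $L^{(i)}$ (the $i$-th bus) started at $1-i$. Then the event that $L^{(1)},\dots,L^{(n)}$ do not intersect on $[0,T]$ (no two of them are at the same site at the same time $t\in[0,T]$) and that $L^{(i)}_T=N+1-i$ for $1\le i\le n$ has positive probability. Conditionally on this event, let $t_i$ be the arrival time of the $i$-th bus at the site $x$, i.e. the first time at which it is at $x$. Put $$C_{N,n,x}=\Big(\prod_{i=1}^n\frac{1}{(x+i-2)!\,(N-x+1-i)!}\Big)\Big(\det\Big(\frac1{(N+i-j)!}\Big)_{i,j=1}^n\Big)^{-1},\qquad \tilde C_{N,n,x}=2^{-nN}C_{N,n,x}.$$ Then: 1. The vector $\tilde y=(t_1/T,\dots,t_n/T)$ has joint density $$C_{N,n,x}\prod_{i<j}(\tilde y_j-\tilde y_i)^2\prod_{j=1}^n\tilde y_j^{\,x-1}(1-\tilde y_j)^{N-x-n+1}$$ on $0<\tilde y_1<\dots<\tilde y_n<1$, and density zero elsewhere. Equivalently,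 $(t_1,\dots,t_n)$ has joint density $T^{-n}$ times this expression at $\tilde y_j=t_j/T$, on $0<t_1<\dots<t_n<T$. 2. The vector $y=(2t_1/T-1,\dots,2t_n/T-1)$ has joint density $$\tilde C_{N,n,x}\prod_{i<j}(y_j-y_i)^2\prod_{j=1}^n(1+y_j)^{x-1}(1-y_j)^{N-x-n+1}$$ on $-1<y_1<\dots<y_n<1$, and density zero elsewhere. 3. The density in 2 is the eigenvalue density of the Jacobi Unitary Ensemble: for $n\times n$ complex Hermitian matrices $M$ let $$w(M)=\det(1+M)^{x-1}\det(1-M)^{N-x-n+1}\det(\chi_{(-1,1)}(M)),$$ where $\chi_{(-1,1)}$ is the indicator function of $(-1,1)$ applied to $M$ by the functional calculus, let $dM=\prod_i dM_{ii}\prod_{i<j}d(\operatorname{Re}M_{ij})\,d(\operatorname{Im}M_{ij})$, and let $Z_n=\int w(M)\,dM$. Then $0<Z_n<\infty$, and if $M$ is distributed according to $Z_n^{-1}w(M)\,dM$, its eigenvalues $\lambda_1\le\dots\le\lambda_n$ have the joint density of 2. -/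

import Mathlib

open MeasureTheory ProbabilityTheory
open scoped NNReal ENNReal Nat

noncomputable section

/-! ### Poisson processes and the bus model -/

/-- `X` is a Poisson process of rate one on `ℤ`, started at `a`: its paths are nondecreasing and
right-continuous, its increments are independent, and `X t - X s` is Poisson distributed with
parameter `t - s` for `s ≤ t`. -/
structure IsUnitPoissonProcess {Ω : Type*} [MeasurableSpace Ω] (P : Measure Ω) (a : ℤ)
    (X : ℝ≥0 → Ω → ℤ) : Prop where
  measurable : ∀ t, Measurable (X t)
  start : ∀ ω, X 0 ω = a
  monotone : ∀ ω, Monotone fun t => X t ω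
  rightContinuous : ∀ ω t, ContinuousWithinAt (fun s => X s ω) (Set.Ici t) t
  indepIncrements : HasIndepIncrements X P
  increments : ∀ s t : ℝ≥0, s ≤ t →
    HasLaw (fun ω => X t ω - X s ω) ((poissonMeasure (t - s)).map (fun k : ℕ => (k : ℤ))) P

/-- `n` independent buses, each a rate-one Poisson process. The buses are numbered from `0`, so
that bus `i` starts at `-i`: the initial positions are `0, -1, …, -(n - 1)`. -/
structure IsBusProcess {Ω : Type*} [MeasurableSpace Ω] (P : Measure Ω) (n : ℕ)
    (L : Fin n → ℝ≥0 → Ω → ℤ) : Prop where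
  poisson : ∀ i : Fin n, IsUnitPoissonProcess P (-((i : ℕ) : ℤ)) (L i)
  indep : iIndepFun (fun i ω t => L i t ω) P

/-- The event that no two buses are at the same site at any time in `[0, T]` and that the
positions at time `T` are `N, N - 1, …, N - n + 1`. -/
def nonIntersectionEvent {Ω : Type*} {n : ℕ} (L : Fin n → ℝ≥0 → Ω → ℤ) (N : ℕ) (T : ℝ≥0) :
    Set Ω :=
  {ω | (∀ t, t ≤ T → ∀ i j, i ≠ j → L i t ω ≠ L j t ω) ∧ ∀ i : Fin n, L i T ω = (N : ℤ) - ((i : ℕ) : ℤ)}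

/-- The first time at which the path of `X` is at the site `x`. -/
def arrivalTime {Ω : Type*} (X : ℝ≥0 → Ω → ℤ) (x : ℤ) (ω : Ω) : ℝ :=
  ((sInf {t : ℝ≥0 | X t ω = x} : ℝ≥0) : ℝ)

/-! ### The densities -/

/-- The configurations `a < y₁ < ⋯ < yₙ < b`. -/
def orderedChamber (n : ℕ) (a b : ℝ) : Set (Fin n → ℝ) :=
  {y | StrictMono y ∧ ∀ j, y j ∈ Set.Ioo a b}

/-- The measure on `ℝⁿ` with Lebesgue density `f` on `a < y₁ < ⋯ < yₙ < b`, and density zero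
elsewhere. -/
def orderedDensityMeasure (n : ℕ) (a b : ℝ) (f : (Fin n → ℝ) → ℝ) : Measure (Fin n → ℝ) :=
  (volume.restrict (orderedChamber n a b)).withDensity fun y => ENNReal.ofReal (f y)

/-- `∏_{i<j} (y_j - y_i)²`. -/
def vandermondeSq {n : ℕ} (y : Fin n → ℝ) : ℝ :=
  ∏ i, ∏ j ∈ Finset.Ioi i, (y j - y i) ^ 2

/-- The constant
`C_{N,n,x} = (∏_{i=1}^n 1/((x+i-2)! (N-x+1-i)!)) · (det (1/(N+i-j)!)_{i,j=1}^n)⁻¹`,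
with the indices shifted to start from zero. -/
def busConstant (N n x : ℕ) : ℝ :=
  (∏ i : Fin n, 1 / (((x + (i : ℕ) - 1)! : ℝ) * ((N - x - (i : ℕ))! : ℝ))) *
    (Matrix.det (Matrix.of fun i j : Fin n => 1 / ((N + (i : ℕ) - (j : ℕ))! : ℝ)))⁻¹

/-- `C̃_{N,n,x} = 2^{-nN} C_{N,n,x}`. -/
def busConstant' (N n x : ℕ) : ℝ := ((2 : ℝ) ^ (n * N))⁻¹ * busConstant N n x

/-- The density of the arrival times divided by `T`. -/
def unitDensity (N n x : ℕ) (y : Fin n → ℝ) : ℝ :=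
  busConstant N n x * vandermondeSq y * ∏ j, (y j ^ (x - 1) * (1 - y j) ^ (N + 1 - x - n))

/-- The Jacobi density on `(-1, 1)`. -/
def jacobiDensity (N n x : ℕ) (y : Fin n → ℝ) : ℝ :=
  busConstant' N n x * vandermondeSq y *
    ∏ j, ((1 + y j) ^ (x - 1) * (1 - y j) ^ (N + 1 - x - n))

/-! ### The Jacobi Unitary Ensemble -/

/-- Complex Hermitian `n × n` matrices. -/
def HermitianMatrix (n : ℕ) : Type := {M : Matrix (Fin n) (Fin n) ℂ // M.IsHermitian}

/-- The σ-algebra generated by the entries. -/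
instance (n : ℕ) : MeasurableSpace (HermitianMatrix n) :=
  MeasurableSpace.comap (fun M (p : Fin n × Fin n) => M.1 p.1 p.2) inferInstance

/-- Index pairs above the diagonal. -/
abbrev UpperPair (n : ℕ) : Type := {p : Fin n × Fin n // p.1 < p.2}

/-- Diagonal entries, and real and imaginary parts of the entries above the diagonal. -/
abbrev HermitianCoords (n : ℕ) : Type :=
  (Fin n → ℝ) × (UpperPair n → ℝ) × (UpperPair n → ℝ)

/-- The matrix with the given diagonal entries and the given entries above the diagonal. -/
def hermitianOfCoords {n : ℕ} (c : HermitianCoords n) : HermitianMatrix n :=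
  ⟨Matrix.of fun i j =>
      if h : i < j then ⟨c.2.1 ⟨(i, j), h⟩, c.2.2 ⟨(i, j), h⟩⟩
      else if h : j < i then ⟨c.2.1 ⟨(j, i), h⟩, -c.2.2 ⟨(j, i), h⟩⟩
      else (c.1 i : ℂ), by
    ext i j
    rcases lt_trichotomy i j with h | h | h
    · simp [Matrix.conjTranspose_apply, h, h.not_gt, Complex.ext_iff]
    · subst h; simp [Matrix.conjTranspose_apply]
    · simp [Matrix.conjTranspose_apply, h, h.not_gt, Complex.ext_iff]⟩

/-- `dM = ∏ dM_ii ∏_{i<j} d(Re M_ij) ∏_{i<j} d(Im M_ij)`. -/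
def hermitianVolume (n : ℕ) : Measure (HermitianMatrix n) :=
  (volume : Measure (HermitianCoords n)).map hermitianOfCoords

/-- `w(M) = det(1+M)^β det(1-M)^α det(χ_{(-1,1)}(M))`, where `χ_{(-1,1)}(M)` is formed by the
functional calculus; all three determinants are real. -/
def jacobiWeight {n : ℕ} (α β : ℕ) (M : HermitianMatrix n) : ℝ :=
  ((1 + M.1).det ^ β * (1 - M.1).det ^ α *
    (M.2.cfc (Set.indicator (Set.Ioo (-1 : ℝ) 1) fun _ => 1)).det).re

/-- `Z_n = ∫ w(M) dM`. -/
def jacobiPartition (n α β : ℕ) : ℝ≥0∞ :=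
  ∫⁻ M : HermitianMatrix n, ENNReal.ofReal (jacobiWeight α β M) ∂(hermitianVolume n)

/-- The Jacobi Unitary Ensemble `Z_n⁻¹ w(M) dM`. -/
def jacobiUnitaryEnsemble (n α β : ℕ) : Measure (HermitianMatrix n) :=
  (jacobiPartition n α β)⁻¹ •
    (hermitianVolume n).withDensity fun M => ENNReal.ofReal (jacobiWeight α β M)

/-- The eigenvalues, with multiplicity, in nondecreasing order (`Matrix.IsHermitian.eigenvalues₀`
lists them in nonincreasing order). -/
def orderedEigenvalues {n : ℕ} (M : HermitianMatrix n) : Fin n → ℝ :=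
  fun j => M.2.eigenvalues₀ (Fin.cast (Fintype.card_fin n).symm j.rev)

end

/-!
The proof has two halves, which meet in the normalization of the Jacobi density.

*Arrival times.* The paths of the buses are described by their passage times, that is by the times
at which bus `i` enters the successive sites. By independence of the increments these have, on the
event that the buses end at the prescribed sites, a constant density with respect to Lebesgue
measure on ordered tuples (`IsUnitPoissonProcess.map_jumpTimes`). The buses do not intersect if and
only if, up to a null event, the passage times at consecutive sites interlace
(`IsArrivalSystem.ne_iff_admissible`), so that the conditional law of the arrival times at `x` is
obtained by integrating out the layers of interlacing times at all other sites. A layer is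
integrated out one site at a time: the volume of the layers before the site `y` is the determinant
`leftMatrix` of divided powers `s ^ k / k!`, and integrating each row of such a determinant over
the interval left free by interlacing raises its exponents by one
(`lintegral_siteKernel_mul_leftMatrix`). The layers after `x` are treated by time reversal. At `x`
both determinants are Vandermonde determinants times powers, which gives the square of the
Vandermonde determinant and the Jacobi weight, and integrating out the last layer gives the
determinant in the normalizing constant (`hasLaw_arrivalTime`).

*Eigenvalues.* The Weyl integration formula `exists_lintegral_orderedEigenvalues` is proved, up to
the value of its constant, by induction on the size of the matrix. Border a Hermitian matrix `A`,
with simple spectrum `lam`, by a diagonal entry `c` and a vector `b`. In an eigenbasis of `A`, which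
leaves the Lebesgue measure of `b` unchanged, the characteristic polynomial of the bordered matrix
is `secularFun lam u`, where `u` consists of `c` and of the squared moduli of the entries of `b`;
the latter are distributed according to a multiple of Lebesgue measure on the positive reals. The
map from the new eigenvalues `μ` to `u` is a bijection from the tuples interlacing with `lam` onto
the tuples with positive squared moduli (`image_secularCoords`), and the absolute value of its
Jacobian is the quotient of the Vandermonde determinants of `μ` and `lam`
(`abs_det_secularJacobian`). Finally the integral of the Vandermonde determinant of `lam` over the
tuples interlacing with `μ` is a multiple of the Vandermonde determinant of `μ`
(`lintegral_vandermonde_interlacing`).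

The eigenvalue density of the Jacobi Unitary Ensemble is therefore proportional to the density of
the rescaled arrival times. As the latter is a probability density, the two are equal, and the
partition function of the ensemble is neither zero nor infinite
(`hasLaw_orderedEigenvalues_of_weyl`).
-/


/-! ### Divided powers and integrals of determinants -/

/-- The divided power `s ^ k / k!`, extended by zero to negative exponents. With this convention
`divPow k` is the derivative of `divPow (k + 1)` for every integer `k`. -/
noncomputable def divPow (k : ℤ) (s : ℝ) : ℝ := if k < 0 then 0 else s ^ k.toNat / (k.toNat)!

lemma divPow_natCast (k : ℕ) (s : ℝ) : divPow k s = s ^ k / k ! := by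
  simp [divPow]

lemma divPow_of_neg {k : ℤ} (hk : k < 0) (s : ℝ) : divPow k s = 0 := by
  simp [divPow, hk]

@[simp] lemma divPow_zero_left (s : ℝ) : divPow 0 s = 1 := by
  simp [divPow]

lemma divPow_zero_right {k : ℤ} (hk : k ≠ 0) : divPow k 0 = 0 := by
  rcases lt_or_gt_of_ne hk with h | h
  · exact divPow_of_neg h 0
  · lift k to ℕ using h.le
    rw [divPow_natCast, zero_pow (by exact_mod_cast hk), zero_div]

lemma hasDerivAt_divPow (k : ℤ) (s : ℝ) : HasDerivAt (divPow (k + 1)) (divPow k s) s := by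
  rcases lt_trichotomy k (-1) with h | h | h
  · have : divPow (k + 1) = fun _ => 0 := by ext t; exact divPow_of_neg (by omega) t
    rw [this, divPow_of_neg (by omega)]
    exact hasDerivAt_const s 0
  · subst h
    have : divPow (-1 + 1) = fun _ => 1 := by ext t; simp
    rw [this, divPow_of_neg (by omega)]
    exact hasDerivAt_const s 1
  · lift k to ℕ using by omega
    have : divPow ((k : ℤ) + 1) = fun t => t ^ (k + 1) / ((k + 1)! : ℝ) := by
      ext t; exact_mod_cast divPow_natCast (k + 1) t
    rw [this, divPow_natCast]
    refine ((hasDerivAt_pow (k + 1) s).div_const _).congr_deriv ?_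
    rw [Nat.factorial_succ]
    push_cast
    field_simp

lemma continuous_divPow (k : ℤ) : Continuous (divPow k) := by
  have h := hasDerivAt_divPow (k - 1)
  rw [sub_add_cancel] at h
  exact continuous_iff_continuousAt.2 fun s => (h s).continuousAt

lemma integrableOn_divPow (k : ℤ) {a b : ℝ} {s : Set ℝ} (hs : s ⊆ Set.Icc a b) :
    IntegrableOn (divPow k) s :=
  ((continuous_divPow k).integrableOn_Icc).mono_set hs

lemma setIntegral_divPow (k : ℤ) {a b : ℝ} (hab : a ≤ b) {s : Set ℝ} (hs : s ⊆ Set.Icc a b)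
    (hs' : Set.Ioo a b ⊆ s) :
    ∫ u in s, divPow k u = divPow (k + 1) b - divPow (k + 1) a := by
  have hae : s =ᵐ[volume] Set.Ioc a b :=
    (Filter.EventuallyLE.antisymm
      (hs.eventuallyLE.trans Ioc_ae_eq_Icc.symm.le)
      (Ioo_ae_eq_Ioc.symm.le.trans hs'.eventuallyLE))
  rw [setIntegral_congr_set hae, ← intervalIntegral.integral_of_le hab]
  exact intervalIntegral.integral_eq_sub_of_hasDerivAt (fun u _ => hasDerivAt_divPow k u)
    ((continuous_divPow k).intervalIntegrable a b)

section DetIntegral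

variable {ι : Type*} [Fintype ι] [DecidableEq ι] {ν : ι → Measure ℝ} [∀ i, SigmaFinite (ν i)]
  {f : ι → ι → ℝ → ℝ}

lemma integrable_det_of_rows (hf : ∀ i j, Integrable (f i j) (ν i)) :
    Integrable (fun z : ι → ℝ => (Matrix.of fun i j => f i j (z i)).det) (Measure.pi ν) := by
  simp_rw [← Matrix.det_transpose (Matrix.of _), Matrix.det_apply']
  refine integrable_finsetSum _ fun σ _ => ?_
  refine Integrable.const_mul ?_ _
  simp only [Matrix.transpose_apply, Matrix.of_apply]
  exact Integrable.fintype_prod (f := fun i s => f i (σ i) s) fun i => hf i (σ i)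

/-- If the `i`-th row of a matrix depends on the `i`-th variable only, then integrating its
determinant amounts to integrating its entries. -/
lemma integral_det_of_rows (hf : ∀ i j, Integrable (f i j) (ν i)) :
    ∫ z : ι → ℝ, (Matrix.of fun i j => f i j (z i)).det ∂(Measure.pi ν) =
      (Matrix.of fun i j => ∫ s, f i j s ∂(ν i)).det := by
  simp_rw [← Matrix.det_transpose (Matrix.of _), Matrix.det_apply']
  rw [integral_finsetSum]
  · refine Finset.sum_congr rfl fun σ _ => ?_
    rw [integral_const_mul]
    congr 1
    simp only [Matrix.transpose_apply, Matrix.of_apply]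
    exact integral_fintype_prod_eq_prod (fun i s => f i (σ i) s)
  · intro σ _
    refine Integrable.const_mul ?_ _
    simp only [Matrix.transpose_apply, Matrix.of_apply]
    exact Integrable.fintype_prod (f := fun i s => f i (σ i) s) fun i => hf i (σ i)

lemma lintegral_det_of_rows (hf : ∀ i j, Integrable (f i j) (ν i))
    (h0 : ∀ᵐ z ∂(Measure.pi ν), 0 ≤ (Matrix.of fun i j => f i j (z i)).det) :
    ∫⁻ z : ι → ℝ, ENNReal.ofReal (Matrix.of fun i j => f i j (z i)).det ∂(Measure.pi ν) =
      ENNReal.ofReal (Matrix.of fun i j => ∫ s, f i j s ∂(ν i)).det := by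
  rw [← integral_det_of_rows hf, ofReal_integral_eq_lintegral_ofReal (integrable_det_of_rows hf) h0]

end DetIntegral

/-- A row whose diagonal entry is the only nonzero entry of its column may be altered off the
diagonal without changing the determinant. -/
lemma Matrix.det_eq_of_col_eq_single {n : ℕ} {A B : Matrix (Fin (n + 1)) (Fin (n + 1)) ℝ}
    (p : Fin (n + 1)) (hrow : ∀ i, i ≠ p → A i = B i) (hp : A p p = B p p)
    (hcol : ∀ i, i ≠ p → A i p = 0) : A.det = B.det := by
  rw [Matrix.det_succ_column A p, Matrix.det_succ_column B p]
  refine Finset.sum_congr rfl fun i _ => ?_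
  by_cases hi : i = p
  · subst hi
    rw [hp]
    congr 2
    ext a b
    simp only [Matrix.submatrix_apply]
    rw [hrow _ (Fin.succAbove_ne _ _)]
  · rw [← hrow i hi, hcol i hi]; simp

/-! ### Arrival times at the successive sites -/

/-- Bus `i`, which starts at `-i` and ends at `N - i`, arrives at the site `y` at a positive
time. -/
def Visits (N : ℕ) (y : ℤ) {n : ℕ} (i : Fin n) : Prop := -(i : ℤ) < y ∧ y ≤ (N : ℤ) - (i : ℤ)

instance (N : ℕ) (y : ℤ) {n : ℕ} (i : Fin n) : Decidable (Visits N y i) := by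
  unfold Visits; infer_instance

/-- The conventional arrival time at a site that is not visited: `0` behind the starting point,
`T` beyond the end point. -/
noncomputable def boundaryTime (T : ℝ) (y : ℤ) {n : ℕ} (i : Fin n) : ℝ :=
  if y ≤ -(i : ℤ) then 0 else T

/-- The reference measure for the arrival time of bus `i` at `y`. -/
noncomputable def siteMeasure (N : ℕ) (T : ℝ) (y : ℤ) {n : ℕ} (i : Fin n) : Measure ℝ :=
  if Visits N y i then volume else Measure.dirac (boundaryTime T y i)

instance (N : ℕ) (T : ℝ) (y : ℤ) {n : ℕ} (i : Fin n) : SigmaFinite (siteMeasure N T y i) := by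
  unfold siteMeasure; split_ifs <;> infer_instance

/-- The reference measure for the arrival times of all buses at `y`. -/
noncomputable def layerMeasure (N : ℕ) (T : ℝ) (n : ℕ) (y : ℤ) : Measure (Fin n → ℝ) :=
  Measure.pi fun i => siteMeasure N T y i

instance (N : ℕ) (T : ℝ) (n : ℕ) (y : ℤ) : SigmaFinite (layerMeasure N T n y) := by
  unfold layerMeasure; infer_instance

/-- The possible arrival times at the site `y`. -/
def layerSet (N : ℕ) (T : ℝ) (n : ℕ) (y : ℤ) : Set (Fin n → ℝ) :=
  {z | (∀ i, Visits N y i → z i ∈ Set.Ioo 0 T) ∧ (∀ i, ¬ Visits N y i → z i = boundaryTime T y i) ∧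
    ∀ i j, i < j → Visits N y i → Visits N y j → z i < z j}

/-- The interlacing of the arrival times `z` at `y` with the arrival times `z'` at `y + 1`: every
bus leaves `y` after its arrival there, and not after the arrival of the next bus at `y`. -/
def Interlaces (N : ℕ) (y : ℤ) {m : ℕ} (z z' : Fin (m + 1) → ℝ) : Prop :=
  (∀ k : Fin m, z' k.castSucc ≤ z k.succ) ∧
    ∀ i : Fin (m + 1), -(i : ℤ) ≤ y → y ≤ (N : ℤ) - (i : ℤ) → z i < z' i

/-- The indicator function of the admissible pairs of arrival times at `y` and `y + 1`. -/
noncomputable def siteKernel (N : ℕ) (T : ℝ) (m : ℕ) (y : ℤ) (z z' : Fin (m + 1) → ℝ) : ℝ≥0∞ :=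
  Set.indicator {p : (Fin (m + 1) → ℝ) × (Fin (m + 1) → ℝ) | p.1 ∈ layerSet N T (m + 1) y ∧
    p.2 ∈ layerSet N T (m + 1) (y + 1) ∧ Interlaces N y p.1 p.2} 1 (z, z')

lemma siteKernel_of_interlaces {N : ℕ} {T : ℝ} {m : ℕ} {y : ℤ} {z z' : Fin (m + 1) → ℝ}
    (h : z ∈ layerSet N T (m + 1) y ∧ z' ∈ layerSet N T (m + 1) (y + 1) ∧ Interlaces N y z z') :
    siteKernel N T m y z z' = 1 :=
  Set.indicator_of_mem (s := {p : (Fin (m + 1) → ℝ) × (Fin (m + 1) → ℝ) |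
    p.1 ∈ layerSet N T (m + 1) y ∧ p.2 ∈ layerSet N T (m + 1) (y + 1) ∧ Interlaces N y p.1 p.2})
    (a := (z, z')) h 1

lemma siteKernel_of_not_interlaces {N : ℕ} {T : ℝ} {m : ℕ} {y : ℤ} {z z' : Fin (m + 1) → ℝ}
    (h : ¬ (z ∈ layerSet N T (m + 1) y ∧ z' ∈ layerSet N T (m + 1) (y + 1) ∧
      Interlaces N y z z')) :
    siteKernel N T m y z z' = 0 :=
  Set.indicator_of_notMem (s := {p : (Fin (m + 1) → ℝ) × (Fin (m + 1) → ℝ) |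
    p.1 ∈ layerSet N T (m + 1) y ∧ p.2 ∈ layerSet N T (m + 1) (y + 1) ∧ Interlaces N y p.1 p.2})
    (a := (z, z')) h 1

lemma measurableSet_layerSet (N : ℕ) (T : ℝ) (n : ℕ) (y : ℤ) :
    MeasurableSet (layerSet N T n y) := by
  simp only [layerSet, Set.ofPred_and, Set.ofPred_forall]
  refine .inter (.iInter fun i => .iInter fun _ => ?_) (.inter (.iInter fun i => .iInter fun _ => ?_)
    (.iInter fun i => .iInter fun j => .iInter fun _ => .iInter fun _ => .iInter fun _ => ?_))
  · exact measurableSet_Ioo.preimage (measurable_pi_apply i)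
  · exact measurableSet_eq_fun (measurable_pi_apply i) measurable_const
  · exact measurableSet_lt (measurable_pi_apply i) (measurable_pi_apply j)

lemma measurable_siteKernel (N : ℕ) (T : ℝ) (m : ℕ) (y : ℤ) :
    Measurable (Function.uncurry (siteKernel N T m y)) := by
  refine Measurable.indicator measurable_one ?_
  simp only [Interlaces, Set.ofPred_and, Set.ofPred_forall]
  refine .inter ((measurableSet_layerSet N T _ y).preimage measurable_fst)
    (.inter ((measurableSet_layerSet N T _ (y + 1)).preimage measurable_snd)
      (.inter (.iInter fun k => ?_) (.iInter fun i => .iInter fun _ => .iInter fun _ => ?_)))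
  · exact measurableSet_le (by fun_prop) (by fun_prop)
  · exact measurableSet_lt (by fun_prop) (by fun_prop)

lemma layerMeasure_ae_eq_boundaryTime (N : ℕ) (T : ℝ) (n : ℕ) (y : ℤ) :
    ∀ᵐ z ∂(layerMeasure N T n y), ∀ i, ¬ Visits N y i → z i = boundaryTime T y i := by
  rw [Filter.eventually_all]
  intro i
  by_cases hi : Visits N y i
  · simp [hi]
  · have h : ∀ᵐ s ∂(siteMeasure N T y i), s = boundaryTime T y i := by
      rw [siteMeasure, if_neg hi, ae_dirac_eq]
      exact Filter.eventually_pure.2 rfl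
    filter_upwards [(Measure.tendsto_eval_ae_ae
      (μ := fun i : Fin n => siteMeasure N T y i) (i := i)).eventually h] with z hz _ using hz

/-- The number of the last jump of bus `i` that counts at the site `y`, shifted by one. -/
def clippedSite (N : ℕ) (y : ℤ) {n : ℕ} (i : Fin n) : ℤ :=
  max (1 - (i : ℤ)) (min y ((N : ℤ) + 1 - (i : ℤ)))

/-- The matrix whose determinant is the volume of the set of arrival times at the sites before
`y`, given the arrival times `z` at `y`. -/
noncomputable def leftMatrix (N : ℕ) (y : ℤ) {n : ℕ} (z : Fin n → ℝ) : Matrix (Fin n) (Fin n) ℝ :=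
  Matrix.of fun i j => divPow (clippedSite N y i - 1 + (j : ℤ)) (z i)

/-- The lower bound for the arrival time of bus `i` at a site, given the arrival times at the next
site. -/
noncomputable def previousTime {m : ℕ} (z : Fin (m + 1) → ℝ) (i : Fin (m + 1)) : ℝ :=
  Fin.cases 0 (fun k => z k.castSucc) i

/-- Integrating the rows of `leftMatrix N y` over the interlacing region gives a matrix with the
determinant of `leftMatrix N (y + 1)`: the two differ by row operations, and by one row which does
not matter when a new bus enters. -/
lemma det_leftMatrix_succ {N m : ℕ} (hN : m < N) {T : ℝ} {y : ℤ} {z' : Fin (m + 1) → ℝ}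
    (hz' : z' ∈ layerSet N T (m + 1) (y + 1)) :
    (Matrix.of fun i j : Fin (m + 1) => if Visits N y i then
        divPow (y + (j : ℤ)) (z' i) - divPow (y + (j : ℤ)) (previousTime z' i)
      else divPow (clippedSite N y i - 1 + (j : ℤ)) (boundaryTime T y i)).det =
      (leftMatrix N (y + 1) z').det := by
  obtain ⟨-, hbd, -⟩ := hz'
  set A : Matrix (Fin (m + 1)) (Fin (m + 1)) ℝ := Matrix.of fun i j : Fin (m + 1) =>
    if Visits N y i then
        divPow (y + (j : ℤ)) (z' i) - divPow (y + (j : ℤ)) (previousTime z' i)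
      else divPow (clippedSite N y i - 1 + (j : ℤ)) (boundaryTime T y i) with hA
  set B : Matrix (Fin (m + 1)) (Fin (m + 1)) ℝ := Matrix.of fun i j : Fin (m + 1) =>
    leftMatrix N (y + 1) z' i j - if Visits N y i then
      Fin.cases 0 (fun k : Fin m => leftMatrix N (y + 1) z' k.castSucc j) i else 0 with hB
  -- `B` arises by subtracting from the row of each bus that visits `y` the preceding row.
  have hBM : (leftMatrix N (y + 1) z').det = B.det := by
    refine Matrix.det_eq_of_forall_row_eq_smul_add_pred
      (fun k : Fin m => if Visits N y k.succ then 1 else 0) (fun j => ?_) (fun k j => ?_)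
    · simp [hB]
    · by_cases h : Visits N y k.succ <;> simp [hB, h]
  rw [hBM]
  have key : ∀ i : Fin (m + 1), y ≠ -(i : ℤ) → A i = B i := by
    intro i hi
    ext j
    simp only [hA, hB, Matrix.of_apply, leftMatrix]
    by_cases hv : Visits N y i
    · have hv' := hv
      obtain ⟨h1, h2⟩ := hv'
      have hc : clippedSite N (y + 1) i = y + 1 := by unfold clippedSite; omega
      simp only [if_pos hv, hc]
      congr 1
      · congr 1; ring
      · induction i using Fin.cases with
        | zero =>
          simp only [previousTime, Fin.cases_zero]
          exact divPow_zero_right (by simp at h1; omega)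
        | succ k =>
          have hk : clippedSite N (y + 1) k.castSucc = y + 1 := by
            simp only [Fin.val_succ] at h1 h2
            unfold clippedSite; simp only [Fin.val_castSucc]; push_cast at *; omega
          simp only [previousTime, Fin.cases_succ, hk]
          congr 1; ring
    · simp only [if_neg hv, sub_zero]
      unfold Visits at hv
      have hnv : ¬ Visits N (y + 1) i := by unfold Visits; omega
      rw [hbd i hnv]
      congr 1
      · unfold clippedSite; omega
      · unfold boundaryTime
        by_cases h : y ≤ -(i : ℤ)
        · rw [if_pos h, if_pos (by omega)]
        · rw [if_neg h, if_neg (by omega)]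
  -- `A` and `B` differ at most in the row of the bus `p` that starts at `y`. In that case column `p`
  -- of `A` is zero off the diagonal, so that only the diagonal entry of row `p` matters.
  by_cases hp : ∃ p : Fin (m + 1), y = -(p : ℤ)
  · obtain ⟨p, hp⟩ := hp
    have hne : ∀ i, i ≠ p → y ≠ -(i : ℤ) := fun i hi h => hi (Fin.ext (by omega))
    refine Matrix.det_eq_of_col_eq_single p (fun i hi => key i (hne i hi)) ?_ ?_
    · have hv : ¬ Visits N y p := by unfold Visits; omega
      simp only [hA, hB, Matrix.of_apply, if_neg hv, sub_zero, leftMatrix]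
      have h1 : clippedSite N y p - 1 + (p : ℤ) = 0 := by unfold clippedSite; omega
      have h2 : clippedSite N (y + 1) p - 1 + (p : ℤ) = 0 := by unfold clippedSite; omega
      rw [h1, h2]; simp
    · intro i hi
      simp only [hA, Matrix.of_apply]
      by_cases hv : Visits N y i
      · rw [if_pos hv, hp]; simp
      · rw [if_neg hv]
        have hi' := i.2
        unfold Visits at hv
        have hlt : (i : ℤ) < p := by
          have : (i : ℤ) ≠ p := fun h => hi (Fin.ext (by omega))
          omega
        rw [boundaryTime, if_pos (by omega)]
        exact divPow_zero_right (by unfold clippedSite; omega)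
  · push Not at hp
    congr 1
    ext i j
    rw [key i (hp i)]

lemma mem_Icc_of_mem_layerSet {N n : ℕ} {T : ℝ} (hT : 0 < T) {y : ℤ} {z : Fin n → ℝ}
    (hz : z ∈ layerSet N T n y) (i : Fin n) : z i ∈ Set.Icc 0 T := by
  by_cases hi : Visits N y i
  · exact Set.Ioo_subset_Icc_self (hz.1 i hi)
  · rw [hz.2.1 i hi, boundaryTime]
    split_ifs
    · exact ⟨le_rfl, hT.le⟩
    · exact ⟨hT.le, le_rfl⟩

/-- The range of the arrival time of bus `i` at `y`, given the arrival times `z'` at `y + 1`. -/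
def siteRange (N : ℕ) (y : ℤ) {m : ℕ} (z' : Fin (m + 1) → ℝ) (i : Fin (m + 1)) : Set ℝ :=
  {s | Visits N y i → previousTime z' i ≤ s ∧ s < z' i ∧ 0 < s}

lemma measurableSet_siteRange (N : ℕ) (y : ℤ) {m : ℕ} (z' : Fin (m + 1) → ℝ) (i : Fin (m + 1)) :
    MeasurableSet (siteRange N y z' i) := by
  simp only [siteRange, Set.ofPred_forall, Set.ofPred_and]
  exact .iInter fun _ => measurableSet_Ici.inter (measurableSet_Iio.inter measurableSet_Ioi)

lemma visits_succ_castSucc {N m : ℕ} {y : ℤ} {k : Fin m} (h : Visits N y k.succ) :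
    Visits N (y + 1) k.castSucc := by
  simp only [Visits, Fin.val_succ, Fin.val_castSucc] at *
  push_cast at *; omega

lemma previousTime_mem_Ico {N m : ℕ} {T : ℝ} (hT : 0 < T) {y : ℤ} {z' : Fin (m + 1) → ℝ}
    (hz' : z' ∈ layerSet N T (m + 1) (y + 1)) {i : Fin (m + 1)} (hi : Visits N y i) :
    previousTime z' i ∈ Set.Ico 0 (z' i) := by
  have hb : ¬ Visits N (y + 1) i → z' i = T := fun h => by
    rw [hz'.2.1 i h, boundaryTime, if_neg (by unfold Visits at *; omega)]
  induction i using Fin.cases with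
  | zero =>
    refine ⟨le_rfl, ?_⟩
    simp only [previousTime, Fin.cases_zero]
    by_cases h : Visits N (y + 1) (0 : Fin (m + 1))
    · exact (hz'.1 _ h).1
    · rw [hb h]; exact hT
  | succ k =>
    simp only [previousTime, Fin.cases_succ]
    refine ⟨(mem_Icc_of_mem_layerSet hT hz' _).1, ?_⟩
    have hk := visits_succ_castSucc hi
    by_cases h : Visits N (y + 1) k.succ
    · exact hz'.2.2 _ _ (Fin.castSucc_lt_succ) hk h
    · rw [hb h]; exact (hz'.1 _ hk).2

/-- Given the arrival times at `y + 1`, the interlacing region at `y` is a product of intervals. -/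
lemma interlaces_iff_mem_pi_siteRange {N m : ℕ} (hN : m < N) {T : ℝ} (hT : 0 < T) {y : ℤ}
    {z z' : Fin (m + 1) → ℝ} (hz' : z' ∈ layerSet N T (m + 1) (y + 1))
    (hz : ∀ i, ¬ Visits N y i → z i = boundaryTime T y i) :
    (z ∈ layerSet N T (m + 1) y ∧ z' ∈ layerSet N T (m + 1) (y + 1) ∧ Interlaces N y z z') ↔
      z ∈ Set.univ.pi (siteRange N y z') := by
  have hIcc := mem_Icc_of_mem_layerSet hT hz'
  constructor
  · rintro ⟨hzS, -, h1, h2⟩ i - hi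
    refine ⟨?_, h2 i hi.1.le hi.2, (hzS.1 i hi).1⟩
    induction i using Fin.cases with
    | zero => simpa [previousTime] using (hzS.1 0 hi).1.le
    | succ k => simpa [previousTime] using h1 k
  · intro h
    have hr : ∀ i, Visits N y i → previousTime z' i ≤ z i ∧ z i < z' i ∧ 0 < z i :=
      fun i hi => h i (Set.mem_univ i) hi
    refine ⟨⟨fun i hi => ⟨(hr i hi).2.2, (hr i hi).2.1.trans_le (hIcc i).2⟩, hz, ?_⟩, hz', ?_, ?_⟩
    · intro i j hij hi hj
      refine (hr i hi).2.1.trans_le (le_trans ?_ (hr j hj).1)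
      induction j using Fin.cases with
      | zero => exact absurd hij (Fin.not_lt_zero _)
      | succ k =>
        simp only [previousTime, Fin.cases_succ]
        rcases eq_or_lt_of_le (Fin.le_castSucc_iff.2 hij) with h | h
        · rw [h]
        · refine (hz'.2.2 _ _ h ?_ (visits_succ_castSucc hj)).le
          have : (i : ℕ) < k.succ := hij
          unfold Visits at *; omega
    · intro k
      by_cases hk : Visits N y k.succ
      · simpa [previousTime] using (hr _ hk).1
      · rw [hz _ hk, boundaryTime]
        split_ifs with h
        · have hk' : ¬ Visits N (y + 1) k.castSucc := by
            simp only [Visits, Fin.val_succ, Fin.val_castSucc] at *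
            push_cast at *; omega
          rw [hz'.2.1 _ hk', boundaryTime, if_pos]
          simp only [Fin.val_succ, Fin.val_castSucc] at *
          push_cast at *; omega
        · exact (hIcc _).2
    · intro i hi1 hi2
      by_cases hi : Visits N y i
      · exact (hr i hi).2.1
      · have hv : Visits N (y + 1) i := by
          have := i.2
          unfold Visits at *; omega
        rw [hz i hi, boundaryTime, if_pos (by unfold Visits at *; omega)]
        exact (hz'.1 i hv).1

lemma integral_siteMeasure_restrict {N m : ℕ} {T : ℝ} (hT : 0 < T) {y : ℤ}
    {z' : Fin (m + 1) → ℝ} (hz' : z' ∈ layerSet N T (m + 1) (y + 1)) (i j : Fin (m + 1)) :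
    Integrable (divPow (clippedSite N y i - 1 + (j : ℤ)))
      ((siteMeasure N T y i).restrict (siteRange N y z' i)) ∧
    ∫ s, divPow (clippedSite N y i - 1 + (j : ℤ)) s
      ∂((siteMeasure N T y i).restrict (siteRange N y z' i)) =
      if Visits N y i then
        divPow (y + (j : ℤ)) (z' i) - divPow (y + (j : ℤ)) (previousTime z' i)
      else divPow (clippedSite N y i - 1 + (j : ℤ)) (boundaryTime T y i) := by
  by_cases hi : Visits N y i
  · have hp := previousTime_mem_Ico hT hz' hi
    have hc : clippedSite N y i = y := by unfold Visits at hi; unfold clippedSite; omega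
    have hsub : siteRange N y z' i ⊆ Set.Icc (previousTime z' i) (z' i) :=
      fun s hs => ⟨(hs hi).1, (hs hi).2.1.le⟩
    rw [siteMeasure, if_pos hi, if_pos hi, hc]
    refine ⟨integrableOn_divPow _ hsub, ?_⟩
    rw [setIntegral_divPow _ hp.2.le hsub fun s hs _ => ⟨hs.1.le, hs.2, hp.1.trans_lt hs.1⟩]
    have : y - 1 + (j : ℤ) + 1 = y + j := by ring
    rw [this]
  · have hr : siteRange N y z' i = Set.univ := by
      ext s; simp [siteRange, hi]
    rw [siteMeasure, if_neg hi, if_neg hi, hr, Measure.restrict_univ]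
    exact ⟨integrable_dirac (by simp), integral_dirac _ _⟩

/-- Given the arrival times at `y + 1`, the admissible arrival times at `y` form a box, over which
the determinant is integrated row by row. -/
theorem lintegral_siteKernel_mul_leftMatrix {N m : ℕ} (hN : m < N) {T : ℝ} (hT : 0 < T) {y : ℤ}
    (h0 : ∀ z ∈ layerSet N T (m + 1) y, 0 ≤ (leftMatrix N y z).det)
    {z' : Fin (m + 1) → ℝ} (hz' : z' ∈ layerSet N T (m + 1) (y + 1)) :
    ∫⁻ z, siteKernel N T m y z z' * ENNReal.ofReal (leftMatrix N y z).det
        ∂(layerMeasure N T (m + 1) y) = ENNReal.ofReal (leftMatrix N (y + 1) z').det ∧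
      0 ≤ (leftMatrix N (y + 1) z').det := by
  have hae := layerMeasure_ae_eq_boundaryTime N T (m + 1) y
  have hmeas : MeasurableSet (Set.univ.pi (siteRange N y z')) :=
    MeasurableSet.univ_pi fun i => measurableSet_siteRange N y z' i
  have hint := integral_siteMeasure_restrict (N := N) hT hz'
  have hnn : ∀ᵐ z ∂(Measure.pi fun i => (siteMeasure N T y i).restrict (siteRange N y z' i)),
      0 ≤ (leftMatrix N y z).det := by
    rw [← Measure.restrict_pi_pi]
    filter_upwards [ae_restrict_of_ae hae, ae_restrict_mem hmeas] with z h1 h2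
    exact h0 z ((interlaces_iff_mem_pi_siteRange hN hT hz' h1).2 h2).1
  have hdet : (Matrix.of fun i j : Fin (m + 1) =>
      ∫ s, divPow (clippedSite N y i - 1 + (j : ℤ)) s
        ∂((siteMeasure N T y i).restrict (siteRange N y z' i))).det =
      (leftMatrix N (y + 1) z').det := by
    rw [← det_leftMatrix_succ hN hz']
    congr 1
    ext i j
    exact (hint i j).2
  constructor
  · calc _ = ∫⁻ z, (Set.univ.pi (siteRange N y z')).indicator
          (fun z => ENNReal.ofReal (leftMatrix N y z).det) z ∂(layerMeasure N T (m + 1) y) := by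
          refine lintegral_congr_ae ?_
          filter_upwards [hae] with z hz
          have := interlaces_iff_mem_pi_siteRange hN hT hz' hz
          by_cases h : z ∈ Set.univ.pi (siteRange N y z')
          · rw [Set.indicator_of_mem h, siteKernel_of_interlaces (this.2 h), one_mul]
          · rw [Set.indicator_of_notMem h,
              siteKernel_of_not_interlaces (fun h' => h (this.1 h')), zero_mul]
      _ = _ := by
          rw [lintegral_indicator hmeas, layerMeasure, Measure.restrict_pi_pi, ← hdet]
          exact lintegral_det_of_rows (f := fun i j => divPow (clippedSite N y i - 1 + (j : ℤ)))
            (fun i j => (hint i j).1) hnn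
  · rw [← hdet, ← integral_det_of_rows
      (f := fun i j => divPow (clippedSite N y i - 1 + (j : ℤ))) (fun i j => (hint i j).1)]
    exact integral_nonneg_of_ae hnn

/-! ### Integration along a chain -/

section Chain

variable {E : Type*} [MeasurableSpace E]

lemma lintegral_pi_fin_succ {n : ℕ} (μ : Fin (n + 1) → Measure E) [∀ i, SigmaFinite (μ i)]
    {f : (Fin (n + 1) → E) → ℝ≥0∞} (hf : Measurable f) :
    ∫⁻ z, f z ∂(Measure.pi μ) =
      ∫⁻ a, ∫⁻ w, f (Fin.cons a w) ∂(Measure.pi fun j : Fin n => μ j.succ) ∂(μ 0) := by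
  have h := (measurePreserving_piFinSuccAbove μ 0).symm
  rw [← h.lintegral_comp hf]
  refine (lintegral_prod (μ := μ 0) (ν := Measure.pi fun j : Fin n => μ j.succ) _
    (hf.comp h.measurable).aemeasurable).trans
      (lintegral_congr fun a => lintegral_congr fun w => ?_)
  exact congrArg f (Fin.insertNth_zero' a w)

/-- One step of integration along a chain: the variable `z` is integrated out. -/
noncomputable def chainStep (κ : E → E → ℝ≥0∞) (μ : Measure E) (G : E → ℝ≥0∞) (z' : E) : ℝ≥0∞ :=
  ∫⁻ z, κ z z' * G z ∂μ

/-- The result of integrating out `p` variables, starting from the left end. -/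
noncomputable def chainLeft (κ : ℕ → E → E → ℝ≥0∞) (μ : ℕ → Measure E) :
    ℕ → ℕ → (E → ℝ≥0∞) → E → ℝ≥0∞
  | 0, _, G => G
  | p + 1, a, G => chainLeft κ μ p (a + 1) (chainStep (κ a) (μ a) G)

/-- The result of integrating out the `r` variables that follow a given one. -/
noncomputable def chainRight (κ : ℕ → E → E → ℝ≥0∞) (μ : ℕ → Measure E) :
    ℕ → ℕ → E → ℝ≥0∞
  | 0, _, _ => 1
  | r + 1, a, z => ∫⁻ z', κ a z z' * chainRight κ μ r (a + 1) z' ∂(μ (a + 1))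

variable {κ : ℕ → E → E → ℝ≥0∞} {μ : ℕ → Measure E} [∀ k, SigmaFinite (μ k)]

lemma measurable_chainStep {κ : E → E → ℝ≥0∞} {μ : Measure E} [SigmaFinite μ]
    (hκ : Measurable (Function.uncurry κ)) {G : E → ℝ≥0∞} (hG : Measurable G) :
    Measurable (chainStep κ μ G) := by
  have : Measurable (Function.uncurry fun z' z => κ z z' * G z) :=
    (hκ.comp measurable_swap).mul (hG.comp measurable_snd)
  exact this.lintegral_prod_right'

lemma measurable_chainProd (hκ : ∀ k, Measurable (Function.uncurry (κ k))) (M a : ℕ) :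
    Measurable fun z : Fin (M + 1) → E => ∏ k : Fin M, κ (a + k) (z k.castSucc) (z k.succ) := by
  refine Finset.measurable_fun_prod _ fun k _ => ?_
  have : Measurable fun z : Fin (M + 1) → E => (z k.castSucc, z k.succ) := by fun_prop
  exact (hκ (a + k)).comp this

omit [MeasurableSpace E] in
lemma chainProd_cons (M a : ℕ) (z : E) (w : Fin (M + 1) → E) :
    ∏ k : Fin (M + 1), κ (a + k) ((Fin.cons z w : Fin (M + 2) → E) k.castSucc)
        ((Fin.cons z w : Fin (M + 2) → E) k.succ) =
      κ a z (w 0) * ∏ k : Fin M, κ (a + 1 + k) (w k.castSucc) (w k.succ) := by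
  rw [Fin.prod_univ_succ]
  congr 1
  refine Finset.prod_congr rfl fun k _ => ?_
  have : a + (k.succ : ℕ) = a + 1 + k := by simp; ring
  rw [this]
  congr 1

lemma lintegral_chain_right (hκ : ∀ k, Measurable (Function.uncurry (κ k))) (M : ℕ) :
    ∀ (a : ℕ) (G : E → ℝ≥0∞), Measurable G →
    ∫⁻ z : Fin (M + 1) → E, (∏ k : Fin M, κ (a + k) (z k.castSucc) (z k.succ)) * G (z 0)
      ∂(Measure.pi fun k : Fin (M + 1) => μ (a + k)) =
    ∫⁻ z, G z * chainRight κ μ M a z ∂(μ a) := by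
  induction M with
  | zero =>
    intro a G hG
    rw [lintegral_pi_fin_succ _ (by fun_prop)]
    simp [chainRight]
  | succ M ih =>
    intro a G hG
    have hmeas : Measurable fun z : Fin (M + 1 + 1) → E =>
        (∏ k : Fin (M + 1), κ (a + k) (z k.castSucc) (z k.succ)) * G (z 0) :=
      (measurable_chainProd hκ _ a).mul (hG.comp (measurable_pi_apply 0))
    rw [lintegral_pi_fin_succ _ hmeas]
    simp only [chainProd_cons, Fin.cons_zero]
    refine lintegral_congr fun z => ?_
    have hκz : Measurable (κ a z) := (hκ a).comp measurable_prodMk_left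
    have hm : (fun j : Fin (M + 1) => μ (a + (j.succ : ℕ))) =
        fun j : Fin (M + 1) => μ (a + 1 + (j : ℕ)) := by
      ext1 j; congr 1; simp; ring
    rw [hm, chainRight, ← ih (a + 1) (κ a z) hκz, ← lintegral_const_mul]
    · refine lintegral_congr fun w => ?_
      ring
    · exact (measurable_chainProd hκ _ _).mul (hκz.comp (measurable_pi_apply 0))

/-- The integral along a chain of a function of the `p`-th variable is the integral of this function
against the product of the contributions of the two sides. -/
theorem lintegral_chain (hκ : ∀ k, Measurable (Function.uncurry (κ k))) {F : E → ℝ≥0∞}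
    (hF : Measurable F) (p : ℕ) :
    ∀ (r M : ℕ) (hM : M = p + r) (a : ℕ) (G : E → ℝ≥0∞), Measurable G →
    ∫⁻ z : Fin (M + 1) → E, (∏ k : Fin M, κ (a + k) (z k.castSucc) (z k.succ)) *
        (G (z 0) * F (z ⟨p, by omega⟩)) ∂(Measure.pi fun k : Fin (M + 1) => μ (a + k)) =
    ∫⁻ z, chainLeft κ μ p a G z * F z * chainRight κ μ r (a + p) z ∂(μ (a + p)) := by
  induction p with
  | zero =>
    intro r M hM a G hG
    obtain rfl : M = r := by omega
    exact lintegral_chain_right hκ M a (fun z => G z * F z) (hG.mul hF)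
  | succ p ih =>
    intro r M hM a G hG
    obtain ⟨M, rfl⟩ : ∃ M', M = M' + 1 := ⟨p + r, by omega⟩
    have hM' : M = p + r := by omega
    have hmeas : Measurable fun z : Fin (M + 1 + 1) → E =>
        (∏ k : Fin (M + 1), κ (a + k) (z k.castSucc) (z k.succ)) *
          (G (z 0) * F (z ⟨p + 1, by omega⟩)) :=
      (measurable_chainProd hκ _ a).mul
        ((hG.comp (measurable_pi_apply 0)).mul (hF.comp (measurable_pi_apply _)))
    rw [lintegral_pi_fin_succ _ hmeas]
    have hm : (fun j : Fin (M + 1) => μ (a + (j.succ : ℕ))) =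
        fun j : Fin (M + 1) => μ (a + 1 + (j : ℕ)) := by
      ext1 j; congr 1; simp; ring
    simp only [chainProd_cons, Fin.cons_zero]
    rw [hm, lintegral_lintegral_swap]
    · have := ih r M hM' (a + 1) (chainStep (κ a) (μ a) G) (measurable_chainStep (hκ a) hG)
      have h1 : a + (p + 1) = a + 1 + p := by ring
      rw [h1, chainLeft, ← this]
      refine lintegral_congr fun w => ?_
      have hκw : Measurable fun z => κ a z (w 0) := (hκ a).comp measurable_prodMk_right
      have hκG : Measurable fun z => κ a z (w 0) * G z := hκw.mul hG
      rw [chainStep, ← lintegral_mul_const _ hκG, ← lintegral_const_mul]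
      · refine lintegral_congr fun z => ?_
        have h2 : (Fin.cons z w : Fin (M + 2) → E) ⟨p + 1, by omega⟩ = w ⟨p, by omega⟩ := rfl
        rw [h2]
        ring
      · exact hκG.mul_const _
    · have h1 : Measurable fun q : E × (Fin (M + 1) → E) => κ a q.1 (q.2 0) :=
        (hκ a).comp (measurable_fst.prodMk ((measurable_pi_apply 0).comp measurable_snd))
      have h2 := (measurable_chainProd hκ M (a + 1)).comp
        (measurable_snd : Measurable (Prod.snd : E × (Fin (M + 1) → E) → _))
      have h3 : Measurable fun q : E × (Fin (M + 1) → E) => F (q.2 ⟨p, by omega⟩) :=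
        hF.comp ((measurable_pi_apply _).comp measurable_snd)
      exact ((h1.mul h2).mul ((hG.comp measurable_fst).mul h3)).aemeasurable

end Chain

/-! ### The two sides of a site -/

/-- The reflection that exchanges the buses, the sites and the direction of time. -/
def timeReflection (T : ℝ) {n : ℕ} (z : Fin n → ℝ) (i : Fin n) : ℝ := T - z i.rev

lemma timeReflection_timeReflection (T : ℝ) {n : ℕ} (z : Fin n → ℝ) :
    timeReflection T (timeReflection T z) = z := by
  ext i; simp [timeReflection]

section Reflection

variable {N m : ℕ} {T : ℝ} {y y' : ℤ}

lemma visits_rev_iff (h : y + y' = (N : ℤ) + 1 - m) (i : Fin (m + 1)) :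
    Visits N y' i.rev ↔ Visits N y i := by
  have h2 : ((i.rev : ℕ) : ℤ) = m - i := by rw [Fin.val_rev]; omega
  unfold Visits; rw [h2]; omega

lemma boundaryTime_rev (h : y + y' = (N : ℤ) + 1 - m) {i : Fin (m + 1)} (hi : ¬ Visits N y i) :
    boundaryTime T y' i.rev = T - boundaryTime T y i := by
  have h2 : ((i.rev : ℕ) : ℤ) = m - i := by rw [Fin.val_rev]; omega
  unfold Visits at hi
  unfold boundaryTime; rw [h2]
  by_cases h3 : y ≤ -(i : ℤ)
  · rw [if_pos h3, if_neg (by omega), sub_zero]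
  · rw [if_neg h3, if_pos (by omega), sub_self]

lemma timeReflection_mem_layerSet (h : y + y' = (N : ℤ) + 1 - m) {z : Fin (m + 1) → ℝ}
    (hz : z ∈ layerSet N T (m + 1) y) : timeReflection T z ∈ layerSet N T (m + 1) y' := by
  have hv : ∀ i : Fin (m + 1), Visits N y' i ↔ Visits N y i.rev := fun i => by
    rw [← visits_rev_iff h, Fin.rev_rev]
  refine ⟨fun i hi => ?_, fun i hi => ?_, fun i j hij hi hj => ?_⟩
  · have := hz.1 i.rev ((hv i).1 hi)
    exact ⟨by simpa [timeReflection] using this.2, by simpa [timeReflection] using this.1⟩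
  · have hi' : ¬ Visits N y i.rev := fun h' => hi ((hv i).2 h')
    have := boundaryTime_rev (T := T) h hi'
    rw [Fin.rev_rev] at this
    rw [timeReflection, hz.2.1 _ hi', this]
  · have := hz.2.2 j.rev i.rev (Fin.rev_lt_rev.2 hij) ((hv j).1 hj) ((hv i).1 hi)
    simp only [timeReflection]
    linarith

lemma timeReflection_mem_layerSet_iff (h : y + y' = (N : ℤ) + 1 - m) {z : Fin (m + 1) → ℝ} :
    timeReflection T z ∈ layerSet N T (m + 1) y' ↔ z ∈ layerSet N T (m + 1) y := by
  refine ⟨fun hz => ?_, timeReflection_mem_layerSet h⟩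
  have := timeReflection_mem_layerSet (y := y') (y' := y) (by omega) hz
  rwa [timeReflection_timeReflection] at this

lemma interlaces_timeReflection (h : y + y' = (N : ℤ) + 1 - m) {z z' : Fin (m + 1) → ℝ}
    (hz : Interlaces N y z z') :
    Interlaces N (y' - 1) (timeReflection T z') (timeReflection T z) := by
  refine ⟨fun k => ?_, fun i h1 h2 => ?_⟩
  · have := hz.1 k.rev
    simp only [timeReflection, Fin.rev_castSucc, Fin.rev_succ]
    linarith
  · have h3 : ((i.rev : ℕ) : ℤ) = m - i := by rw [Fin.val_rev]; omega
    have := hz.2 i.rev (by omega) (by omega)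
    simp only [timeReflection]
    linarith

lemma siteKernel_timeReflection (h : y + y' = (N : ℤ) + 1 - m) (z z' : Fin (m + 1) → ℝ) :
    siteKernel N T m (y' - 1) (timeReflection T z') (timeReflection T z) =
      siteKernel N T m y z z' := by
  have key : (timeReflection T z' ∈ layerSet N T (m + 1) (y' - 1) ∧
      timeReflection T z ∈ layerSet N T (m + 1) (y' - 1 + 1) ∧
      Interlaces N (y' - 1) (timeReflection T z') (timeReflection T z)) ↔
      (z ∈ layerSet N T (m + 1) y ∧ z' ∈ layerSet N T (m + 1) (y + 1) ∧ Interlaces N y z z') := by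
    rw [timeReflection_mem_layerSet_iff (y := y + 1) (by omega), sub_add_cancel,
      timeReflection_mem_layerSet_iff h]
    refine ⟨fun ⟨h1, h2, h3⟩ => ⟨h2, h1, ?_⟩, fun ⟨h1, h2, h3⟩ =>
      ⟨h2, h1, interlaces_timeReflection h h3⟩⟩
    have := interlaces_timeReflection (T := T) (y := y' - 1) (y' := y + 1) (by omega) h3
    rwa [timeReflection_timeReflection, timeReflection_timeReflection, add_sub_cancel_right] at this
  by_cases h' : z ∈ layerSet N T (m + 1) y ∧ z' ∈ layerSet N T (m + 1) (y + 1) ∧ Interlaces N y z z'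
  · rw [siteKernel_of_interlaces h', siteKernel_of_interlaces (key.2 h')]
  · rw [siteKernel_of_not_interlaces h', siteKernel_of_not_interlaces (fun h'' => h' (key.1 h''))]

lemma map_siteMeasure_sub (h : y + y' = (N : ℤ) + 1 - m) (i : Fin (m + 1)) :
    (siteMeasure N T y i).map (fun s => T - s) = siteMeasure N T y' i.rev := by
  unfold siteMeasure
  by_cases hi : Visits N y i
  · rw [if_pos hi, if_pos ((visits_rev_iff h i).2 hi)]
    exact (Measure.measurePreserving_sub_left volume T).map_eq
  · rw [if_neg hi, if_neg (fun h' => hi ((visits_rev_iff h i).1 h')),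
      boundaryTime_rev h hi]
    exact Measure.map_dirac' (by fun_prop) _

lemma measurePreserving_timeReflection (h : y + y' = (N : ℤ) + 1 - m) :
    MeasurePreserving (timeReflection T) (layerMeasure N T (m + 1) y)
      (layerMeasure N T (m + 1) y') := by
  have hmeas : Measurable (timeReflection T : (Fin (m + 1) → ℝ) → Fin (m + 1) → ℝ) :=
    by unfold timeReflection; fun_prop
  refine ⟨hmeas, (Measure.pi_eq fun s hs => ?_).symm⟩
  rw [Measure.map_apply hmeas (MeasurableSet.univ_pi hs)]
  have : timeReflection T ⁻¹' (Set.univ.pi s) =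
      Set.univ.pi fun i : Fin (m + 1) => (fun u => T - u) ⁻¹' (s i.rev) := by
    ext z
    simp only [Set.mem_preimage, Set.mem_univ_pi, timeReflection]
    exact ⟨fun h i => by simpa using h i.rev, fun h i => by simpa using h i.rev⟩
  rw [this, layerMeasure, Measure.pi_pi]
  rw [← Equiv.prod_comp Fin.revPerm (fun i => siteMeasure N T y' i (s i))]
  refine Finset.prod_congr rfl fun i _ => ?_
  rw [Fin.revPerm_apply, ← map_siteMeasure_sub h, Measure.map_apply (by fun_prop) (hs _)]

end Reflection

section Sides

variable {N m : ℕ} {T : ℝ}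

lemma measurable_det_leftMatrix (N : ℕ) (y : ℤ) (n : ℕ) :
    Measurable fun z : Fin n → ℝ => (leftMatrix N y z).det := by
  refine Continuous.measurable (Continuous.matrix_det (continuous_matrix fun i j => ?_))
  exact (continuous_divPow _).comp (continuous_apply i)

lemma det_leftMatrix_of_le {y : ℤ} (hy : y ≤ -(m : ℤ)) {z : Fin (m + 1) → ℝ}
    (hz : z ∈ layerSet N T (m + 1) y) : (leftMatrix N y z).det = 1 := by
  have : leftMatrix N y z = 1 := by
    ext i j
    have hi := i.2
    have hv : ¬ Visits N y i := by unfold Visits; omega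
    have hc : clippedSite N y i - 1 + (j : ℤ) = j - i := by unfold clippedSite; omega
    rw [leftMatrix, Matrix.of_apply, hz.2.1 i hv, boundaryTime, if_pos (by omega), hc]
    by_cases hij : i = j
    · subst hij; simp
    · rw [Matrix.one_apply_ne hij]
      exact divPow_zero_right fun h => hij (Fin.ext (by omega))
  rw [this, Matrix.det_one]

lemma chainLeft_siteKernel (hN : m < N) (hT : 0 < T) (p : ℕ) :
    ∀ (a : ℕ) (G : (Fin (m + 1) → ℝ) → ℝ≥0∞),
    (∀ z ∈ layerSet N T (m + 1) ((a : ℤ) - m),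
      G z = ENNReal.ofReal (leftMatrix N ((a : ℤ) - m) z).det ∧
        0 ≤ (leftMatrix N ((a : ℤ) - m) z).det) →
    ∀ z ∈ layerSet N T (m + 1) (((a + p : ℕ) : ℤ) - m),
      chainLeft (fun k => siteKernel N T m ((k : ℤ) - m))
          (fun k => layerMeasure N T (m + 1) ((k : ℤ) - m)) p a G z =
        ENNReal.ofReal (leftMatrix N (((a + p : ℕ) : ℤ) - m) z).det ∧
      0 ≤ (leftMatrix N (((a + p : ℕ) : ℤ) - m) z).det := by
  induction p with
  | zero => intro a G hG z hz; exact hG z hz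
  | succ p ih =>
    intro a G hG
    have h1 : a + (p + 1) = a + 1 + p := by ring
    rw [h1]
    refine ih (a + 1) _ fun z' hz' => ?_
    have h2 : (((a + 1 : ℕ) : ℤ) - m) = (a : ℤ) - m + 1 := by push_cast; ring
    rw [h2] at hz' ⊢
    obtain ⟨h3, h4⟩ := lintegral_siteKernel_mul_leftMatrix hN hT (fun z hz => (hG z hz).2) hz'
    refine ⟨?_, h4⟩
    rw [← h3, chainStep]
    refine lintegral_congr fun z => ?_
    by_cases hz : z ∈ layerSet N T (m + 1) ((a : ℤ) - m)
    · rw [(hG z hz).1]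
    · dsimp only
      rw [siteKernel_of_not_interlaces fun h => hz h.1, zero_mul, zero_mul]

lemma det_leftMatrix_nonneg (hN : m < N) (hT : 0 < T) {y : ℤ} (hy : -(m : ℤ) ≤ y)
    {z : Fin (m + 1) → ℝ} (hz : z ∈ layerSet N T (m + 1) y) : 0 ≤ (leftMatrix N y z).det := by
  obtain ⟨p, hp⟩ : ∃ p : ℕ, y = ((0 + p : ℕ) : ℤ) - m := ⟨(y + m).toNat, by omega⟩
  subst hp
  refine (chainLeft_siteKernel hN hT p 0 (fun _ => 1) (fun w hw => ?_) z hz).2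
  rw [det_leftMatrix_of_le (by simp) hw]
  simp

/-- By reflection, the contribution of the sites beyond a given one has the same form as that of the
sites before it. -/
lemma chainRight_siteKernel (hN : m < N) (hT : 0 < T) (r : ℕ) :
    ∀ (a : ℕ), a + r = N + m + 1 → ∀ z ∈ layerSet N T (m + 1) ((a : ℤ) - m),
      chainRight (fun k => siteKernel N T m ((k : ℤ) - m))
          (fun k => layerMeasure N T (m + 1) ((k : ℤ) - m)) r a z =
        ENNReal.ofReal (leftMatrix N ((N : ℤ) + 1 - a) (timeReflection T z)).det := by
  induction r with
  | zero =>
    intro a ha z hz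
    have hR := timeReflection_mem_layerSet (y' := (N : ℤ) + 1 - a) (by ring) hz
    rw [det_leftMatrix_of_le (by omega) hR]
    simp [chainRight]
  | succ r ih =>
    intro a ha z hz
    have hsum : ((a : ℤ) - m) + ((N : ℤ) + 1 - a) = (N : ℤ) + 1 - m := by ring
    have hR := timeReflection_mem_layerSet (y' := (N : ℤ) + 1 - a) hsum hz
    have hmp := measurePreserving_timeReflection (N := N) (m := m) (T := T)
      (y := ((a + 1 : ℕ) : ℤ) - m) (y' := (N : ℤ) - a) (by push_cast; ring)
    have h1 : (N : ℤ) - a + 1 = (N : ℤ) + 1 - a := by ring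
    have hstep := (lintegral_siteKernel_mul_leftMatrix hN hT (y := (N : ℤ) - a)
      (fun w hw => det_leftMatrix_nonneg hN hT (by omega) hw)
      (z' := timeReflection T z) (by rwa [h1])).1
    rw [h1] at hstep
    have hmeas : Measurable fun w => siteKernel N T m ((N : ℤ) - a) w (timeReflection T z) *
        ENNReal.ofReal (leftMatrix N ((N : ℤ) - a) w).det :=
      ((measurable_siteKernel N T m _).comp measurable_prodMk_right).mul
        (measurable_det_leftMatrix N _ _).ennreal_ofReal
    rw [← hstep, chainRight, ← hmp.lintegral_comp hmeas]
    refine lintegral_congr fun z' => ?_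
    have h2 := siteKernel_timeReflection (T := T) hsum z z'
    have h3 : (N : ℤ) + 1 - a - 1 = (N : ℤ) - a := by ring
    rw [h3] at h2
    rw [h2]
    by_cases hz' : z' ∈ layerSet N T (m + 1) (((a + 1 : ℕ) : ℤ) - m)
    · rw [ih (a + 1) (by omega) z' hz']
      have h5 : (N : ℤ) + 1 - ((a + 1 : ℕ) : ℤ) = (N : ℤ) - a := by push_cast; ring
      rw [h5]
    · have : siteKernel N T m ((a : ℤ) - m) z z' = 0 := by
        refine siteKernel_of_not_interlaces fun h => hz' ?_
        have h4 : ((a + 1 : ℕ) : ℤ) - m = (a : ℤ) - m + 1 := by push_cast; ring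
        rw [h4]
        exact h.2.1
      rw [this, zero_mul, zero_mul]

/-- The indicator function of the admissible arrival times at all sites, the site of index `k`
being `k - m`. -/
noncomputable def siteProd (N : ℕ) (T : ℝ) (m : ℕ) (z : Fin (N + m + 2) → Fin (m + 1) → ℝ) :
    ℝ≥0∞ :=
  ∏ k : Fin (N + m + 1), siteKernel N T m ((k : ℤ) - m) (z k.castSucc) (z k.succ)

lemma lintegral_siteProd_mul {F : (Fin (m + 1) → ℝ) → ℝ≥0∞}
    (hF : Measurable F) {p r : ℕ} (hp : N + m + 1 = p + r) :
    ∫⁻ z, siteProd N T m z * F (z ⟨p, by omega⟩)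
      ∂(Measure.pi fun k : Fin (N + m + 2) => layerMeasure N T (m + 1) ((k : ℤ) - m)) =
    ∫⁻ z, chainLeft (fun k => siteKernel N T m ((k : ℤ) - m))
          (fun k => layerMeasure N T (m + 1) ((k : ℤ) - m)) p 0 1 z * F z *
        chainRight (fun k => siteKernel N T m ((k : ℤ) - m))
          (fun k => layerMeasure N T (m + 1) ((k : ℤ) - m)) r p z
      ∂(layerMeasure N T (m + 1) ((p : ℤ) - m)) := by
  have := lintegral_chain (κ := fun k => siteKernel N T m ((k : ℤ) - m))
    (μ := fun k => layerMeasure N T (m + 1) ((k : ℤ) - m))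
    (fun k => measurable_siteKernel N T m _) hF p r _ hp 0 1 measurable_one
  simp only [zero_add, Pi.one_apply, one_mul] at this
  exact this

lemma chainLeft_siteKernel_one (hN : m < N) (hT : 0 < T) {p : ℕ} {z : Fin (m + 1) → ℝ}
    (hz : z ∈ layerSet N T (m + 1) ((p : ℤ) - m)) :
    chainLeft (fun k => siteKernel N T m ((k : ℤ) - m))
      (fun k => layerMeasure N T (m + 1) ((k : ℤ) - m)) p 0 1 z =
        ENNReal.ofReal (leftMatrix N ((p : ℤ) - m) z).det := by
  have := (chainLeft_siteKernel hN hT p 0 1 (fun w hw => ?_) z (by simpa using hz)).1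
  · simpa using this
  · rw [det_leftMatrix_of_le (by simp) hw]
    simp

/-- The integral of a function of the arrival times at one site over all admissible arrival
times. -/
theorem lintegral_siteProd_mul_eq (hN : m < N) (hT : 0 < T) {F : (Fin (m + 1) → ℝ) → ℝ≥0∞}
    (hF : Measurable F) {p : ℕ} (hp : p < N + m + 1) :
    ∫⁻ z, siteProd N T m z * F (z ⟨p, by omega⟩)
      ∂(Measure.pi fun k : Fin (N + m + 2) => layerMeasure N T (m + 1) ((k : ℤ) - m)) =
    ∫⁻ z in layerSet N T (m + 1) ((p : ℤ) - m), ENNReal.ofReal (leftMatrix N ((p : ℤ) - m) z).det *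
      F z * ENNReal.ofReal (leftMatrix N ((N : ℤ) + 1 - p) (timeReflection T z)).det
      ∂(layerMeasure N T (m + 1) ((p : ℤ) - m)) := by
  obtain ⟨r, hr⟩ : ∃ r, N + m + 1 = p + (r + 1) := ⟨N + m - p, by omega⟩
  rw [lintegral_siteProd_mul hF hr, ← lintegral_indicator (measurableSet_layerSet _ _ _ _)]
  refine lintegral_congr fun z => ?_
  by_cases hz : z ∈ layerSet N T (m + 1) ((p : ℤ) - m)
  · rw [Set.indicator_of_mem hz, chainLeft_siteKernel_one hN hT hz,
      chainRight_siteKernel hN hT _ p hr.symm z hz]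
  · rw [Set.indicator_of_notMem hz]
    have : chainRight (fun k => siteKernel N T m ((k : ℤ) - m))
        (fun k => layerMeasure N T (m + 1) ((k : ℤ) - m)) (r + 1) p z = 0 := by
      rw [chainRight]
      refine (lintegral_congr fun z' => ?_).trans lintegral_zero
      rw [siteKernel_of_not_interlaces fun h => hz h.1, zero_mul]
    rw [this, mul_zero]

/-- The volume of the set of all admissible arrival times. -/
theorem lintegral_siteProd (hN : m < N) (hT : 0 < T) :
    ∫⁻ z, siteProd N T m z
      ∂(Measure.pi fun k : Fin (N + m + 2) => layerMeasure N T (m + 1) ((k : ℤ) - m)) =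
    ENNReal.ofReal (Matrix.of fun i j : Fin (m + 1) => divPow ((N : ℤ) - i + j) T).det := by
  have h := lintegral_siteProd_mul (T := T) (F := 1) measurable_one (p := N + m + 1) (r := 0) rfl
  simp only [Pi.one_apply, mul_one, chainRight] at h
  rw [h]
  have hv : ∀ i : Fin (m + 1), ¬ Visits N (((N + m + 1 : ℕ) : ℤ) - m) i := fun i => by
    unfold Visits; push_cast; omega
  have hb : ∀ i : Fin (m + 1), boundaryTime T (((N + m + 1 : ℕ) : ℤ) - m) i = T := fun i => by
    rw [boundaryTime, if_neg (by push_cast; omega)]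
  -- No bus gets beyond the site `N`, so all arrival times at the last site take the value `T`.
  have hμ : layerMeasure N T (m + 1) (((N + m + 1 : ℕ) : ℤ) - m) =
      Measure.dirac fun _ : Fin (m + 1) => T := by
    refine Measure.pi_eq fun s hs => ?_
    simp only [siteMeasure, if_neg (hv _), hb]
    simp only [Measure.dirac_apply' _ (MeasurableSet.univ_pi hs), Measure.dirac_apply' _ (hs _)]
    by_cases h : ∀ i, T ∈ s i
    · have h' : (fun _ : Fin (m + 1) => T) ∈ Set.univ.pi s := fun i _ => h i
      rw [Set.indicator_of_mem h']
      simp [Set.indicator_of_mem (h _)]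
    · have h' : (fun _ : Fin (m + 1) => T) ∉ Set.univ.pi s := fun h' =>
        h fun i => h' i (Set.mem_univ i)
      rw [Set.indicator_of_notMem h']
      push Not at h
      obtain ⟨i, hi⟩ := h
      exact (Finset.prod_eq_zero (Finset.mem_univ i) (Set.indicator_of_notMem hi _)).symm
  have hmem : (fun _ : Fin (m + 1) => T) ∈ layerSet N T (m + 1) (((N + m + 1 : ℕ) : ℤ) - m) :=
    ⟨fun i hi => absurd hi (hv i), fun i _ => (hb i).symm, fun i _ _ hi => absurd hi (hv i)⟩
  rw [hμ, lintegral_dirac, chainLeft_siteKernel_one hN hT hmem]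
  congr 2
  ext i j
  rw [leftMatrix, Matrix.of_apply, Matrix.of_apply]
  congr 1
  unfold clippedSite; push_cast; omega

end Sides

/-! ### Passage times of a Poisson process -/

/-- The first time at which the path of `X` has reached `y`, and `T` if this does not happen
before `T`. -/
noncomputable def passageTime {Ω : Type*} (X : ℝ≥0 → Ω → ℤ) (T : ℝ≥0) (y : ℤ) (ω : Ω) : ℝ :=
  ((sInf ({t | y ≤ X t ω} ∪ {T}) : ℝ≥0) : ℝ)

section PassageTime

variable {Ω : Type*} {X : ℝ≥0 → Ω → ℤ} {T : ℝ≥0} {y : ℤ} {ω : Ω}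

lemma passageTime_nonneg : 0 ≤ passageTime X T y ω := NNReal.coe_nonneg _

lemma passageTime_le : passageTime X T y ω ≤ T :=
  NNReal.coe_le_coe.2 (csInf_le (OrderBot.bddBelow _) (Or.inr rfl))

lemma passageTime_le_of_le {t : ℝ≥0} (h : y ≤ X t ω) : passageTime X T y ω ≤ t :=
  NNReal.coe_le_coe.2 (csInf_le (OrderBot.bddBelow _) (Or.inl h))

lemma le_of_passageTime_le_of_lt (hmono : Monotone fun t => X t ω)
    (hrc : ∀ t, ContinuousWithinAt (fun s => X s ω) (Set.Ici t) t) {t : ℝ≥0} (ht : t < T)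
    (h : passageTime X T y ω ≤ t) : y ≤ X t ω := by
  set S : Set ℝ≥0 := {t | y ≤ X t ω} ∪ {T} with hS
  have hne : S.Nonempty := ⟨T, Or.inr rfl⟩
  have hglb : IsGLB S (sInf S) := isGLB_csInf hne (OrderBot.bddBelow _)
  have hle : sInf S ≤ t := NNReal.coe_le_coe.1 h
  have hfreq := hglb.frequently_mem hne
  have hev : ∀ᶠ s in nhdsWithin (sInf S) (Set.Ici (sInf S)), X s ω = X (sInf S) ω := by
    have := hrc (sInf S)
    rw [ContinuousWithinAt, nhds_discrete, Filter.tendsto_pure] at this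
    exact this
  have hlt : ∀ᶠ s in nhdsWithin (sInf S) (Set.Ici (sInf S)), s < T :=
    Filter.Eventually.filter_mono nhdsWithin_le_nhds (eventually_lt_nhds (hle.trans_lt ht))
  obtain ⟨s, hs, hs1, hs2⟩ := (hfreq.and_eventually (hev.and hlt)).exists
  rcases hs with hs | hs
  · exact (hs1 ▸ hs : y ≤ X (sInf S) ω).trans (hmono hle)
  · exact absurd hs hs2.ne

lemma passageTime_le_iff (hmono : Monotone fun t => X t ω)
    (hrc : ∀ t, ContinuousWithinAt (fun s => X s ω) (Set.Ici t) t) {t : ℝ≥0} (ht : t ≤ T)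
    (hy : y ≤ X T ω) : passageTime X T y ω ≤ t ↔ y ≤ X t ω := by
  rcases ht.lt_or_eq with h | h
  · exact ⟨le_of_passageTime_le_of_lt hmono hrc h, passageTime_le_of_le⟩
  · subst h
    exact ⟨fun _ => hy, fun _ => passageTime_le⟩

lemma passageTime_of_le_start (hy : y ≤ X 0 ω) : passageTime X T y ω = 0 :=
  le_antisymm (by simpa using passageTime_le_of_le (T := T) hy) passageTime_nonneg

lemma passageTime_of_lt (hmono : Monotone fun t => X t ω) (hy : X T ω < y) :
    passageTime X T y ω = T := by
  refine le_antisymm passageTime_le (NNReal.coe_le_coe.2 (le_csInf ⟨T, Or.inr rfl⟩ ?_))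
  rintro t (ht | ht)
  · by_contra! h
    exact absurd (lt_of_lt_of_le hy ht) (hmono h.le).not_gt
  · exact ht.ge

lemma measurable_passageTime {mΩ : MeasurableSpace Ω} (hX : ∀ t, Measurable (X t))
    (hmono : ∀ ω, Monotone fun t => X t ω)
    (hrc : ∀ ω t, ContinuousWithinAt (fun s => X s ω) (Set.Ici t) t) (T : ℝ≥0) (y : ℤ) :
    Measurable (passageTime X T y) := by
  refine measurable_of_Iic fun c => ?_
  rcases lt_or_ge c 0 with hc | hc
  · convert MeasurableSet.empty
    ext ω
    simpa using hc.trans_le passageTime_nonneg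
  · lift c to ℝ≥0 using hc
    rcases lt_or_ge c T with h | h
    · have : passageTime X T y ⁻¹' Set.Iic (c : ℝ) = X c ⁻¹' Set.Ici y := by
        ext ω
        exact ⟨le_of_passageTime_le_of_lt (hmono ω) (hrc ω) h, passageTime_le_of_le⟩
      rw [this]
      exact hX c measurableSet_Ici
    · convert MeasurableSet.univ
      ext ω
      simpa using passageTime_le.trans (NNReal.coe_le_coe.2 h)

end PassageTime

section Increments

variable {Ω : Type*} [MeasurableSpace Ω] {P : Measure Ω} {a : ℤ} {X : ℝ≥0 → Ω → ℤ}

lemma IsUnitPoissonProcess.measure_increment_eq (hX : IsUnitPoissonProcess P a X) {s t : ℝ≥0}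
    (hst : s ≤ t) (c : ℕ) :
    P ((fun ω => X t ω - X s ω) ⁻¹' {(c : ℤ)}) =
      ENNReal.ofReal (Real.exp (-((t : ℝ) - s)) * ((t : ℝ) - s) ^ c / c !) := by
  have h := hX.increments s t hst
  have h1 : (fun k : ℕ => (k : ℤ)) ⁻¹' {(c : ℤ)} = {c} := by ext; simp
  rw [← Measure.map_apply_of_aemeasurable h.aemeasurable (measurableSet_singleton _), h.map_eq,
    Measure.map_apply (measurable_of_countable _) (measurableSet_singleton _), h1,
    poissonMeasure_singleton, NNReal.coe_sub hst]

lemma IsUnitPoissonProcess.measure_increments_eq (hX : IsUnitPoissonProcess P a X)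
    {t : ℕ → ℝ≥0} (ht : Monotone t) (c : ℕ → ℕ) (M : ℕ) :
    P {ω | ∀ j < M, X (t (j + 1)) ω - X (t j) ω = c j} =
      ∏ j ∈ Finset.range M, ENNReal.ofReal
        (Real.exp (-((t (j + 1) : ℝ) - t j)) * ((t (j + 1) : ℝ) - t j) ^ c j / (c j)!) := by
  have hind := hX.indepIncrements M (fun i => t i) (fun i j hij => ht hij)
  have := hind.meas_iInter (s := fun j : Fin M =>
    (fun ω => X (t (j + 1)) ω - X (t j) ω) ⁻¹' {(c j : ℤ)})
    (fun j => ⟨{(c j : ℤ)}, measurableSet_singleton _, rfl⟩)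
  have hset : {ω | ∀ j < M, X (t (j + 1)) ω - X (t j) ω = c j} =
      ⋂ j : Fin M, (fun ω => X (t (j + 1)) ω - X (t j) ω) ⁻¹' {(c j : ℤ)} := by
    ext ω
    simp only [Set.mem_ofPred_eq, Set.mem_iInter, Set.mem_preimage, Set.mem_singleton_iff]
    exact ⟨fun h j => h j j.2, fun h j hj => h ⟨j, hj⟩⟩
  rw [hset, this, ← Fin.prod_univ_eq_prod_range (fun j => ENNReal.ofReal
        (Real.exp (-((t (j + 1) : ℝ) - t j)) * ((t (j + 1) : ℝ) - t j) ^ c j / (c j)!))]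
  exact Finset.prod_congr rfl fun j _ => hX.measure_increment_eq (ht (Nat.le_succ _)) _

end Increments

/-- The end points of `N` successive intervals `(lo k, hi k]`, preceded by `0` and followed by
`T`. -/
noncomputable def endpointGrid {N : ℕ} (lo hi : Fin N → ℝ≥0) (T : ℝ≥0) : ℕ → ℝ≥0
  | 0 => 0
  | j + 1 => if h : j / 2 < N then (if j % 2 = 0 then lo ⟨j / 2, h⟩ else hi ⟨j / 2, h⟩) else T

section Grid

variable {N : ℕ} {lo hi : Fin N → ℝ≥0} {T : ℝ≥0}

lemma endpointGrid_odd (k : Fin N) : endpointGrid lo hi T (2 * k + 1) = lo k := by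
  have h1 : 2 * (k : ℕ) / 2 = k := by omega
  simp [endpointGrid, h1]

lemma endpointGrid_even (k : Fin N) : endpointGrid lo hi T (2 * k + 2) = hi k := by
  have h1 : (2 * (k : ℕ) + 1) / 2 = k := by omega
  have h2 : (2 * (k : ℕ) + 1) % 2 = 1 := by omega
  simp [endpointGrid, h1, h2]

lemma endpointGrid_last {j : ℕ} (hj : 2 * N < j) : endpointGrid lo hi T j = T := by
  obtain ⟨j, rfl⟩ : ∃ i, j = i + 1 := ⟨j - 1, by omega⟩
  rw [endpointGrid, dif_neg (by omega)]

lemma monotone_endpointGrid (h1 : ∀ k, lo k ≤ hi k) (h2 : ∀ k, hi k ≤ T)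
    (h3 : ∀ k l, k < l → hi k ≤ lo l) : Monotone (endpointGrid lo hi T) := by
  refine monotone_nat_of_le_succ fun j => ?_
  rcases Nat.even_or_odd' j with ⟨k, rfl | rfl⟩
  · rcases Nat.eq_zero_or_pos k with rfl | hk
    · exact zero_le
    · obtain ⟨k, rfl⟩ : ∃ i, k = i + 1 := ⟨k - 1, by omega⟩
      by_cases hkN : k < N
      · have e1 := endpointGrid_even (lo := lo) (hi := hi) (T := T) ⟨k, hkN⟩
        by_cases hkN' : k + 1 < N
        · have e2 := endpointGrid_odd (lo := lo) (hi := hi) (T := T) ⟨k + 1, hkN'⟩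
          exact e1.le.trans ((h3 _ _ (by simp)).trans e2.ge)
        · rw [endpointGrid_last (j := 2 * (k + 1) + 1) (by omega)]
          exact e1.le.trans (h2 _)
      · rw [endpointGrid_last (by omega), endpointGrid_last (by omega)]
  · by_cases hkN : k < N
    · have e1 := endpointGrid_odd (lo := lo) (hi := hi) (T := T) ⟨k, hkN⟩
      have e2 := endpointGrid_even (lo := lo) (hi := hi) (T := T) ⟨k, hkN⟩
      exact e1.le.trans ((h1 _).trans e2.ge)
    · rw [endpointGrid_last (by omega), endpointGrid_last (by omega)]

end Grid

section JumpTimes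

variable {Ω : Type*} [MeasurableSpace Ω] {P : Measure Ω} {a : ℤ} {X : ℝ≥0 → Ω → ℤ} {N : ℕ}
  {T : ℝ≥0}

lemma prod_range_two_mul_succ {M : Type*} [CommMonoid M] (f : ℕ → M) (N : ℕ) :
    ∏ j ∈ Finset.range (2 * N + 1), f j =
      f (2 * N) * ∏ k ∈ Finset.range N, (f (2 * k) * f (2 * k + 1)) := by
  rw [Finset.prod_range_succ, mul_comm]
  congr 1
  induction N with
  | zero => simp
  | succ N ih =>
    rw [Nat.mul_succ, Finset.prod_range_succ, Finset.prod_range_succ, ih,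
      Finset.prod_range_succ _ N, mul_assoc]

/-- The jump times lie in prescribed successive intervals if and only if the increments of the
process are `0` and `1` in turn along the end points of these intervals. -/
lemma IsUnitPoissonProcess.jumpTimes_mem_iff (hX : IsUnitPoissonProcess P a X)
    {lo hi : Fin N → ℝ≥0} (h1 : ∀ k, lo k ≤ hi k) (h2 : ∀ k, hi k ≤ T)
    (h3 : ∀ k l, k < l → hi k ≤ lo l) (ω : Ω) :
    (X T ω = a + N ∧ ∀ k : Fin N,
        passageTime X T (a + (k : ℤ) + 1) ω ∈ Set.Ioc (lo k : ℝ) (hi k)) ↔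
      ∀ j < 2 * N + 1, X (endpointGrid lo hi T (j + 1)) ω - X (endpointGrid lo hi T j) ω =
        ((j % 2 : ℕ) : ℤ) := by
  have hm := hX.monotone ω
  have hg := monotone_endpointGrid h1 h2 h3
  have hlast : endpointGrid lo hi T (2 * N + 1) = T := endpointGrid_last (by omega)
  have hpass : X T ω = a + N → ∀ (k : Fin N) (t : ℝ≥0), t ≤ T →
      (passageTime X T (a + (k : ℤ) + 1) ω ≤ t ↔ a + (k : ℤ) + 1 ≤ X t ω) := fun hT k t ht =>
    passageTime_le_iff hm (hX.rightContinuous ω) ht (by rw [hT]; have := k.2; omega)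
  constructor
  -- By monotonicity, the value at the `j`-th grid point is squeezed to be `a + ⌊j / 2⌋`.
  · rintro ⟨hT, h⟩
    have hlo : ∀ k : Fin N, X (lo k) ω ≤ a + k := fun k => by
      have := (hpass hT k (lo k) ((h1 k).trans (h2 k))).not.1 (not_le.2 (h k).1)
      omega
    have hhi : ∀ k : Fin N, a + k + 1 ≤ X (hi k) ω := fun k =>
      (hpass hT k (hi k) (h2 k)).1 (h k).2
    have hval : ∀ j ≤ 2 * N + 1, X (endpointGrid lo hi T j) ω = a + ((j / 2 : ℕ) : ℤ) := by
      have hub : ∀ k ≤ N, X (endpointGrid lo hi T (2 * k + 1)) ω ≤ a + k := fun k hk => by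
        rcases hk.lt_or_eq with hk | hk
        · rw [endpointGrid_odd ⟨k, hk⟩]; exact hlo ⟨k, hk⟩
        · rw [hk, hlast, hT]
      have hlb : ∀ k ≤ N, a + k ≤ X (endpointGrid lo hi T (2 * k)) ω := fun k hk => by
        rcases Nat.eq_zero_or_pos k with rfl | hk0
        · simp [endpointGrid, hX.start ω]
        · obtain ⟨k, rfl⟩ : ∃ i, k = i + 1 := ⟨k - 1, by omega⟩
          have := hhi ⟨k, by omega⟩
          rw [Nat.mul_succ, endpointGrid_even ⟨k, by omega⟩]
          push_cast at *
          linarith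
      intro j hj
      have hle : X (endpointGrid lo hi T (2 * (j / 2))) ω ≤ X (endpointGrid lo hi T j) ω :=
        hm (hg (by omega))
      have hge : X (endpointGrid lo hi T j) ω ≤ X (endpointGrid lo hi T (2 * (j / 2) + 1)) ω :=
        hm (hg (by omega))
      exact le_antisymm (hge.trans (hub _ (by omega))) ((hlb _ (by omega)).trans hle)
    intro j hj
    rw [hval _ (by omega), hval _ (by omega)]
    omega
  · intro h
    have hval : ∀ j ≤ 2 * N + 1, X (endpointGrid lo hi T j) ω = a + ((j / 2 : ℕ) : ℤ) := by
      intro j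
      induction j with
      | zero => intro _; simp [endpointGrid, hX.start ω]
      | succ j ih =>
        intro hj
        have h4 := h j (by omega)
        rw [ih (by omega)] at h4
        omega
    have hT : X T ω = a + N := by
      have := hval (2 * N + 1) le_rfl
      rw [hlast] at this
      rw [this]; omega
    refine ⟨hT, fun k => ⟨?_, ?_⟩⟩
    · refine not_le.1 ((hpass hT k (lo k) ((h1 k).trans (h2 k))).not.2 ?_)
      have := hval (2 * k + 1) (by have := k.2; omega)
      rw [endpointGrid_odd] at this
      omega
    · refine (hpass hT k (hi k) (h2 k)).2 ?_
      have := hval (2 * k + 2) (by have := k.2; omega)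
      rw [endpointGrid_even] at this
      omega

lemma IsUnitPoissonProcess.measure_jumpTimes_mem (hX : IsUnitPoissonProcess P a X)
    {lo hi : Fin N → ℝ≥0} (h1 : ∀ k, lo k ≤ hi k) (h2 : ∀ k, hi k ≤ T)
    (h3 : ∀ k l, k < l → hi k ≤ lo l) :
    P {ω | X T ω = a + N ∧ ∀ k : Fin N,
        passageTime X T (a + (k : ℤ) + 1) ω ∈ Set.Ioc (lo k : ℝ) (hi k)} =
      ENNReal.ofReal (Real.exp (-T)) * ∏ k, ENNReal.ofReal ((hi k : ℝ) - lo k) := by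
  have hg := monotone_endpointGrid h1 h2 h3
  set t := endpointGrid lo hi T with ht
  have hnn : ∀ j, 0 ≤ (t (j + 1) : ℝ) - t j := fun j =>
    sub_nonneg.2 (NNReal.coe_le_coe.2 (hg (Nat.le_succ j)))
  have hlast : t (2 * N + 1) = T := endpointGrid_last (by omega)
  simp_rw [hX.jumpTimes_mem_iff h1 h2 h3]
  rw [hX.measure_increments_eq hg (fun j => j % 2),
    ← ENNReal.ofReal_prod_of_nonneg (fun k _ => sub_nonneg.2 (NNReal.coe_le_coe.2 (h1 k))),
    ← ENNReal.ofReal_mul (Real.exp_nonneg _), ← ENNReal.ofReal_prod_of_nonneg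
      (fun j _ => by have := hnn j; positivity)]
  congr 1
  have hfac : ∀ j : ℕ, ((j % 2)! : ℝ) = 1 := fun j => by
    rcases Nat.mod_two_eq_zero_or_one j with h | h <;> simp [h]
  simp only [hfac, div_one]
  rw [Finset.prod_mul_distrib, ← Real.exp_sum]
  congr 1
  · congr 1
    rw [Finset.sum_neg_distrib, Finset.sum_range_sub (fun j => (t j : ℝ)), hlast]
    simp [ht, endpointGrid]
  · rw [prod_range_two_mul_succ, ← Fin.prod_univ_eq_prod_range (fun k =>
      ((t (2 * k + 1) : ℝ) - t (2 * k)) ^ (2 * k % 2) *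
        ((t (2 * k + 1 + 1) : ℝ) - t (2 * k + 1)) ^ ((2 * k + 1) % 2))]
    have e1 : ∀ k : ℕ, 2 * k % 2 = 0 := fun k => by omega
    have e2 : ∀ k : ℕ, (2 * k + 1) % 2 = 1 := fun k => by omega
    simp only [e1, e2, pow_zero, pow_one, one_mul]
    refine Finset.prod_congr rfl fun k _ => ?_
    rw [ht, endpointGrid_odd, endpointGrid_even]

end JumpTimes

/-! ### The joint law of the jump times -/

lemma strictMono_fin_cons_iff {n : ℕ} {y : ℝ} {w : Fin n → ℝ} :
    StrictMono (Fin.cons y w : Fin (n + 1) → ℝ) ↔ (∀ i, y < w i) ∧ StrictMono w := by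
  constructor
  · intro h
    refine ⟨fun i => ?_, fun i j hij => ?_⟩
    · simpa using h (Fin.succ_pos i)
    · simpa using h (Fin.succ_lt_succ_iff.2 hij)
  · rintro ⟨h1, h2⟩ i j hij
    induction j using Fin.cases with
    | zero => exact absurd hij (Fin.not_lt_zero _)
    | succ j =>
      induction i using Fin.cases with
      | zero => simpa using h1 j
      | succ i => simpa using h2 (Fin.succ_lt_succ_iff.1 hij)

lemma measurableSet_setOf_strictMono (n : ℕ) : MeasurableSet {y : Fin n → ℝ | StrictMono y} := by
  simp only [StrictMono, Set.ofPred_forall]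
  exact .iInter fun i => .iInter fun j => .iInter fun _ =>
    measurableSet_lt (measurable_pi_apply i) (measurable_pi_apply j)

lemma measurableSet_orderedChamber (n : ℕ) (a b : ℝ) : MeasurableSet (orderedChamber n a b) := by
  have : orderedChamber n a b = {y | StrictMono y} ∩ ⋂ j, (fun y => y j) ⁻¹' Set.Ioo a b := by
    ext y; simp [orderedChamber]
  rw [this]
  refine (measurableSet_setOf_strictMono n).inter ?_
  exact .iInter fun j => measurableSet_Ioo.preimage (measurable_pi_apply j)

lemma cons_mem_orderedChamber_iff {n : ℕ} {a b y : ℝ} {w : Fin n → ℝ} :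
    (Fin.cons y w : Fin (n + 1) → ℝ) ∈ orderedChamber (n + 1) a b ↔
      y ∈ Set.Ioo a b ∧ w ∈ orderedChamber n y b := by
  simp only [orderedChamber, Set.mem_ofPred_eq, strictMono_fin_cons_iff, Set.mem_Ioo,
    Fin.forall_fin_succ, Fin.cons_zero, Fin.cons_succ]
  exact ⟨fun ⟨⟨h1, h2⟩, h3, h4⟩ => ⟨h3, h2, fun i => ⟨h1 i, (h4 i).2⟩⟩,
    fun ⟨h1, h2, h3⟩ => ⟨⟨fun i => (h3 i).1, h2⟩, h1, fun i => ⟨h1.1.trans (h3 i).1, (h3 i).2⟩⟩⟩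

lemma volume_orderedChamber (n : ℕ) {a b : ℝ} (hab : a ≤ b) :
    volume (orderedChamber n a b) = ENNReal.ofReal (divPow n (b - a)) := by
  induction n generalizing a with
  | zero =>
    have : orderedChamber 0 a b = Set.univ := by
      ext y
      simp [orderedChamber, Subsingleton.strictMono]
    rw [this, volume_pi, Measure.pi_of_empty]
    simp
  | succ n ih =>
    rw [← lintegral_indicator_one (measurableSet_orderedChamber _ _ _), volume_pi,
      lintegral_pi_fin_succ _ (measurable_one.indicator (measurableSet_orderedChamber _ _ _))]
    have h1 : ∀ y : ℝ, ∫⁻ w : Fin n → ℝ, (orderedChamber (n + 1) a b).indicator 1 (Fin.cons y w)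
        ∂(Measure.pi fun _ => volume) =
        (Set.Ioo a b).indicator (fun y => ENNReal.ofReal (divPow n (b - y))) y := by
      intro y
      by_cases hy : y ∈ Set.Ioo a b
      · rw [Set.indicator_of_mem hy, ← ih hy.2.le, ← volume_pi,
          ← lintegral_indicator_one (measurableSet_orderedChamber _ _ _)]
        refine lintegral_congr fun w => ?_
        by_cases hw : w ∈ orderedChamber n y b
        · rw [Set.indicator_of_mem hw,
            Set.indicator_of_mem (cons_mem_orderedChamber_iff.2 ⟨hy, hw⟩)]
          rfl
        · rw [Set.indicator_of_notMem hw,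
            Set.indicator_of_notMem fun h => hw (cons_mem_orderedChamber_iff.1 h).2]
      · rw [Set.indicator_of_notMem hy]
        refine (lintegral_congr fun w => ?_).trans lintegral_zero
        exact Set.indicator_of_notMem (fun h => hy (cons_mem_orderedChamber_iff.1 h).1) _
    simp only [h1]
    rw [lintegral_indicator measurableSet_Ioo, ← ofReal_integral_eq_lintegral_ofReal]
    · rw [← integral_Ioc_eq_integral_Ioo, ← intervalIntegral.integral_of_le hab,
        intervalIntegral.integral_comp_sub_left (fun u => divPow n u) b, sub_self,
        intervalIntegral.integral_eq_sub_of_hasDerivAt (fun u _ => hasDerivAt_divPow n u)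
          ((continuous_divPow n).intervalIntegrable _ _), divPow_zero_right (by omega), sub_zero]
      rfl
    · exact (((continuous_divPow n).comp (continuous_const.sub continuous_id)).integrableOn_Icc
        (a := a) (b := b)).mono_set Set.Ioo_subset_Icc_self
    · filter_upwards [ae_restrict_mem measurableSet_Ioo] with y hy
      rw [divPow_natCast]
      have := sub_nonneg.2 hy.2.le
      simp only [Pi.zero_apply]
      positivity

/-- A finite measure on `ℝⁿ` is determined by its values on products of lower half-lines. -/
lemma ext_of_pi_Iic {n : ℕ} {μ ν : Measure (Fin n → ℝ)} [IsFiniteMeasure μ]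
    (h : ∀ d : Fin n → ℝ, μ (Set.univ.pi fun k => Set.Iic (d k)) =
      ν (Set.univ.pi fun k => Set.Iic (d k))) (huniv : μ Set.univ = ν Set.univ) : μ = ν := by
  have hspan : IsCountablySpanning (Set.range (Set.Iic : ℝ → Set ℝ)) := by
    refine ⟨fun n => Set.Iic (n : ℝ), fun n => ⟨n, rfl⟩, ?_⟩
    ext y
    simpa using exists_nat_ge y
  refine ext_of_generate_finite
    (Set.univ.pi '' Set.univ.pi fun _ : Fin n => Set.range (Set.Iic : ℝ → Set ℝ)) ?_ ?_ ?_ huniv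
  · exact (generateFrom_eq_pi (fun _ => by
      rw [← borel_eq_generateFrom_Iic]; exact BorelSpace.measurable_eq.symm) fun _ => hspan).symm
  · exact IsPiSystem.pi fun _ => isPiSystem_Iic
  · rintro _ ⟨s, hs, rfl⟩
    choose d hd using fun k => hs k (Set.mem_univ k)
    have : s = fun k => Set.Iic (d k) := funext fun k => (hd k).symm
    rw [this]
    exact h d

section JumpTimes

variable {Ω : Type*} [MeasurableSpace Ω] {P : Measure Ω} {a : ℤ}
  {X : ℝ≥0 → Ω → ℤ} {N : ℕ} {T : ℝ≥0}

/-- Pairs of end points of successive intervals `(lo k, hi k]` in `(0, T)`. -/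
def SeparatedBoxes (N : ℕ) (T : ℝ≥0) : Set ((Fin N → ℚ) × (Fin N → ℚ)) :=
  {q | (∀ k, 0 ≤ q.1 k) ∧ (∀ k, q.1 k ≤ q.2 k) ∧ (∀ k, (q.2 k : ℝ) < T) ∧
    ∀ k l, k < l → q.2 k ≤ q.1 l}

lemma orderedChamber_eq_iUnion (N : ℕ) (T : ℝ≥0) :
    orderedChamber N 0 T = ⋃ q : SeparatedBoxes N T,
      Set.univ.pi fun k => Set.Ioc (q.1.1 k : ℝ) (q.1.2 k) := by
  ext y
  simp only [Set.mem_iUnion, Set.mem_univ_pi]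
  constructor
  · rintro ⟨hmono, hy⟩
    have hev : ∀ᶠ δ : ℝ in nhds 0, (∀ k, 0 < y k - δ ∧ y k + δ < T) ∧
        ∀ k l, k < l → y k + δ < y l - δ := by
      refine (Filter.eventually_all.2 fun k => ?_).and
        (Filter.eventually_all.2 fun k => Filter.eventually_all.2 fun l => ?_)
      · refine Filter.Eventually.and ?_ ?_
        · exact (Continuous.tendsto' (by fun_prop) 0 (y k) (by simp)).eventually_const_lt (hy k).1
        · exact (Continuous.tendsto' (by fun_prop) 0 (y k) (by simp)).eventually_lt_const (hy k).2
      · rcases lt_or_ge k l with h | h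
        · have : ∀ᶠ δ : ℝ in nhds 0, y k + δ < y l - δ :=
            (Continuous.tendsto' (by fun_prop) 0 (y k) (by simp)).eventually_lt
              (Continuous.tendsto' (by fun_prop) 0 (y l) (by simp)) (hmono h)
          exact this.mono fun _ h _ => h
        · exact Filter.Eventually.of_forall fun _ h' => absurd h' h.not_gt
    obtain ⟨δ, ⟨hδ1, hδ2⟩, hδ⟩ :=
      ((hev.filter_mono nhdsWithin_le_nhds).and (self_mem_nhdsWithin (s := Set.Ioi (0 : ℝ)))).exists
    have hδ : 0 < δ := hδ
    choose lo hlo1 hlo2 using fun k => exists_rat_btwn (sub_lt_self (y k) hδ)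
    choose hi hhi1 hhi2 using fun k => exists_rat_btwn (lt_add_of_pos_right (y k) hδ)
    refine ⟨⟨(lo, hi), fun k => ?_, fun k => ?_, fun k => ?_, fun k l hkl => ?_⟩,
      fun k => ⟨hlo2 k, (hhi1 k).le⟩⟩
    · exact_mod_cast ((hδ1 k).1.trans (hlo1 k)).le
    · exact_mod_cast ((hlo2 k).trans (hhi1 k)).le
    · exact (hhi2 k).trans (hδ1 k).2
    · exact_mod_cast (((hhi2 k).trans (hδ2 k l hkl)).trans (hlo1 l)).le
  · rintro ⟨⟨⟨lo, hi⟩, h1, h2, h3, h4⟩, hy⟩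
    refine ⟨fun k l hkl => (hy k).2.trans_lt (lt_of_le_of_lt ?_ (hy l).1), fun k =>
      ⟨lt_of_le_of_lt ?_ (hy k).1, (hy k).2.trans_lt (h3 k)⟩⟩
    · exact_mod_cast h4 k l hkl
    · exact_mod_cast h1 k

/-- The times at which the process reaches the `N` sites that follow its starting point. -/
noncomputable def jumpTimes {Ω : Type*} (X : ℝ≥0 → Ω → ℤ) (a : ℤ) (N : ℕ) (T : ℝ≥0) (ω : Ω)
    (k : Fin N) : ℝ := passageTime X T (a + (k : ℤ) + 1) ω

lemma measurable_jumpTimes {Ω : Type*} {mΩ : MeasurableSpace Ω} {X : ℝ≥0 → Ω → ℤ}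
    (hX : ∀ t, Measurable (X t)) (hmono : ∀ ω, Monotone fun t => X t ω)
    (hrc : ∀ ω t, ContinuousWithinAt (fun s => X s ω) (Set.Ici t) t) (a : ℤ) (N : ℕ) (T : ℝ≥0) :
    Measurable (jumpTimes X a N T) :=
  measurable_pi_lambda _ fun _ => measurable_passageTime hX hmono hrc T _

lemma IsUnitPoissonProcess.measurable_jumpTimes (hX : IsUnitPoissonProcess P a X) (N : ℕ)
    (T : ℝ≥0) : Measurable (jumpTimes X a N T) :=
  _root_.measurable_jumpTimes hX.measurable hX.monotone hX.rightContinuous a N T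

lemma IsUnitPoissonProcess.measure_eq_add (hX : IsUnitPoissonProcess P a X) (N : ℕ) (T : ℝ≥0) :
    P {ω | X T ω = a + N} = ENNReal.ofReal (Real.exp (-T)) * ENNReal.ofReal (divPow N T) := by
  have h := hX.measure_increment_eq (zero_le (a := T)) N
  have hs : (fun ω => X T ω - X 0 ω) ⁻¹' {(N : ℤ)} = {ω | X T ω = a + N} := by
    ext ω
    simp only [Set.mem_preimage, Set.mem_singleton_iff, hX.start, Set.mem_ofPred_eq]
    omega
  rw [← hs, h, ← ENNReal.ofReal_mul (Real.exp_nonneg _), divPow_natCast]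
  simp [mul_div_assoc]

/-- On the event that a Poisson process makes exactly `N` jumps before `T`, the law of its jump
times has constant density `exp (-T)` on `0 < τ₁ < ⋯ < τ_N < T`. -/
theorem IsUnitPoissonProcess.map_jumpTimes [IsProbabilityMeasure P] (hX : IsUnitPoissonProcess P a X)
    (N : ℕ) (T : ℝ≥0) :
    (P.restrict {ω | X T ω = a + N}).map (jumpTimes X a N T) =
      ENNReal.ofReal (Real.exp (-T)) • volume.restrict (orderedChamber N 0 T) := by
  set E : Set Ω := {ω | X T ω = a + N} with hE
  set μ := (P.restrict E).map (jumpTimes X a N T) with hμ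
  set ν := ENNReal.ofReal (Real.exp (-T)) • volume.restrict (orderedChamber N 0 T) with hν
  have hmeas := hX.measurable_jumpTimes N T
  have hch := measurableSet_orderedChamber N 0 T
  have hbox : ∀ lo hi : Fin N → ℝ, (∀ k, 0 ≤ lo k) → (∀ k, lo k ≤ hi k) → (∀ k, hi k < T) →
      (∀ k l, k < l → hi k ≤ lo l) →
      μ (Set.univ.pi fun k => Set.Ioc (lo k) (hi k)) =
        ν (Set.univ.pi fun k => Set.Ioc (lo k) (hi k)) := by
    intro lo hi h0 h1 h2 h3
    have hm : MeasurableSet (Set.univ.pi fun k => Set.Ioc (lo k) (hi k)) :=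
      MeasurableSet.univ_pi fun _ => measurableSet_Ioc
    have hsub : (Set.univ.pi fun k => Set.Ioc (lo k) (hi k)) ⊆ orderedChamber N 0 T := by
      intro y hy
      have hy' : ∀ k, y k ∈ Set.Ioc (lo k) (hi k) := fun k => hy k (Set.mem_univ k)
      exact ⟨fun k l hkl => (hy' k).2.trans_lt ((h3 k l hkl).trans_lt (hy' l).1), fun k =>
        ⟨(h0 k).trans_lt (hy' k).1, (hy' k).2.trans_lt (h2 k)⟩⟩
    rw [hμ, Measure.map_apply hmeas hm, Measure.restrict_apply (hmeas hm), hν, Measure.smul_apply,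
      Measure.restrict_apply hm, Set.inter_eq_left.2 hsub, volume_pi, Measure.pi_pi]
    lift lo to Fin N → ℝ≥0 using h0
    lift hi to Fin N → ℝ≥0 using fun k => (NNReal.coe_nonneg _).trans (h1 k)
    have := hX.measure_jumpTimes_mem (lo := lo) (hi := hi) (T := T)
      (fun k => NNReal.coe_le_coe.1 (h1 k)) (fun k => (NNReal.coe_lt_coe.1 (h2 k)).le)
      (fun k l h => NNReal.coe_le_coe.1 (h3 k l h))
    simp only [Real.volume_Ioc, smul_eq_mul]
    rw [← this]
    congr 1
    ext ω
    simp only [Set.mem_inter_iff, Set.mem_preimage, Set.mem_univ_pi, hE, Set.mem_ofPred_eq,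
      jumpTimes]
    exact and_comm
  -- The chamber is a countable union of boxes with separated sides.
  have hres : μ.restrict (orderedChamber N 0 T) = ν.restrict (orderedChamber N 0 T) := by
    rw [orderedChamber_eq_iUnion]
    refine Measure.restrict_iUnion_congr.2 ?_
    rintro ⟨⟨lo, hi⟩, h0, h1, h2, h3⟩
    have h0' : ∀ k, (0 : ℝ) ≤ lo k := fun k => by exact_mod_cast h0 k
    have h1' : ∀ k, (lo k : ℝ) ≤ hi k := fun k => by exact_mod_cast h1 k
    have h3' : ∀ k l, k < l → (hi k : ℝ) ≤ lo l := fun k l h => by exact_mod_cast h3 k l h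
    refine ext_of_pi_Iic (fun d => ?_) ?_
    · have hm : MeasurableSet (Set.univ.pi fun k => Set.Iic (d k)) :=
        MeasurableSet.univ_pi fun _ => measurableSet_Iic
      rw [Measure.restrict_apply hm, Measure.restrict_apply hm, ← Set.pi_inter_distrib]
      have hI : ∀ k, Set.Iic (d k) ∩ Set.Ioc (lo k : ℝ) (hi k) =
          Set.Ioc (lo k : ℝ) (min (hi k) (d k)) := fun k => by
        ext u; simp only [Set.mem_inter_iff, Set.mem_Iic, Set.mem_Ioc, le_min_iff]; tauto
      simp only [hI]
      by_cases hd : ∀ k, (lo k : ℝ) ≤ d k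
      · exact hbox _ _ h0' (fun k => le_min (h1' k) (hd k))
          (fun k => (min_le_left _ _).trans_lt (h2 k))
          (fun k l h => (min_le_left _ _).trans (h3' k l h))
      · push Not at hd
        obtain ⟨k, hk⟩ := hd
        have : (Set.univ.pi fun k => Set.Ioc (lo k : ℝ) (min (hi k) (d k))) = ∅ := by
          refine Set.univ_pi_eq_empty (i := k) (Set.Ioc_eq_empty ?_)
          exact not_lt.2 ((min_le_right _ _).trans hk.le)
        rw [this]; simp
    · rw [Measure.restrict_apply_univ, Measure.restrict_apply_univ]
      exact hbox _ _ h0' h1' h2 h3'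
  have huniv : μ Set.univ = ν Set.univ := by
    rw [hμ, Measure.map_apply hmeas MeasurableSet.univ, Set.preimage_univ,
      Measure.restrict_apply_univ, hX.measure_eq_add, hν, Measure.smul_apply,
      Measure.restrict_apply_univ, volume_orderedChamber N T.coe_nonneg, sub_zero, smul_eq_mul]
  have hνres : ν.restrict (orderedChamber N 0 T) = ν := by
    rw [hν, Measure.restrict_smul, Measure.restrict_restrict hch, Set.inter_self]
  -- The total masses are equal and so are the masses of the chamber, hence no mass lies outside.
  have hc : μ (orderedChamber N 0 T)ᶜ = 0 := by
    rw [measure_compl hch (measure_ne_top _ _),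
      ← Measure.restrict_apply_univ (orderedChamber N 0 T), hres, hνres, huniv,
      tsub_self]
  rw [← hνres, ← hres]
  exact (Measure.restrict_eq_self_of_ae_mem hc).symm

end JumpTimes

/-! ### Non-intersection and interlacing -/

/-- The arrival times at all sites, the site of index `k` being `k - m`, are admissible. -/
def AdmissibleTimes (N : ℕ) (T : ℝ) (m : ℕ) (z : Fin (N + m + 2) → Fin (m + 1) → ℝ) : Prop :=
  ∀ k : Fin (N + m + 1), z k.castSucc ∈ layerSet N T (m + 1) ((k : ℤ) - m) ∧
    z k.succ ∈ layerSet N T (m + 1) ((k : ℤ) - m + 1) ∧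
    Interlaces N ((k : ℤ) - m) (z k.castSucc) (z k.succ)

lemma siteProd_of_admissible {N : ℕ} {T : ℝ} {m : ℕ} {z : Fin (N + m + 2) → Fin (m + 1) → ℝ}
    (h : AdmissibleTimes N T m z) : siteProd N T m z = 1 :=
  Finset.prod_eq_one fun k _ => siteKernel_of_interlaces (h k)

lemma siteProd_of_not_admissible {N : ℕ} {T : ℝ} {m : ℕ} {z : Fin (N + m + 2) → Fin (m + 1) → ℝ}
    (h : ¬ AdmissibleTimes N T m z) : siteProd N T m z = 0 := by
  unfold AdmissibleTimes at h
  push Not at h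
  obtain ⟨k, hk⟩ := h
  refine Finset.prod_eq_zero (Finset.mem_univ k) (siteKernel_of_not_interlaces ?_)
  exact fun h => hk h.1 h.2.1 h.2.2

section Paths

variable {N m : ℕ} {T : ℝ≥0} {f : Fin (m + 1) → ℝ≥0 → ℤ} {τ : ℤ → Fin (m + 1) → ℝ}

/-- The arrival times of paths that increase by unit steps from `-i` to `N - i`, in the open
interval from `0` to `T`. -/
structure IsArrivalSystem (N m : ℕ) (T : ℝ≥0) (f : Fin (m + 1) → ℝ≥0 → ℤ)
    (τ : ℤ → Fin (m + 1) → ℝ) : Prop where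
  start_le : ∀ (i : Fin (m + 1)) t, -(i : ℤ) ≤ f i t
  le_end : ∀ (i : Fin (m + 1)) t, t ≤ T → f i t ≤ N - (i : ℤ)
  le_iff : ∀ (y : ℤ) (i : Fin (m + 1)) (t : ℝ≥0), t ≤ T → y ≤ (N : ℤ) - i →
    (τ y i ≤ (t : ℝ) ↔ y ≤ f i t)
  boundary : ∀ y i, ¬ Visits N y i → τ y i = boundaryTime T y i
  mem_Ioo : ∀ y i, Visits N y i → τ y i ∈ Set.Ioo (0 : ℝ) T
  lt : ∀ y i, Visits N y i → Visits N (y + 1) i → τ y i < τ (y + 1) i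

lemma IsArrivalSystem.mem_Icc (h : IsArrivalSystem N m T f τ) (y : ℤ) (i : Fin (m + 1)) :
    τ y i ∈ Set.Icc (0 : ℝ) T := by
  by_cases hv : Visits N y i
  · exact Set.Ioo_subset_Icc_self (h.mem_Ioo y i hv)
  · rw [h.boundary y i hv, boundaryTime]
    split_ifs
    · exact ⟨le_rfl, T.coe_nonneg⟩
    · exact ⟨T.coe_nonneg, le_rfl⟩

lemma IsArrivalSystem.lt_succ (h : IsArrivalSystem N m T f τ) (hN : m < N) {y : ℤ}
    {i : Fin (m + 1)} (h1 : -(i : ℤ) ≤ y) (h2 : y ≤ (N : ℤ) - i) : τ y i < τ (y + 1) i := by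
  by_cases hv : Visits N y i <;> by_cases hv' : Visits N (y + 1) i
  · exact h.lt y i hv hv'
  · rw [h.boundary _ i hv', boundaryTime, if_neg (by unfold Visits at *; omega)]
    exact (h.mem_Ioo y i hv).2
  · rw [h.boundary _ i hv, boundaryTime, if_pos (by unfold Visits at *; omega)]
    exact (h.mem_Ioo _ i hv').1
  · unfold Visits at *; omega

/-- If two successive paths do not meet, then the second one reaches a site only after the first one
has left it: at the first site where this fails, the two paths would meet. -/
lemma IsArrivalSystem.le_of_ne (h : IsArrivalSystem N m T f τ) (hN : m < N)
    (hne : ∀ t, t ≤ T → ∀ i j, i ≠ j → f i t ≠ f j t) (k : Fin m) (y : ℤ) :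
    τ (y + 1) k.castSucc ≤ τ y k.succ := by
  -- If the second path arrives at `y` before the first one has left, then both are at `y` at that time,
  -- provided that the first path has already arrived there.
  have step : ∀ y : ℤ, Visits N y k.succ →
      (∀ t : ℝ≥0, t ≤ T → (t : ℝ) = τ y k.succ → y ≤ f k.castSucc t) →
      τ (y + 1) k.castSucc ≤ τ y k.succ := by
    intro y hv hle
    by_contra! hlt
    obtain ⟨h0, hT⟩ := h.mem_Icc y k.succ
    obtain ⟨t, ht⟩ : ∃ t : ℝ≥0, (t : ℝ) = τ y k.succ := ⟨⟨_, h0⟩, rfl⟩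
    have htT : t ≤ T := by rw [← NNReal.coe_le_coe, ht]; exact hT
    have hvb := hv
    simp only [Visits, Fin.val_succ] at hvb; push_cast at hvb
    have h1 := (h.le_iff _ k.succ t htT hv.2).1 ht.ge
    have h2 : f k.castSucc t < y + 1 := not_le.1 fun hc =>
      absurd ((h.le_iff _ k.castSucc t htT (by simp; omega)).2 hc) (by rw [ht]; exact hlt.not_ge)
    have h3 : f k.succ t < y + 1 := by
      by_cases he : y + 1 ≤ (N : ℤ) - (k.succ : ℕ)
      · refine not_le.1 fun hc => absurd ((h.le_iff _ k.succ t htT he).2 hc) ?_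
        rw [ht]; exact (h.lt_succ hN hv.1.le hv.2).not_ge
      · have := h.le_end k.succ t htT
        omega
    have h4 := hle t htT ht
    exact hne t htT _ _ (Fin.castSucc_lt_succ (i := k)).ne (by omega)
  by_cases hv : Visits N y k.succ
  · have hlow : -(k : ℤ) ≤ y := by
      simp only [Visits, Fin.val_succ] at hv; push_cast at hv; omega
    obtain ⟨d, rfl⟩ : ∃ d : ℕ, y = -(k : ℤ) + d := ⟨(y + k).toNat, by omega⟩
    clear hlow
    induction d with
    | zero =>
      refine step _ hv fun t _ _ => ?_
      simpa using h.start_le k.castSucc t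
    | succ d ih =>
      have hvb := hv
      simp only [Visits, Fin.val_succ] at hvb; push_cast at hvb
      have hv' : Visits N (-(k : ℤ) + (d : ℕ)) k.succ := by
        simp only [Visits, Fin.val_succ]; push_cast; omega
      have h5 := ih hv'
      have h6 := h.lt_succ hN hv'.1.le hv'.2
      have e : -(k : ℤ) + (d : ℕ) + 1 = -(k : ℤ) + (d + 1 : ℕ) := by push_cast; ring
      rw [e] at h5 h6
      exact step _ hv fun t htT ht => (h.le_iff _ k.castSucc t htT (by simp; omega)).1
        ((h5.trans h6.le).trans ht.ge)
  · rw [h.boundary _ _ hv, boundaryTime]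
    split_ifs with h1
    · have hv' : ¬ Visits N (y + 1) k.castSucc := by
        simp only [Visits, Fin.val_succ, Fin.val_castSucc] at *
        push_cast at *; omega
      rw [h.boundary _ _ hv', boundaryTime, if_pos]
      simp only [Fin.val_succ, Fin.val_castSucc] at *
      push_cast at *; omega
    · exact (h.mem_Icc _ _).2

lemma IsArrivalSystem.mem_layerSet (h : IsArrivalSystem N m T f τ) (hN : m < N)
    (hne : ∀ t, t ≤ T → ∀ i j, i ≠ j → f i t ≠ f j t) (y : ℤ) :
    τ y ∈ layerSet N T (m + 1) y := by
  refine ⟨h.mem_Ioo y, h.boundary y, fun i j hij hi hj => ?_⟩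
  have key : ∀ k : Fin m, Visits N y k.castSucc → τ y k.castSucc < τ y k.succ := fun k hk =>
    (h.lt_succ hN hk.1.le hk.2).trans_le (h.le_of_ne hN hne k y)
  induction j using Fin.induction with
  | zero => exact absurd hij (Fin.not_lt_zero _)
  | succ k ih =>
    have hi' : (i : ℕ) < k + 1 := by simpa using Fin.lt_def.1 hij
    have hk : Visits N y k.castSucc := by
      simp only [Visits, Fin.val_succ, Fin.val_castSucc] at *
      push_cast at *; omega
    rcases eq_or_lt_of_le (Fin.le_castSucc_iff.2 hij) with h' | h'
    · rw [h']; exact key k hk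
    · exact (ih h' hk).trans (key k hk)

/-- The paths do not meet if and only if their arrival times at successive sites interlace. -/
theorem IsArrivalSystem.ne_iff_admissible (h : IsArrivalSystem N m T f τ) (hN : m < N) :
    (∀ t, t ≤ T → ∀ i j, i ≠ j → f i t ≠ f j t) ↔
      AdmissibleTimes N T m (fun k i => τ ((k : ℤ) - m) i) := by
  constructor
  · intro hne k
    have e : ((k.succ : ℕ) : ℤ) - m = ((k : ℕ) : ℤ) - m + 1 := by simp; ring
    have e' : ((k.castSucc : ℕ) : ℤ) - m = ((k : ℕ) : ℤ) - m := by simp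
    simp only [e, e']
    exact ⟨h.mem_layerSet hN hne _, h.mem_layerSet hN hne _, fun l => h.le_of_ne hN hne l _,
      fun i h1 h2 => h.lt_succ hN h1 h2⟩
  · intro hadm t ht
    have hlt : ∀ k : Fin m, f k.succ t < f k.castSucc t := by
      intro k
      have h1 := h.start_le k.succ t
      have h2 := h.le_end k.succ t ht
      have h3 := h.start_le k.castSucc t
      set y := f k.succ t with hy
      have hkm := k.2
      simp only [Fin.val_succ, Fin.val_castSucc] at h1 h2 h3
      push_cast at h1 h2
      rcases h1.lt_or_eq with h1 | h1
      · obtain ⟨l, hl⟩ : ∃ l : Fin (N + m + 1), ((l : ℕ) : ℤ) - m = y :=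
          ⟨⟨(y + m).toNat, by omega⟩, by simp; omega⟩
        have e : ((l.succ : ℕ) : ℤ) - m = y + 1 := by simp; omega
        have e' : ((l.castSucc : ℕ) : ℤ) - m = y := by simpa using hl
        have h4 := (hadm l).2.2.1 k
        simp only [e, e'] at h4
        have h5 := (h.le_iff y k.succ t ht (by simp; omega)).2 le_rfl
        have h6 := (h.le_iff (y + 1) k.castSucc t ht (by simp; omega)).1 (h4.trans h5)
        omega
      · omega
    have hanti : StrictAnti fun i => f i t := Fin.strictAnti_iff_succ_lt.2 hlt
    exact fun i j hij h' => hij (hanti.injective h')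

end Paths

/-! ### The joint law of the arrival times at all sites -/

/-- Exchanging the two indices turns an iterated product measure into an iterated product
measure. -/
lemma measurePreserving_swap_pi {ι κ : Type*} [Fintype ι] [Fintype κ] (μ : ι → κ → Measure ℝ)
    [∀ i k, SigmaFinite (μ i k)] :
    MeasurePreserving (fun (z : ι → κ → ℝ) k i => z i k)
      (Measure.pi fun i => Measure.pi fun k => μ i k)
      (Measure.pi fun k => Measure.pi fun i => μ i k) := by
  have hm : Measurable fun (z : ι → κ → ℝ) k i => z i k := by fun_prop
  refine ⟨hm, (Measure.pi_eq_generateFrom (C := fun _ => Set.univ.pi '' Set.univ.pi fun _ =>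
    {s : Set ℝ | MeasurableSet s}) (fun _ => generateFrom_pi) (fun _ => isPiSystem_pi)
    (fun k => Measure.FiniteSpanningSetsIn.pi fun i => (μ i k).toFiniteSpanningSetsIn) ?_).symm⟩
  intro s hs
  choose t ht hts using hs
  have ht' : ∀ k i, MeasurableSet (t k i) := fun k i => ht k i (Set.mem_univ i)
  obtain rfl : s = fun k => Set.univ.pi (t k) := funext fun k => (hts k).symm
  rw [Measure.map_apply hm (MeasurableSet.univ_pi fun k => MeasurableSet.univ_pi (ht' k))]
  have : (fun (z : ι → κ → ℝ) k i => z i k) ⁻¹' (Set.univ.pi fun k => Set.univ.pi (t k)) =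
      Set.univ.pi fun i => Set.univ.pi fun k => t k i := by
    ext z
    simp only [Set.mem_preimage, Set.mem_univ_pi]
    exact forall_comm
  rw [this]
  simp only [Measure.pi_pi]
  exact Finset.prod_comm

/-- The arrival times of bus `i` at all sites, in terms of its jump times. -/
noncomputable def rowOfJumps (N : ℕ) (T : ℝ) {m : ℕ} (i : Fin (m + 1)) (w : Fin N → ℝ)
    (k : Fin (N + m + 2)) : ℝ :=
  if h : Visits N ((k : ℤ) - m) i then
    w ⟨((k : ℤ) - m + i - 1).toNat, by unfold Visits at h; omega⟩
  else boundaryTime T ((k : ℤ) - m) i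

/-- The index of the site which bus `i` reaches with its `j`-th jump. -/
def siteOfJump {N m : ℕ} (i : Fin (m + 1)) (j : Fin N) : Fin (N + m + 2) :=
  ⟨(j : ℕ) + 1 + m - i, by omega⟩

lemma siteOfJump_sub {N m : ℕ} (i : Fin (m + 1)) (j : Fin N) :
    ((siteOfJump i j : ℕ) : ℤ) - m = j + 1 - i := by
  simp only [siteOfJump]; omega

lemma visits_siteOfJump {N m : ℕ} (i : Fin (m + 1)) (j : Fin N) :
    Visits N (((siteOfJump i j : ℕ) : ℤ) - m) i := by
  rw [siteOfJump_sub]; unfold Visits; omega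

/-- The visited sites correspond to the jumps. -/
def siteEquivJump {N m : ℕ} (i : Fin (m + 1)) :
    {k : Fin (N + m + 2) // Visits N ((k : ℤ) - m) i} ≃ Fin N where
  toFun k := ⟨((k.1 : ℤ) - m + i - 1).toNat, by have := k.2; unfold Visits at this; omega⟩
  invFun j := ⟨siteOfJump i j, visits_siteOfJump i j⟩
  left_inv k := by
    have := k.2
    unfold Visits at this
    ext
    simp only [siteOfJump]; omega
  right_inv j := by
    ext
    simp only [siteOfJump_sub]; omega

lemma rowOfJumps_siteOfJump {N m : ℕ} (T : ℝ) (i : Fin (m + 1)) (w : Fin N → ℝ) (j : Fin N) :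
    rowOfJumps N T i w (siteOfJump i j) = w j := by
  rw [rowOfJumps, dif_pos (visits_siteOfJump i j)]
  congr 1
  ext
  simp only [siteOfJump_sub]; omega

lemma measurePreserving_rowOfJumps (N : ℕ) (T : ℝ) {m : ℕ} (i : Fin (m + 1)) :
    MeasurePreserving (rowOfJumps N T i) volume
      (Measure.pi fun k : Fin (N + m + 2) => siteMeasure N T ((k : ℤ) - m) i) := by
  have hm : Measurable (rowOfJumps N T i : (Fin N → ℝ) → Fin (N + m + 2) → ℝ) := by
    refine measurable_pi_lambda _ fun k => ?_
    unfold rowOfJumps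
    split_ifs
    · fun_prop
    · fun_prop
  refine ⟨hm, (Measure.pi_eq fun s hs => ?_).symm⟩
  rw [Measure.map_apply hm (MeasurableSet.univ_pi hs), ← Fintype.prod_subtype_mul_prod_subtype
    (fun k : Fin (N + m + 2) => Visits N ((k : ℤ) - m) i)]
  have h1 : ∏ k : {k : Fin (N + m + 2) // Visits N ((k : ℤ) - m) i},
      siteMeasure N T ((k.1 : ℤ) - m) i (s k.1) = ∏ j : Fin N, volume (s (siteOfJump i j)) := by
    rw [← Equiv.prod_comp (siteEquivJump i).symm]
    refine Finset.prod_congr rfl fun j _ => ?_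
    rw [siteMeasure, if_pos (((siteEquivJump i).symm j).2)]
    rfl
  have h2 : ∀ k : {k : Fin (N + m + 2) // ¬ Visits N ((k : ℤ) - m) i},
      siteMeasure N T ((k.1 : ℤ) - m) i (s k.1) =
        (s k.1).indicator 1 (boundaryTime T ((k.1 : ℤ) - m) i) := fun k => by
    rw [siteMeasure, if_neg k.2, Measure.dirac_apply' _ (hs _)]
  rw [h1]
  simp only [h2]
  by_cases hb : ∀ k : Fin (N + m + 2), ¬ Visits N ((k : ℤ) - m) i →
      boundaryTime T ((k : ℤ) - m) i ∈ s k
  · have hset : rowOfJumps N T i ⁻¹' (Set.univ.pi s) =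
        Set.univ.pi fun j => s (siteOfJump i j) := by
      ext w
      simp only [Set.mem_preimage, Set.mem_univ_pi]
      refine ⟨fun h j => by simpa only [rowOfJumps_siteOfJump] using h (siteOfJump i j),
        fun h k => ?_⟩
      by_cases hk : Visits N ((k : ℤ) - m) i
      · have h3 := congrArg Subtype.val ((siteEquivJump i).left_inv ⟨k, hk⟩)
        have h4 : siteOfJump i (siteEquivJump i ⟨k, hk⟩) = k := h3
        rw [← h4, rowOfJumps_siteOfJump]
        exact h _
      · rw [rowOfJumps, dif_neg hk]
        exact hb k hk
    rw [hset, volume_pi, Measure.pi_pi, Finset.prod_eq_one (s := Finset.univ) (f := fun k :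
      {k : Fin (N + m + 2) // ¬ Visits N ((k : ℤ) - m) i} =>
        (s k.1).indicator (1 : ℝ → ℝ≥0∞) (boundaryTime T ((k.1 : ℤ) - m) i))
        fun k _ => Set.indicator_of_mem (hb k.1 k.2) _, mul_one]
  · push Not at hb
    obtain ⟨k, hk, hks⟩ := hb
    have hset : rowOfJumps N T i ⁻¹' (Set.univ.pi s) = ∅ := by
      ext w
      simp only [Set.mem_preimage, Set.mem_univ_pi, Set.mem_empty_iff_false, iff_false]
      intro h
      have := h k
      rw [rowOfJumps, dif_neg hk] at this
      exact hks this
    rw [hset, measure_empty, Finset.prod_eq_zero (Finset.mem_univ (⟨k, hk⟩ :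
      {k : Fin (N + m + 2) // ¬ Visits N ((k : ℤ) - m) i})) (Set.indicator_of_notMem hks _),
      mul_zero]

/-- The arrival times of all buses at all sites, in terms of the jump times. -/
noncomputable def timesOfJumps (N : ℕ) (T : ℝ) {m : ℕ} (w : Fin (m + 1) → Fin N → ℝ)
    (k : Fin (N + m + 2)) (i : Fin (m + 1)) : ℝ := rowOfJumps N T i (w i) k

lemma measurePreserving_timesOfJumps (N : ℕ) (T : ℝ) (m : ℕ) :
    MeasurePreserving (timesOfJumps N T : (Fin (m + 1) → Fin N → ℝ) → _) volume
      (Measure.pi fun k : Fin (N + m + 2) => layerMeasure N T (m + 1) ((k : ℤ) - m)) := by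
  have h1 : MeasurePreserving (fun (w : Fin (m + 1) → Fin N → ℝ) i => rowOfJumps N T i (w i))
      volume (Measure.pi fun i : Fin (m + 1) => Measure.pi fun k : Fin (N + m + 2) =>
        siteMeasure N T ((k : ℤ) - m) i) := by
    rw [volume_pi]
    exact measurePreserving_pi _ _ fun i => measurePreserving_rowOfJumps N T i
  exact (measurePreserving_swap_pi fun (i : Fin (m + 1)) (k : Fin (N + m + 2)) =>
    siteMeasure N T ((k : ℤ) - m) i).comp h1

section Buses

variable {Ω : Type*} [MeasurableSpace Ω] {P : Measure Ω} {m N : ℕ}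
  {T : ℝ≥0} {L : Fin (m + 1) → ℝ≥0 → Ω → ℤ}

/-- The event that all buses are at their final sites at time `T`. -/
def endEvent (L : Fin (m + 1) → ℝ≥0 → Ω → ℤ) (N : ℕ) (T : ℝ≥0) : Set Ω :=
  {ω | ∀ i, L i T ω = -((i : ℕ) : ℤ) + N}

lemma measurableSet_endEvent (hL : IsBusProcess P (m + 1) L) : MeasurableSet (endEvent L N T) := by
  have : endEvent L N T = ⋂ i, L i T ⁻¹' {-((i : ℕ) : ℤ) + N} := by ext; simp [endEvent]
  rw [this]
  exact .iInter fun i => (hL.poisson i).measurable T (measurableSet_singleton _)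

/-- The jump times of all buses. -/
noncomputable def allJumpTimes (L : Fin (m + 1) → ℝ≥0 → Ω → ℤ) (N : ℕ) (T : ℝ≥0) (ω : Ω)
    (i : Fin (m + 1)) : Fin N → ℝ := jumpTimes (L i) (-((i : ℕ) : ℤ)) N T ω

lemma measurable_allJumpTimes (hL : IsBusProcess P (m + 1) L) :
    Measurable (allJumpTimes L N T) :=
  measurable_pi_lambda _ fun i => (hL.poisson i).measurable_jumpTimes N T

/-- By independence, the jump times of all buses have a constant joint density on the event that the
buses arrive at their final sites. -/
lemma map_allJumpTimes [IsProbabilityMeasure P] (hL : IsBusProcess P (m + 1) L) :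
    (P.restrict (endEvent L N T)).map (allJumpTimes L N T) =
      ENNReal.ofReal (Real.exp (-T)) ^ (m + 1) •
        volume.restrict (Set.univ.pi fun _ => orderedChamber N 0 T) := by
  have hm := measurable_allJumpTimes (N := N) (T := T) hL
  have key : Measure.pi (fun i : Fin (m + 1) =>
      (P.restrict {ω | L i T ω = -((i : ℕ) : ℤ) + N}).map (jumpTimes (L i) (-((i : ℕ) : ℤ)) N T)) =
      (P.restrict (endEvent L N T)).map (allJumpTimes L N T) := by
    refine Measure.pi_eq fun s hs => ?_
    rw [Measure.map_apply hm (MeasurableSet.univ_pi hs),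
      Measure.restrict_apply (hm (MeasurableSet.univ_pi hs))]
    have hset : allJumpTimes L N T ⁻¹' Set.univ.pi s ∩ endEvent L N T =
        ⋂ i, (jumpTimes (L i) (-((i : ℕ) : ℤ)) N T ⁻¹' s i ∩
          {ω | L i T ω = -((i : ℕ) : ℤ) + N}) := by
      ext ω
      simp only [Set.mem_inter_iff, Set.mem_preimage, Set.mem_univ_pi, endEvent, Set.mem_ofPred_eq,
        Set.mem_iInter, allJumpTimes]
      exact forall_and.symm
    rw [hset, hL.indep.meas_iInter]
    · refine Finset.prod_congr rfl fun i _ => ?_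
      have hi := (hL.poisson i).measurable_jumpTimes N T
      rw [Measure.map_apply hi (hs i), Measure.restrict_apply (hi (hs i))]
    · intro i
      -- The jump times of a bus are measurable for the σ-algebra generated by that bus.
      have hc : ∀ t, Measurable[MeasurableSpace.comap (fun ω t => L i t ω) inferInstance] (L i t) :=
        fun t s hs => ⟨(fun g => g t) ⁻¹' s, measurable_pi_apply t hs, rfl⟩
      refine MeasurableSet.inter ?_ (hc T (measurableSet_singleton _))
      exact measurable_jumpTimes hc (hL.poisson i).monotone (hL.poisson i).rightContinuous _ N T
        (hs i)
  rw [← key, volume_pi, Measure.restrict_pi_pi]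
  refine Measure.pi_eq fun s hs => ?_
  rw [Measure.smul_apply, Measure.pi_pi]
  simp only [(hL.poisson _).map_jumpTimes N T, Measure.smul_apply, smul_eq_mul,
    Finset.prod_mul_distrib, Finset.prod_const, Finset.card_univ, Fintype.card_fin]

/-- The arrival times of all buses at all sites. -/
noncomputable def allPassageTimes (L : Fin (m + 1) → ℝ≥0 → Ω → ℤ) (N : ℕ) (T : ℝ≥0) (ω : Ω)
    (k : Fin (N + m + 2)) (i : Fin (m + 1)) : ℝ := passageTime (L i) T ((k : ℤ) - m) ω

lemma passageTime_of_not_visits (hL : IsBusProcess P (m + 1) L) {ω : Ω} (hω : ω ∈ endEvent L N T)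
    {y : ℤ} {i : Fin (m + 1)} (h : ¬ Visits N y i) :
    passageTime (L i) T y ω = boundaryTime T y i := by
  rw [boundaryTime]
  split_ifs with h1
  · exact passageTime_of_le_start (by rw [(hL.poisson i).start]; exact h1)
  · refine passageTime_of_lt ((hL.poisson i).monotone ω) ?_
    rw [hω i]
    unfold Visits at h; omega

lemma allPassageTimes_eq (hL : IsBusProcess P (m + 1) L) {ω : Ω} (hω : ω ∈ endEvent L N T) :
    allPassageTimes L N T ω = timesOfJumps N T (allJumpTimes L N T ω) := by
  ext k i
  rw [timesOfJumps, rowOfJumps, allPassageTimes]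
  split_ifs with h
  · rw [allJumpTimes, jumpTimes]
    congr 1
    unfold Visits at h
    simp only
    omega
  · exact passageTime_of_not_visits hL hω h

/-- The event that the jump times of every bus are strictly increasing in `(0, T)`. -/
def regularEvent (L : Fin (m + 1) → ℝ≥0 → Ω → ℤ) (N : ℕ) (T : ℝ≥0) : Set Ω :=
  allJumpTimes L N T ⁻¹' Set.univ.pi fun _ => orderedChamber N 0 T

lemma ae_mem_regularEvent [IsProbabilityMeasure P] (hL : IsBusProcess P (m + 1) L) :
    ∀ᵐ ω ∂(P.restrict (endEvent L N T)), ω ∈ regularEvent L N T := by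
  have hc : MeasurableSet (Set.univ.pi fun _ : Fin (m + 1) => orderedChamber N 0 (T : ℝ)) :=
    MeasurableSet.univ_pi fun _ => measurableSet_orderedChamber _ _ _
  refine ae_of_ae_map (measurable_allJumpTimes hL).aemeasurable
    (p := fun w => w ∈ Set.univ.pi fun _ : Fin (m + 1) => orderedChamber N 0 (T : ℝ)) ?_
  rw [map_allJumpTimes hL]
  exact Measure.ae_smul_measure (ae_restrict_mem hc) _

lemma isArrivalSystem_of_regular (hL : IsBusProcess P (m + 1) L) {ω : Ω}
    (hω : ω ∈ endEvent L N T) (hreg : ω ∈ regularEvent L N T) :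
    IsArrivalSystem N m T (fun i t => L i t ω) (fun y i => passageTime (L i) T y ω) := by
  have hjump : ∀ y i, (h : Visits N y i) → passageTime (L i) T y ω =
      allJumpTimes L N T ω i ⟨(y + i - 1).toNat, by unfold Visits at h; omega⟩ := fun y i h => by
    rw [allJumpTimes, jumpTimes]
    congr 1
    unfold Visits at h
    simp only
    omega
  have hr : ∀ i, allJumpTimes L N T ω i ∈ orderedChamber N 0 T := fun i => hreg i (Set.mem_univ i)
  refine ⟨fun i t => ?_, fun i t ht => ?_, fun y i t ht hy => ?_, fun y i h => ?_, fun y i h => ?_,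
    fun y i h h' => ?_⟩
  · rw [← (hL.poisson i).start ω]
    exact (hL.poisson i).monotone ω zero_le
  · refine ((hL.poisson i).monotone ω ht).trans ?_
    simp only [hω i]
    omega
  · exact passageTime_le_iff ((hL.poisson i).monotone ω) ((hL.poisson i).rightContinuous ω) ht
      (by rw [hω i]; omega)
  · exact passageTime_of_not_visits hL hω h
  · simp only [hjump y i h]
    exact (hr i).2 _
  · simp only [hjump y i h, hjump (y + 1) i h']
    refine (hr i).1 ?_
    unfold Visits at h h'
    rw [Fin.lt_def]
    simp only
    omega

lemma mem_nonIntersectionEvent_iff (hL : IsBusProcess P (m + 1) L) (hN : m < N) {ω : Ω}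
    (hω : ω ∈ endEvent L N T) (hreg : ω ∈ regularEvent L N T) :
    ω ∈ nonIntersectionEvent L N T ↔ AdmissibleTimes N T m (allPassageTimes L N T ω) := by
  have h := (isArrivalSystem_of_regular hL hω hreg).ne_iff_admissible hN
  refine Iff.trans ⟨fun h' => h'.1, fun h' => ⟨h', fun i => ?_⟩⟩ h
  rw [hω i]; ring

omit [MeasurableSpace Ω] in
lemma nonIntersectionEvent_subset : nonIntersectionEvent L N T ⊆ endEvent L N T := by
  intro ω hω i
  rw [hω.2 i]; ring

lemma measurable_siteProd (N : ℕ) (T : ℝ) (m : ℕ) : Measurable (siteProd N T m) := by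
  refine Finset.measurable_fun_prod _ fun k _ => ?_
  have : Measurable fun z : Fin (N + m + 2) → Fin (m + 1) → ℝ => (z k.castSucc, z k.succ) := by
    fun_prop
  exact (measurable_siteKernel N T m _).comp this

lemma measurable_timesOfJumps (N : ℕ) (T : ℝ) (m : ℕ) :
    Measurable (timesOfJumps N T : (Fin (m + 1) → Fin N → ℝ) → _) :=
  (measurePreserving_timesOfJumps N T m).measurable

lemma siteProd_timesOfJumps_of_notMem {w : Fin (m + 1) → Fin N → ℝ}
    (hw : w ∉ Set.univ.pi fun _ => orderedChamber N 0 T) :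
    siteProd N T m (timesOfJumps N T w) = 0 := by
  refine siteProd_of_not_admissible fun hadm => hw fun i _ => ?_
  have hval : ∀ j : Fin N, timesOfJumps N T w (siteOfJump i j) i = w i j := fun j =>
    rowOfJumps_siteOfJump _ _ _ _
  have hsite : ∀ j : Fin N, ∃ k : Fin (N + m + 1), k.castSucc = siteOfJump i j := fun j =>
    ⟨⟨(siteOfJump i j : ℕ), by simp only [siteOfJump]; omega⟩, rfl⟩
  refine ⟨?_, fun j => ?_⟩
  · obtain _ | N := N
    · exact Subsingleton.strictMono _
    · refine Fin.strictMono_iff_lt_succ.2 fun j => ?_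
      obtain ⟨k, hk⟩ := hsite j.castSucc
      have hk' : k.succ = siteOfJump i j.succ := by
        have := congrArg Fin.val hk
        ext
        simp only [siteOfJump, Fin.val_succ, Fin.val_castSucc] at *
        omega
      have e : ((k : ℕ) : ℤ) - m = ((siteOfJump i j.castSucc : ℕ) : ℤ) - m := by rw [← hk]; simp
      have hv := visits_siteOfJump i j.castSucc
      rw [← e] at hv
      have := (hadm k).2.2.2 i hv.1.le hv.2
      rwa [hk, hk', hval, hval] at this
  · obtain ⟨k, hk⟩ := hsite j
    have e : ((k : ℕ) : ℤ) - m = ((siteOfJump i j : ℕ) : ℤ) - m := by rw [← hk]; simp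
    have hv := visits_siteOfJump i j
    rw [← e] at hv
    have := (hadm k).1.1 i hv
    rwa [hk, hval] at this

/-- The non-intersection event agrees with a measurable set up to a null set. -/
lemma nonIntersectionEvent_ae_eq [IsProbabilityMeasure P] (hL : IsBusProcess P (m + 1) L)
    (hN : m < N) :
    nonIntersectionEvent L N T =ᵐ[P] (endEvent L N T ∩
      {ω | siteProd N T m (timesOfJumps N T (allJumpTimes L N T ω)) = 1} : Set Ω) := by
  have h := ae_mem_regularEvent (N := N) (T := T) hL
  rw [ae_restrict_iff' (measurableSet_endEvent hL)] at h
  filter_upwards [h] with ω hω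
  refine propext ?_
  by_cases hE : ω ∈ endEvent L N T
  · have h1 := mem_nonIntersectionEvent_iff hL hN hE (hω hE)
    rw [allPassageTimes_eq hL hE] at h1
    refine h1.trans ⟨fun h => ⟨hE, siteProd_of_admissible h⟩, fun h => ?_⟩
    by_contra hna
    have h2 : siteProd N T m (timesOfJumps N T (allJumpTimes L N T ω)) = 1 := h.2
    rw [siteProd_of_not_admissible hna] at h2
    exact zero_ne_one h2
  · exact ⟨fun h => absurd (nonIntersectionEvent_subset h) hE, fun h => absurd h.1 hE⟩

lemma siteProd_eq_zero_or_one (N : ℕ) (T : ℝ) (m : ℕ) (z : Fin (N + m + 2) → Fin (m + 1) → ℝ) :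
    siteProd N T m z = 0 ∨ siteProd N T m z = 1 := by
  by_cases h : AdmissibleTimes N T m z
  · exact Or.inr (siteProd_of_admissible h)
  · exact Or.inl (siteProd_of_not_admissible h)

/-- On the non-intersection event, the arrival times at all sites have a constant density on the
set of admissible arrival times. -/
theorem lintegral_nonIntersectionEvent [IsProbabilityMeasure P] (hL : IsBusProcess P (m + 1) L)
    (hN : m < N) {G : (Fin (N + m + 2) → Fin (m + 1) → ℝ) → ℝ≥0∞} (hG : Measurable G) :
    ∫⁻ ω in nonIntersectionEvent L N T, G (allPassageTimes L N T ω) ∂P =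
      ENNReal.ofReal (Real.exp (-T)) ^ (m + 1) * ∫⁻ z, siteProd N T m z * G z
        ∂(Measure.pi fun k : Fin (N + m + 2) => layerMeasure N T (m + 1) ((k : ℤ) - m)) := by
  have hJ := measurable_allJumpTimes (N := N) (T := T) hL
  have hZ := measurable_timesOfJumps N T m
  have hSG : Measurable fun z => siteProd N T m z * G z := (measurable_siteProd N T m).mul hG
  have hE := measurableSet_endEvent (N := N) (T := T) hL
  have hS : MeasurableSet {ω | siteProd N T m (timesOfJumps N T (allJumpTimes L N T ω)) = 1} :=
    (measurable_siteProd N T m).comp (hZ.comp hJ) (measurableSet_singleton 1)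
  have hc : MeasurableSet (Set.univ.pi fun _ : Fin (m + 1) => orderedChamber N 0 (T : ℝ)) :=
    MeasurableSet.univ_pi fun _ => measurableSet_orderedChamber _ _ _
  rw [setLIntegral_congr (nonIntersectionEvent_ae_eq hL hN), Set.inter_comm,
    ← Measure.restrict_restrict hS, ← lintegral_indicator hS]
  calc _ = ∫⁻ ω in endEvent L N T, (fun w => siteProd N T m (timesOfJumps N T w) *
        G (timesOfJumps N T w)) (allJumpTimes L N T ω) ∂P := by
        refine setLIntegral_congr_fun hE fun ω hω => ?_
        rcases siteProd_eq_zero_or_one N T m (timesOfJumps N T (allJumpTimes L N T ω)) with h | h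
        · rw [Set.indicator_of_notMem]
          · simp [h]
          · intro h'
            have h' : siteProd N T m (timesOfJumps N T (allJumpTimes L N T ω)) = 1 := h'
            rw [h] at h'
            exact zero_ne_one h'
        · rw [Set.indicator_of_mem (s := {ω | siteProd N T m
            (timesOfJumps N T (allJumpTimes L N T ω)) = 1}) h, allPassageTimes_eq hL hω]
          simp [h]
    _ = ENNReal.ofReal (Real.exp (-T)) ^ (m + 1) *
        ∫⁻ w in Set.univ.pi fun _ => orderedChamber N 0 T,
          siteProd N T m (timesOfJumps N T w) * G (timesOfJumps N T w) := by
        rw [← lintegral_map (f := fun w => siteProd N T m (timesOfJumps N T w) *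
          G (timesOfJumps N T w)) (hSG.comp hZ) hJ, map_allJumpTimes hL, lintegral_smul_measure,
          smul_eq_mul]
    _ = _ := by
        rw [← (measurePreserving_timesOfJumps N T m).lintegral_comp hSG,
          ← lintegral_indicator hc]
        congr 1
        refine lintegral_congr fun w => ?_
        by_cases hw : w ∈ Set.univ.pi fun _ : Fin (m + 1) => orderedChamber N 0 (T : ℝ)
        · rw [Set.indicator_of_mem hw]
        · rw [Set.indicator_of_notMem hw, siteProd_timesOfJumps_of_notMem hw, zero_mul]

end Buses

/-! ### The density of the arrival times at one site -/

lemma vandermondeSq_eq_det_sq {n : ℕ} (y : Fin n → ℝ) :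
    vandermondeSq y = (Matrix.vandermonde y).det ^ 2 := by
  simp only [vandermondeSq, Matrix.det_vandermonde, Finset.prod_pow]

lemma vandermondeSq_affine {n : ℕ} (a b : ℝ) (y : Fin n → ℝ) :
    vandermondeSq (fun j => a * y j + b) = a ^ (n * (n - 1)) * vandermondeSq y := by
  have h1 : ∏ i : Fin n, ∏ _j ∈ Finset.Ioi i, a ^ 2 = a ^ (n * (n - 1)) := by
    simp only [Finset.prod_const, Fin.card_Ioi, ← pow_mul, Finset.prod_pow_eq_pow_sum]
    congr 1
    rw [Fin.sum_univ_eq_sum_range (fun i => 2 * (n - 1 - i)) n,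
      Finset.sum_range_reflect (fun i => 2 * i) n, ← Finset.mul_sum, mul_comm,
      Finset.sum_range_id_mul_two]
  simp only [vandermondeSq, ← h1, ← Finset.prod_mul_distrib]
  refine Finset.prod_congr rfl fun i _ => Finset.prod_congr rfl fun j _ => ?_
  ring

lemma det_vandermonde_pos {n : ℕ} {y : Fin n → ℝ} (hy : StrictMono y) :
    0 < (Matrix.vandermonde y).det := by
  rw [Matrix.det_vandermonde]
  exact Finset.prod_pos fun i _ => Finset.prod_pos fun j hj =>
    sub_pos.2 (hy (Finset.mem_Ioi.1 hj))

lemma vandermondeSq_pos {n : ℕ} {y : Fin n → ℝ} (hy : StrictMono y) : 0 < vandermondeSq y := by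
  rw [vandermondeSq_eq_det_sq]
  exact pow_pos (det_vandermonde_pos hy) 2

lemma det_vandermonde_timeReflection {n : ℕ} (T : ℝ) (z : Fin n → ℝ) :
    (Matrix.vandermonde (timeReflection T z)).det = (Matrix.vandermonde z).det := by
  simp only [Matrix.det_vandermonde, timeReflection, Finset.prod_sigma']
  refine Finset.prod_bij' (fun p _ => ⟨p.2.rev, p.1.rev⟩) (fun p _ => ⟨p.2.rev, p.1.rev⟩)
    ?_ ?_ ?_ ?_ ?_
  · rintro ⟨i, j⟩ h; simpa using h
  · rintro ⟨i, j⟩ h; simpa using h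
  · rintro ⟨i, j⟩ _; simp
  · rintro ⟨i, j⟩ _; simp
  · rintro ⟨i, j⟩ _; simp

section OneSite

variable {N m x : ℕ} {T : ℝ}

lemma visits_of_between (hx : 1 ≤ x) (hxN : x + (m + 1) ≤ N + 1) (i : Fin (m + 1)) :
    Visits N x i := by
  unfold Visits; omega

lemma layerMeasure_of_between (hx : 1 ≤ x) (hxN : x + (m + 1) ≤ N + 1) :
    layerMeasure N T (m + 1) x = volume := by
  simp only [layerMeasure, siteMeasure, if_pos (visits_of_between hx hxN _)]
  rfl

lemma layerSet_of_between (hx : 1 ≤ x) (hxN : x + (m + 1) ≤ N + 1) :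
    layerSet N T (m + 1) x = orderedChamber (m + 1) 0 T := by
  have hv := visits_of_between (m := m) hx hxN
  ext z
  refine ⟨fun h => ⟨fun i j hij => h.2.2 i j hij (hv i) (hv j), fun i => h.1 i (hv i)⟩,
    fun h => ⟨fun i _ => h.2 i, fun i hi => absurd (hv i) hi, fun i j hij _ _ => h.1 hij⟩⟩

lemma det_leftMatrix_eq (hx : 1 ≤ x) (hxN : x + (m + 1) ≤ N + 1) (z : Fin (m + 1) → ℝ) :
    (leftMatrix N x z).det = (∏ i : Fin (m + 1), 1 / ((x + (i : ℕ) - 1)! : ℝ)) *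
      (∏ i, z i ^ (x - 1)) * (Matrix.vandermonde z).det := by
  have h : leftMatrix N x z = Matrix.of fun i j : Fin (m + 1) => z i ^ (x - 1) *
      (Matrix.of fun i j : Fin (m + 1) => 1 / ((x + (j : ℕ) - 1)! : ℝ) *
        Matrix.vandermonde z i j) i j := by
    ext i j
    have hc : clippedSite N (x : ℤ) i - 1 + (j : ℤ) = ((x + (j : ℕ) - 1 : ℕ) : ℤ) := by
      unfold clippedSite; omega
    have he : x + (j : ℕ) - 1 = x - 1 + j := by omega
    simp only [leftMatrix, Matrix.of_apply, Matrix.vandermonde_apply]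
    rw [hc, divPow_natCast, he, pow_add]
    ring
  rw [h, Matrix.det_mul_column, Matrix.det_mul_row]
  ring

lemma det_leftMatrix_timeReflection_eq (hx : 1 ≤ x) (hxN : x + (m + 1) ≤ N + 1)
    (z : Fin (m + 1) → ℝ) :
    (leftMatrix N ((N : ℤ) + 1 - (x + m : ℕ)) (timeReflection T z)).det =
      (∏ i : Fin (m + 1), 1 / ((N - x - (i : ℕ))! : ℝ)) *
      (∏ i, (T - z i) ^ (N + 1 - x - (m + 1))) * (Matrix.vandermonde z).det := by
  have hcast : (N : ℤ) + 1 - (x + m : ℕ) = ((N + 1 - (x + m) : ℕ) : ℤ) := by omega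
  rw [hcast, det_leftMatrix_eq (by omega) (by omega), det_vandermonde_timeReflection]
  congr 2
  · rw [← Equiv.prod_comp Fin.revPerm]
    refine Finset.prod_congr rfl fun i _ => ?_
    have : N + 1 - (x + m) + (Fin.revPerm i : ℕ) - 1 = N - x - i := by
      simp only [Fin.revPerm_apply, Fin.val_rev]; omega
    rw [this]
  · rw [← Equiv.prod_comp Fin.revPerm]
    refine Finset.prod_congr rfl fun i _ => ?_
    have : N + 1 - (x + m) - 1 = N + 1 - x - (m + 1) := by omega
    rw [this]
    simp [timeReflection]

/-- The unnormalized density of the arrival times at the site `x`. -/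
noncomputable def arrivalWeight (N m x : ℕ) (T : ℝ) (z : Fin (m + 1) → ℝ) : ℝ :=
  (∏ i : Fin (m + 1), 1 / (((x + (i : ℕ) - 1)! : ℝ) * ((N - x - (i : ℕ))! : ℝ))) *
    vandermondeSq z * ∏ j, (z j ^ (x - 1) * (T - z j) ^ (N + 1 - x - (m + 1)))

lemma arrivalWeight_pos {z : Fin (m + 1) → ℝ} (hz : z ∈ orderedChamber (m + 1) 0 T) :
    0 < arrivalWeight N m x T z := by
  refine mul_pos (mul_pos (Finset.prod_pos fun i _ => by positivity) (vandermondeSq_pos hz.1))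
    (Finset.prod_pos fun j _ => ?_)
  have h1 := (hz.2 j).1
  have h2 := sub_pos.2 (hz.2 j).2
  positivity

lemma continuous_vandermondeSq (n : ℕ) : Continuous (vandermondeSq : (Fin n → ℝ) → ℝ) := by
  unfold vandermondeSq; fun_prop

lemma measurable_arrivalWeight (N m x : ℕ) (T : ℝ) : Measurable (arrivalWeight N m x T) := by
  have := continuous_vandermondeSq (m + 1)
  unfold arrivalWeight
  exact Continuous.measurable (by fun_prop)

lemma det_mul_det_eq_arrivalWeight (hx : 1 ≤ x) (hxN : x + (m + 1) ≤ N + 1)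
    (z : Fin (m + 1) → ℝ) :
    (leftMatrix N x z).det * (leftMatrix N ((N : ℤ) + 1 - (x + m : ℕ)) (timeReflection T z)).det =
      arrivalWeight N m x T z := by
  rw [det_leftMatrix_eq hx hxN, det_leftMatrix_timeReflection_eq hx hxN, arrivalWeight,
    vandermondeSq_eq_det_sq]
  simp only [one_div, mul_inv, Finset.prod_mul_distrib]
  ring

/-- The determinant in the normalizing constant, for the time horizon `T`. -/
lemma det_divPow_eq (hN : m < N) :
    (Matrix.of fun i j : Fin (m + 1) => divPow ((N : ℤ) - i + j) T).det =
      T ^ ((m + 1) * N) *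
        (Matrix.of fun i j : Fin (m + 1) => 1 / ((N + (i : ℕ) - (j : ℕ))! : ℝ)).det := by
  have h : (Matrix.of fun i j : Fin (m + 1) => divPow ((N : ℤ) - i + j) T) =
      Matrix.of fun i j : Fin (m + 1) => T ^ (N - (i : ℕ)) *
        (Matrix.of fun i j : Fin (m + 1) => T ^ (j : ℕ) *
          (Matrix.of fun i j : Fin (m + 1) => 1 / ((N + (i : ℕ) - (j : ℕ))! : ℝ)).transpose
            i j) i j := by
    ext i j
    have hc : (N : ℤ) - i + j = ((N + (j : ℕ) - i : ℕ) : ℤ) := by omega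
    have he : N + (j : ℕ) - i = (N - i) + j := by omega
    simp only [Matrix.of_apply, Matrix.transpose_apply]
    rw [hc, divPow_natCast, he, pow_add]
    ring
  rw [h, Matrix.det_mul_column, Matrix.det_mul_row, Matrix.det_transpose, ← mul_assoc,
    ← Finset.prod_mul_distrib]
  congr 1
  have : ∀ i : Fin (m + 1), T ^ (N - (i : ℕ)) * T ^ (i : ℕ) = T ^ N := fun i => by
    rw [← pow_add]; congr 1; omega
  simp only [this, Finset.prod_const, Finset.card_univ, Fintype.card_fin, ← pow_mul]
  ring

end OneSite

section Conditioning

variable {Ω : Type*} [MeasurableSpace Ω] {P : Measure Ω} {m N x : ℕ}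
  {T : ℝ≥0} {L : Fin (m + 1) → ℝ≥0 → Ω → ℤ}

lemma measurable_passageTimes (hL : IsBusProcess P (m + 1) L) (y : ℤ) :
    Measurable fun ω i => passageTime (L i) T y ω :=
  measurable_pi_lambda _ fun i => measurable_passageTime (hL.poisson i).measurable
    (hL.poisson i).monotone (hL.poisson i).rightContinuous T y

lemma measure_nonIntersectionEvent [IsProbabilityMeasure P]
    (hL : IsBusProcess P (m + 1) L) (hN : m < N) (hT : 0 < T) :
    P (nonIntersectionEvent L N T) = ENNReal.ofReal (Real.exp (-T)) ^ (m + 1) *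
      ENNReal.ofReal (Matrix.of fun i j : Fin (m + 1) => divPow ((N : ℤ) - i + j) (T : ℝ)).det := by
  have h := lintegral_nonIntersectionEvent (T := T) hL hN
    (G := fun _ => 1) measurable_const
  simp only [mul_one] at h
  rw [lintegral_siteProd hN (NNReal.coe_pos.2 hT)] at h
  rw [← h, lintegral_one, Measure.restrict_apply_univ]

lemma map_passageTimes [IsProbabilityMeasure P]
    (hL : IsBusProcess P (m + 1) L) (hN : m < N) (hT : 0 < T) (hx : 1 ≤ x)
    (hxN : x + (m + 1) ≤ N + 1) :
    (P.restrict (nonIntersectionEvent L N T)).map (fun ω i => passageTime (L i) T x ω) =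
      ENNReal.ofReal (Real.exp (-T)) ^ (m + 1) •
        (volume.restrict (orderedChamber (m + 1) 0 T)).withDensity
          fun z => ENNReal.ofReal (arrivalWeight N m x T z) := by
  ext s hs
  have hT' : (0 : ℝ) < T := NNReal.coe_pos.2 hT
  have hp : x + m < N + m + 1 := by omega
  have hF : Measurable (s.indicator (1 : (Fin (m + 1) → ℝ) → ℝ≥0∞)) := measurable_one.indicator hs
  have e : ((x + m : ℕ) : ℤ) - m = x := by push_cast; ring
  have h1 := lintegral_nonIntersectionEvent (T := T) hL hN
    (G := fun z => s.indicator 1 (z ⟨x + m, by omega⟩)) (hF.comp (measurable_pi_apply _))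
  rw [lintegral_siteProd_mul_eq hN hT' hF hp, e, layerMeasure_of_between hx hxN,
    layerSet_of_between hx hxN] at h1
  have hch := measurableSet_orderedChamber (m + 1) 0 (T : ℝ)
  rw [Measure.smul_apply, withDensity_apply _ hs, ← lintegral_indicator hs, smul_eq_mul,
    ← lintegral_indicator_one hs, lintegral_map hF (measurable_passageTimes hL _)]
  have hz : ∀ ω, (fun i => passageTime (L i) T x ω) =
      allPassageTimes L N T ω ⟨x + m, by omega⟩ := fun ω => by
    ext i; simp only [allPassageTimes, e]
  simp only [hz]
  rw [h1]
  congr 1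
  refine setLIntegral_congr_fun hch fun z hzc => ?_
  by_cases hzs : z ∈ s
  · have hl : 0 ≤ (leftMatrix N x z).det :=
      det_leftMatrix_nonneg hN hT' (by omega) (by rwa [layerSet_of_between hx hxN])
    simp only [Set.indicator_of_mem hzs, Pi.one_apply, mul_one]
    rw [← ENNReal.ofReal_mul hl, det_mul_det_eq_arrivalWeight hx hxN]
  · simp [Set.indicator_of_notMem hzs]

lemma measure_nonIntersectionEvent_ne_zero [IsProbabilityMeasure P]
    (hL : IsBusProcess P (m + 1) L) (hN : m < N)
    (hT : 0 < T) : P (nonIntersectionEvent L N T) ≠ 0 := by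
  have h := map_passageTimes (x := 1) hL hN hT le_rfl (by omega)
  intro h0
  have h1 : (P.restrict (nonIntersectionEvent L N T)).map
      (fun ω i => passageTime (L i) T ((1 : ℕ) : ℤ) ω) = 0 := by
    rw [Measure.restrict_eq_zero.2 h0, Measure.map_zero]
  rw [h1] at h
  have h2 := congrArg (fun μ => μ Set.univ) h.symm
  simp only [Measure.smul_apply, Measure.coe_zero, Pi.zero_apply, smul_eq_mul, mul_eq_zero,
    withDensity_apply _ MeasurableSet.univ, Measure.restrict_univ] at h2
  rcases h2 with h2 | h2
  · exact absurd h2 (pow_ne_zero _ (by simpa using Real.exp_pos _))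
  · rw [lintegral_eq_zero_iff (measurable_arrivalWeight _ _ _ _).ennreal_ofReal] at h2
    have hch := measurableSet_orderedChamber (m + 1) 0 (T : ℝ)
    have h3 : ∀ᵐ z ∂(volume.restrict (orderedChamber (m + 1) 0 (T : ℝ))), False := by
      filter_upwards [h2, ae_restrict_mem hch] with z hz hzc
      exact absurd (ENNReal.ofReal_eq_zero.1 hz) (not_le.2 (arrivalWeight_pos hzc))
    rw [Filter.eventually_false_iff_eq_bot, ae_eq_bot, Measure.restrict_eq_zero,
      volume_orderedChamber _ T.coe_nonneg, ENNReal.ofReal_eq_zero, divPow_natCast, sub_zero] at h3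
    have hT' : (0 : ℝ) < T := NNReal.coe_pos.2 hT
    exact absurd h3 (not_le.2 (by positivity))

lemma arrivalTime_eq_passageTime (hL : IsBusProcess P (m + 1) L) (hN : m < N) (hx : 1 ≤ x)
    (hxN : x + (m + 1) ≤ N + 1) {ω : Ω} (hω : ω ∈ endEvent L N T)
    (hreg : ω ∈ regularEvent L N T) (i : Fin (m + 1)) :
    arrivalTime (L i) x ω = passageTime (L i) T x ω := by
  have h := isArrivalSystem_of_regular hL hω hreg
  have hv := visits_of_between (m := m) hx hxN i
  obtain ⟨t, ht⟩ : ∃ t : ℝ≥0, (t : ℝ) = passageTime (L i) T x ω := ⟨⟨_, passageTime_nonneg⟩, rfl⟩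
  have htT : t ≤ T := by rw [← NNReal.coe_le_coe, ht]; exact passageTime_le
  have h1 : (x : ℤ) ≤ L i t ω := (h.le_iff x i t htT hv.2).1 ht.ge
  have h2 : L i t ω = x := by
    refine le_antisymm ?_ h1
    by_contra! hlt
    by_cases he : (x : ℤ) + 1 ≤ (N : ℤ) - i
    · have := (h.le_iff (x + 1) i t htT he).2 hlt
      rw [ht] at this
      exact absurd (h.lt_succ hN hv.1.le hv.2) this.not_gt
    · have := h.le_end i t htT
      omega
  refine le_antisymm ?_ ?_
  · rw [← ht]
    exact NNReal.coe_le_coe.2 (csInf_le (OrderBot.bddBelow _) h2)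
  · refine NNReal.coe_le_coe.2 (csInf_le_csInf (OrderBot.bddBelow _) ⟨t, h2⟩ ?_)
    intro s hs
    have hs : L i s ω = x := hs
    exact Or.inl (show (x : ℤ) ≤ L i s ω from hs.ge)

/-- Conditionally on the non-intersection event, the arrival times have the density
`arrivalWeight`, up to normalization. -/
theorem hasLaw_arrivalTime [IsProbabilityMeasure P]
    (hL : IsBusProcess P (m + 1) L) (hN : m < N) (hT : 0 < T)
    (hx : 1 ≤ x) (hxN : x + (m + 1) ≤ N + 1) :
    HasLaw (fun ω j => arrivalTime (L j) x ω)
      (orderedDensityMeasure (m + 1) 0 T fun t => arrivalWeight N m x T t /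
        (Matrix.of fun i j : Fin (m + 1) => divPow ((N : ℤ) - i + j) (T : ℝ)).det)
      (cond P (nonIntersectionEvent L N T)) := by
  set E := nonIntersectionEvent L N T with hE
  set D := (Matrix.of fun i j : Fin (m + 1) => divPow ((N : ℤ) - i + j) (T : ℝ)).det with hD
  have hP := measure_nonIntersectionEvent hL hN hT
  have hP0 := measure_nonIntersectionEvent_ne_zero hL hN hT
  rw [← hE, ← hD] at hP
  have hc0 : ENNReal.ofReal (Real.exp (-T)) ^ (m + 1) ≠ 0 :=
    pow_ne_zero _ (by simpa using Real.exp_pos _)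
  have hct : ENNReal.ofReal (Real.exp (-T)) ^ (m + 1) ≠ ∞ := by finiteness
  have hDpos : 0 < D := by
    by_contra! h
    rw [← hE, hP, ENNReal.ofReal_eq_zero.2 h, mul_zero] at hP0
    exact hP0 rfl
  have hcond : cond P E = (P E)⁻¹ • P.restrict E := rfl
  have hae : (fun ω j => arrivalTime (L j) x ω) =ᵐ[cond P E]
      fun ω j => passageTime (L j) T x ω := by
    rw [hcond]
    refine Measure.ae_smul_measure ?_ _
    have h1 : ∀ᵐ ω ∂(P.restrict (endEvent L N T)), ∀ j,
        arrivalTime (L j) x ω = passageTime (L j) T x ω := by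
      filter_upwards [ae_mem_regularEvent hL, ae_restrict_mem (measurableSet_endEvent hL)]
        with ω h2 h3 using arrivalTime_eq_passageTime hL hN hx hxN h3 h2
    filter_upwards [ae_restrict_of_ae_restrict_of_subset nonIntersectionEvent_subset h1]
      with ω hω using funext hω
  have hmeas := measurable_passageTimes (T := T) hL (x : ℤ)
  refine ⟨hmeas.aemeasurable.congr hae.symm, ?_⟩
  rw [Measure.map_congr hae, hcond, Measure.map_smul, map_passageTimes hL hN hT hx hxN, hP,
    orderedDensityMeasure, smul_smul, ENNReal.mul_inv (Or.inl hc0) (Or.inl hct), mul_right_comm,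
    ENNReal.inv_mul_cancel hc0 hct, one_mul,
    ← withDensity_smul _ (measurable_arrivalWeight _ _ _ _).ennreal_ofReal]
  congr 1
  ext z
  rw [Pi.smul_apply, smul_eq_mul, div_eq_inv_mul, ENNReal.ofReal_mul (inv_nonneg.2 hDpos.le),
    ENNReal.ofReal_inv_of_pos hDpos]

end Conditioning

lemma arrivalWeight_div_eq {N m x : ℕ} {T : ℝ} (hT : 0 < T) (hN : m < N) (hx : 1 ≤ x)
    (hxN : x + (m + 1) ≤ N + 1) (t : Fin (m + 1) → ℝ) :
    arrivalWeight N m x T t /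
        (Matrix.of fun i j : Fin (m + 1) => divPow ((N : ℤ) - i + j) T).det =
      (T ^ (m + 1))⁻¹ * unitDensity N (m + 1) x fun j => t j / T := by
  have h1 : vandermondeSq t = T ^ ((m + 1) * m) * vandermondeSq fun j => t j / T := by
    have := vandermondeSq_affine T 0 fun j => t j / T
    simp only [add_zero, mul_div_cancel₀ _ hT.ne'] at this
    exact this
  have h2 : ∏ j, (t j ^ (x - 1) * (T - t j) ^ (N + 1 - x - (m + 1))) =
      T ^ ((m + 1) * (N - (m + 1))) *
        ∏ j, ((t j / T) ^ (x - 1) * (1 - t j / T) ^ (N + 1 - x - (m + 1))) := by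
    have : T ^ ((m + 1) * (N - (m + 1))) = ∏ _j : Fin (m + 1), T ^ (N - (m + 1)) := by
      rw [Finset.prod_const, Finset.card_univ, Fintype.card_fin, ← pow_mul, mul_comm]
    rw [this, ← Finset.prod_mul_distrib]
    refine Finset.prod_congr rfl fun j _ => ?_
    have e : N - (m + 1) = (x - 1) + (N + 1 - x - (m + 1)) := by omega
    have e1 : t j = T * (t j / T) := by field_simp
    have e2 : T - t j = T * (1 - t j / T) := by field_simp
    rw [e, pow_add, e2]
    nth_rw 1 [e1]
    rw [mul_pow, mul_pow]
    ring
  have h3 : T ^ ((m + 1) * N) =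
      T ^ (m + 1) * (T ^ ((m + 1) * m) * T ^ ((m + 1) * (N - (m + 1)))) := by
    rw [← pow_add, ← pow_add]
    congr 1
    obtain ⟨d, rfl⟩ : ∃ d, N = m + 1 + d := ⟨N - (m + 1), by omega⟩
    rw [Nat.add_sub_cancel_left]; ring
  rw [det_divPow_eq hN, arrivalWeight, unitDensity, busConstant, h1, h2, h3, div_eq_mul_inv,
    mul_inv, mul_inv, mul_inv]
  have hT1 : T ^ ((m + 1) * m) ≠ 0 := pow_ne_zero _ hT.ne'
  have hT2 : T ^ ((m + 1) * (N - (m + 1))) ≠ 0 := pow_ne_zero _ hT.ne'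
  field_simp

lemma unitDensity_eq_jacobiDensity {N n x : ℕ} (hx : 1 ≤ x) (hxN : x + n ≤ N + 1)
    (y : Fin n → ℝ) :
    unitDensity N n x y = 2 ^ n * jacobiDensity N n x fun j => 2 * y j - 1 := by
  have h1 := vandermondeSq_affine 2 (-1) y
  simp only [← sub_eq_add_neg] at h1
  have h2 : ∏ j, ((1 + (2 * y j - 1)) ^ (x - 1) * (1 - (2 * y j - 1)) ^ (N + 1 - x - n)) =
      2 ^ (n * (N - n)) * ∏ j, (y j ^ (x - 1) * (1 - y j) ^ (N + 1 - x - n)) := by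
    have : (2 : ℝ) ^ (n * (N - n)) = ∏ _j : Fin n, 2 ^ (N - n) := by
      rw [Finset.prod_const, Finset.card_univ, Fintype.card_fin, ← pow_mul, mul_comm]
    rw [this, ← Finset.prod_mul_distrib]
    refine Finset.prod_congr rfl fun j _ => ?_
    have e : N - n = (x - 1) + (N + 1 - x - n) := by omega
    have e1 : 1 + (2 * y j - 1) = 2 * y j := by ring
    have e2 : 1 - (2 * y j - 1) = 2 * (1 - y j) := by ring
    rw [e, pow_add, e1, e2, mul_pow, mul_pow]
    ring
  have h3 : (2 : ℝ) ^ (n * N) = 2 ^ n * (2 ^ (n * (n - 1)) * 2 ^ (n * (N - n))) := by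
    rw [← pow_add, ← pow_add]
    congr 1
    obtain ⟨d, rfl⟩ : ∃ d, N = n + d := ⟨N - n, by omega⟩
    rcases n with _ | n
    · simp
    · simp only [Nat.add_sub_cancel_left, Nat.add_sub_cancel]; ring
  rw [unitDensity, jacobiDensity, busConstant', h1, h2, h3]
  field_simp

/-! ### Affine changes of variables -/

lemma map_affine_volume {a : ℝ} (ha : 0 < a) (b : ℝ) :
    (volume : Measure ℝ).map (fun t => a * t + b) = ENNReal.ofReal a⁻¹ • volume := by
  have h := Measure.map_map (μ := (volume : Measure ℝ)) (measurable_add_const b)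
    (measurable_const_mul a)
  have e : ((fun t => t + b) ∘ fun t => a * t) = fun t => a * t + b := rfl
  rw [e] at h
  rw [← h, Real.map_volume_mul_left ha.ne', Measure.map_smul, map_add_right_eq_self,
    abs_of_pos (inv_pos.2 ha)]

lemma map_affine_volume_pi (n : ℕ) {a : ℝ} (ha : 0 < a) (b : ℝ) :
    (volume : Measure (Fin n → ℝ)).map (fun t j => a * t j + b) =
      ENNReal.ofReal a⁻¹ ^ n • volume := by
  have hm : Measurable fun (t : Fin n → ℝ) j => a * t j + b := by fun_prop
  have h1 : Measure.pi (fun _ : Fin n => ENNReal.ofReal a⁻¹ • (volume : Measure ℝ)) =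
      (volume : Measure (Fin n → ℝ)).map (fun t j => a * t j + b) := by
    have : SigmaFinite (ENNReal.ofReal a⁻¹ • (volume : Measure ℝ)) :=
      inferInstanceAs (SigmaFinite ((a⁻¹).toNNReal • (volume : Measure ℝ)))
    refine Measure.pi_eq fun s hs => ?_
    have hset : (fun (t : Fin n → ℝ) j => a * t j + b) ⁻¹' Set.univ.pi s =
        Set.univ.pi fun j => (fun t => a * t + b) ⁻¹' s j := by
      ext t; simp
    rw [Measure.map_apply hm (MeasurableSet.univ_pi hs), hset, volume_pi, Measure.pi_pi]
    refine Finset.prod_congr rfl fun j _ => ?_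
    rw [← map_affine_volume ha b, Measure.map_apply (by fun_prop) (hs j)]
  rw [← h1]
  have : SigmaFinite (ENNReal.ofReal a⁻¹ • (volume : Measure ℝ)) :=
    inferInstanceAs (SigmaFinite ((a⁻¹).toNNReal • (volume : Measure ℝ)))
  refine Measure.pi_eq fun s hs => ?_
  simp [volume_pi, Measure.pi_pi, Finset.prod_mul_distrib]

lemma affine_mem_orderedChamber_iff {n : ℕ} {a : ℝ} (ha : 0 < a) (b c d : ℝ) (t : Fin n → ℝ) :
    (fun j => a * t j + b) ∈ orderedChamber n (a * c + b) (a * d + b) ↔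
      t ∈ orderedChamber n c d := by
  simp only [orderedChamber, Set.mem_ofPred_eq, StrictMono, Set.mem_Ioo, add_lt_add_iff_right,
    mul_lt_mul_iff_right₀ ha]

/-- An ordered density is transported by an affine map. -/
lemma map_affine_orderedDensityMeasure {n : ℕ} {a : ℝ} (ha : 0 < a) (b c d : ℝ)
    {f g : (Fin n → ℝ) → ℝ} (hg : Measurable g) (hfg : ∀ t, f t = a ^ n * g fun j => a * t j + b) :
    (orderedDensityMeasure n c d f).map (fun t j => a * t j + b) =
      orderedDensityMeasure n (a * c + b) (a * d + b) g := by
  have hm : Measurable fun (t : Fin n → ℝ) j => a * t j + b := by fun_prop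
  ext s hs
  have hc := measurableSet_orderedChamber n c d
  have hc' := measurableSet_orderedChamber n (a * c + b) (a * d + b)
  have hG : Measurable ((s ∩ orderedChamber n (a * c + b) (a * d + b)).indicator
      fun y => ENNReal.ofReal (g y)) := hg.ennreal_ofReal.indicator (hs.inter hc')
  rw [Measure.map_apply hm hs, orderedDensityMeasure, orderedDensityMeasure,
    withDensity_apply _ (hm hs), withDensity_apply _ hs, Measure.restrict_restrict (hm hs),
    Measure.restrict_restrict hs, ← lintegral_indicator ((hm hs).inter hc),
    ← lintegral_indicator (hs.inter hc')]
  have h1 : ∀ t, ((fun (t : Fin n → ℝ) j => a * t j + b) ⁻¹' s ∩ orderedChamber n c d).indicator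
      (fun t => ENNReal.ofReal (f t)) t = ENNReal.ofReal a ^ n *
      (s ∩ orderedChamber n (a * c + b) (a * d + b)).indicator (fun y => ENNReal.ofReal (g y))
        (fun j => a * t j + b) := fun t => by
    have hmem := affine_mem_orderedChamber_iff ha b c d t
    by_cases ht : (fun j => a * t j + b) ∈ s ∩ orderedChamber n (a * c + b) (a * d + b)
    · have ht' : t ∈ (fun (t : Fin n → ℝ) j => a * t j + b) ⁻¹' s ∩ orderedChamber n c d :=
        ⟨ht.1, hmem.1 ht.2⟩
      rw [Set.indicator_of_mem ht, Set.indicator_of_mem ht',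
        hfg, ENNReal.ofReal_mul (pow_nonneg ha.le n), ENNReal.ofReal_pow ha.le]
    · rw [Set.indicator_of_notMem ht, mul_zero,
        Set.indicator_of_notMem fun h => ht ⟨h.1, hmem.2 h.2⟩]
  have hGm : Measurable fun t : Fin n → ℝ => (s ∩ orderedChamber n (a * c + b) (a * d + b)).indicator
      (fun y => ENNReal.ofReal (g y)) (fun j => a * t j + b) := hG.comp hm
  simp only [h1]
  rw [lintegral_const_mul _ hGm, ← lintegral_map hG hm, map_affine_volume_pi n ha,
    lintegral_smul_measure, smul_eq_mul, ← mul_assoc, ← mul_pow, ← ENNReal.ofReal_mul ha.le,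
    mul_inv_cancel₀ ha.ne', ENNReal.ofReal_one, one_pow, one_mul]

/-! ### Ordered eigenvalues -/

/-- A nondecreasing tuple is determined by the polynomial whose roots are its entries. -/
lemma eq_of_prod_sub_eq {n : ℕ} {μ ν : Fin n → ℝ} (hμ : Monotone μ) (hν : Monotone ν)
    {s : Set ℝ} (hs : s.Infinite) (h : ∀ t ∈ s, ∏ j, (t - μ j) = ∏ j, (t - ν j)) : μ = ν := by
  have hpoly : ∏ j, (Polynomial.X - Polynomial.C (μ j)) =
      ∏ j, (Polynomial.X - Polynomial.C (ν j)) := by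
    refine Polynomial.eq_of_infinite_eval_eq _ _ (hs.mono fun t ht => ?_)
    simpa [Polynomial.eval_prod] using h t ht
  have hr : ∀ ν : Fin n → ℝ, (∏ j, (Polynomial.X - Polynomial.C (ν j))).roots =
      Multiset.map ν Finset.univ.val := fun ν => by
    rw [← Polynomial.roots_multiset_prod_X_sub_C (Multiset.map ν Finset.univ.val),
      Multiset.map_map]
    rfl
  have hroots := congrArg Polynomial.roots hpoly
  rw [hr, hr, Fin.univ_val_map, Fin.univ_val_map, Multiset.coe_eq_coe] at hroots
  exact List.ofFn_injective
    (hroots.eq_of_pairwise' hμ.sortedLE_ofFn.pairwise hν.sortedLE_ofFn.pairwise)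

section OrderedEigenvalues

variable {n : ℕ}

lemma monotone_orderedEigenvalues (M : HermitianMatrix n) : Monotone (orderedEigenvalues M) :=
  fun i j hij => M.2.eigenvalues₀_antitone (by
    rw [Fin.le_def, Fin.val_cast, Fin.val_cast, ← Fin.le_def]
    exact Fin.rev_le_rev.2 hij)

lemma prod_eigenvalues_eq {R : Type*} [CommMonoid R] (M : HermitianMatrix n) (g : ℝ → R) :
    ∏ i, g (M.2.eigenvalues i) = ∏ j, g (orderedEigenvalues M j) := by
  have h1 : ∏ i, g (M.2.eigenvalues i) = ∏ k, g (M.2.eigenvalues₀ k) :=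
    Equiv.prod_comp (Fintype.equivOfCardEq (Fintype.card_fin _)).symm
      (fun k => g (M.2.eigenvalues₀ k))
  rw [h1]
  exact (Equiv.prod_comp (Fin.revPerm.trans (finCongr (Fintype.card_fin n).symm))
    (fun k => g (M.2.eigenvalues₀ k))).symm

lemma det_conjStarAlgAut (U : Matrix.unitaryGroup (Fin n) ℂ) (A : Matrix (Fin n) (Fin n) ℂ) :
    (Unitary.conjStarAlgAut ℂ (Matrix (Fin n) (Fin n) ℂ) U A).det = A.det := by
  rw [Unitary.conjStarAlgAut_apply, Matrix.det_mul, Matrix.det_mul, mul_right_comm,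
    ← Matrix.det_mul, Unitary.mul_star_self_of_mem U.2, Matrix.det_one, one_mul]

lemma det_cfc_eq (M : HermitianMatrix n) (f : ℝ → ℝ) :
    (M.2.cfc f).det = ((∏ j, f (orderedEigenvalues M j) : ℝ) : ℂ) := by
  rw [Matrix.IsHermitian.cfc, det_conjStarAlgAut, Matrix.det_diagonal, ← prod_eigenvalues_eq M f]
  simp

lemma det_smul_one_add_smul (M : HermitianMatrix n) (a b : ℝ) :
    ((a : ℂ) • 1 + (b : ℂ) • M.1).det = ((∏ j, (a + b * orderedEigenvalues M j) : ℝ) : ℂ) := by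
  have h : (a : ℂ) • (1 : Matrix (Fin n) (Fin n) ℂ) + (b : ℂ) • M.1 =
      Unitary.conjStarAlgAut ℂ (Matrix (Fin n) (Fin n) ℂ) M.2.eigenvectorUnitary
        (Matrix.diagonal fun i => ((a + b * M.2.eigenvalues i : ℝ) : ℂ)) := by
    have h1 : (Matrix.diagonal fun i => ((a + b * M.2.eigenvalues i : ℝ) : ℂ)) =
        (a : ℂ) • 1 + (b : ℂ) • Matrix.diagonal (RCLike.ofReal ∘ M.2.eigenvalues) := by
      ext i j
      by_cases hij : i = j
      · subst hij; simp
      · simp [hij]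
    rw [h1, map_add, map_smul, map_smul, map_one, ← M.2.spectral_theorem]
  rw [h, det_conjStarAlgAut, Matrix.det_diagonal, ← prod_eigenvalues_eq M fun u => a + b * u]
  push_cast
  rfl

lemma det_sub_eq (M : HermitianMatrix n) (t : ℝ) :
    ((t : ℂ) • 1 - M.1).det = ((∏ j, (t - orderedEigenvalues M j) : ℝ) : ℂ) := by
  have := det_smul_one_add_smul M t (-1)
  simp only [neg_one_mul, Complex.ofReal_neg, Complex.ofReal_one, neg_smul, one_smul,
    ← sub_eq_add_neg] at this
  exact this

lemma measurable_entry (i j : Fin n) : Measurable fun M : HermitianMatrix n => M.1 i j := by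
  have h : Measurable fun (M : HermitianMatrix n) (p : Fin n × Fin n) => M.1 p.1 p.2 :=
    comap_measurable _
  exact (measurable_pi_apply (i, j)).comp h

/-- The ordered eigenvalues are measurable, since they are determined in a one-to-one way by the
values of the characteristic polynomial at the natural numbers, and an injective measurable map
between standard Borel spaces is a measurable embedding. -/
lemma measurable_orderedEigenvalues :
    Measurable fun M : HermitianMatrix n => orderedEigenvalues M := by
  have hms : MeasurableSet {μ : Fin n → ℝ | Monotone μ} := by
    simp only [Monotone, Set.ofPred_forall]
    exact .iInter fun i => .iInter fun j => .iInter fun _ =>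
      measurableSet_le (measurable_pi_apply i) (measurable_pi_apply j)
  have : StandardBorelSpace {μ : Fin n → ℝ // Monotone μ} := hms.standardBorel
  let g : {μ : Fin n → ℝ // Monotone μ} → ℕ → ℝ := fun μ k => ∏ j, ((k : ℝ) - μ.1 j)
  have hg : Measurable g := by
    refine measurable_pi_lambda _ fun k => Finset.measurable_fun_prod _ fun j _ => ?_
    exact measurable_const.sub ((measurable_pi_apply j).comp measurable_subtype_coe)
  have hinj : Function.Injective g := by
    intro μ ν h
    refine Subtype.ext (eq_of_prod_sub_eq μ.2 ν.2
      (Set.infinite_range_of_injective (Nat.cast_injective (R := ℝ))) ?_)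
    rintro _ ⟨k, rfl⟩
    exact congrFun h k
  let e : HermitianMatrix n → {μ : Fin n → ℝ // Monotone μ} :=
    fun M => ⟨orderedEigenvalues M, monotone_orderedEigenvalues M⟩
  have he : Measurable e := by
    refine (hg.measurableEmbedding hinj).measurable_comp_iff.1 (measurable_pi_lambda _ fun k => ?_)
    have h1 : ∀ M : HermitianMatrix n, (g ∘ e) M k = (((k : ℝ) : ℂ) • 1 - M.1).det.re := fun M => by
      rw [det_sub_eq, Complex.ofReal_re]; rfl
    simp only [h1, Matrix.det_apply']
    refine Complex.measurable_re.comp (Finset.measurable_fun_sum _ fun σ _ =>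
      measurable_const.mul (Finset.measurable_fun_prod _ fun i _ => ?_))
    exact measurable_const.sub (measurable_entry _ _)
  exact measurable_subtype_coe.comp he

/-- The Jacobi weight as a function of the eigenvalues. -/
noncomputable def eigenvalueWeight (α β : ℕ) (y : Fin n → ℝ) : ℝ :=
  (∏ j, ((1 + y j) ^ β * (1 - y j) ^ α)) *
    ∏ j, (Set.Ioo (-1 : ℝ) 1).indicator (fun _ => 1) (y j)

lemma jacobiWeight_eq (α β : ℕ) (M : HermitianMatrix n) :
    jacobiWeight α β M = eigenvalueWeight α β (orderedEigenvalues M) := by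
  have h1 := det_smul_one_add_smul M 1 1
  have h2 := det_sub_eq M 1
  simp only [Complex.ofReal_one, one_smul, one_mul] at h1 h2
  rw [jacobiWeight, h1, h2, det_cfc_eq, ← Complex.ofReal_pow, ← Complex.ofReal_pow,
    ← Complex.ofReal_mul, ← Complex.ofReal_mul, Complex.ofReal_re, eigenvalueWeight,
    Finset.prod_mul_distrib, Finset.prod_pow, Finset.prod_pow]

lemma measurable_eigenvalueWeight (α β : ℕ) :
    Measurable (eigenvalueWeight α β : (Fin n → ℝ) → ℝ) := by
  refine Measurable.mul (by fun_prop) (Finset.measurable_fun_prod _ fun j _ => ?_)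
  exact (measurable_const.indicator measurableSet_Ioo).comp (measurable_pi_apply j)

lemma eigenvalueWeight_of_mem {α β : ℕ} {y : Fin n → ℝ} (hy : ∀ j, y j ∈ Set.Ioo (-1 : ℝ) 1) :
    eigenvalueWeight α β y = ∏ j, ((1 + y j) ^ β * (1 - y j) ^ α) := by
  have h : ∏ j, (Set.Ioo (-1 : ℝ) 1).indicator (fun _ => (1 : ℝ)) (y j) = 1 :=
    Finset.prod_eq_one fun j _ => Set.indicator_of_mem (hy j) _
  rw [eigenvalueWeight, h, mul_one]

lemma eigenvalueWeight_of_notMem {α β : ℕ} {y : Fin n → ℝ}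
    (hy : ¬ ∀ j, y j ∈ Set.Ioo (-1 : ℝ) 1) : eigenvalueWeight α β y = 0 := by
  push Not at hy
  obtain ⟨j, hj⟩ := hy
  have h : ∏ j, (Set.Ioo (-1 : ℝ) 1).indicator (fun _ => (1 : ℝ)) (y j) = 0 :=
    Finset.prod_eq_zero (Finset.mem_univ j) (Set.indicator_of_notMem hj _)
  rw [eigenvalueWeight, h, mul_zero]

end OrderedEigenvalues

/-! ### The eigenvalues of the Jacobi Unitary Ensemble -/

/-- If the eigenvalues of Hermitian matrices have a joint density proportional to
`vandermondeSq`, and the Jacobi density has total mass one, then the latter is the eigenvalue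
density of the Jacobi Unitary Ensemble. -/
theorem hasLaw_orderedEigenvalues_of_weyl {n N x : ℕ} {c : ℝ≥0∞} (hc0 : c ≠ 0) (hct : c ≠ ∞)
    (hW : ∀ f : (Fin n → ℝ) → ℝ≥0∞, Measurable f →
      ∫⁻ M : HermitianMatrix n, f (orderedEigenvalues M) ∂(hermitianVolume n) =
        c * ∫⁻ y in {y | StrictMono y}, ENNReal.ofReal (vandermondeSq y) * f y)
    (hC : 0 ≤ busConstant' N n x)
    (h1 : orderedDensityMeasure n (-1) 1 (jacobiDensity N n x) Set.univ = 1) :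
    jacobiPartition n (N + 1 - x - n) (x - 1) ≠ 0 ∧
    jacobiPartition n (N + 1 - x - n) (x - 1) ≠ ∞ ∧
    HasLaw (fun M : HermitianMatrix n => orderedEigenvalues M)
      (orderedDensityMeasure n (-1) 1 (jacobiDensity N n x))
      (jacobiUnitaryEnsemble n (N + 1 - x - n) (x - 1)) := by
  set K := ENNReal.ofReal (busConstant' N n x) with hK
  set w : (Fin n → ℝ) → ℝ≥0∞ := fun y =>
    ENNReal.ofReal (eigenvalueWeight (N + 1 - x - n) (x - 1) y) with hw
  have hwm : Measurable w := (measurable_eigenvalueWeight _ _).ennreal_ofReal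
  have hch := measurableSet_orderedChamber n (-1) 1
  have hV := (continuous_vandermondeSq n).measurable.ennreal_ofReal
  have key : ∀ s : Set (Fin n → ℝ), MeasurableSet s →
      orderedDensityMeasure n (-1) 1 (jacobiDensity N n x) s =
        K * ∫⁻ y in {y | StrictMono y}, ENNReal.ofReal (vandermondeSq y) *
          (s.indicator 1 y * w y) := by
    intro s hs
    rw [orderedDensityMeasure, withDensity_apply _ hs, Measure.restrict_restrict hs,
      ← lintegral_indicator (hs.inter hch), ← lintegral_indicator (measurableSet_setOf_strictMono n),
      ← lintegral_const_mul]
    · refine lintegral_congr fun y => ?_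
      by_cases hy : y ∈ {y : Fin n → ℝ | StrictMono y}
      · rw [Set.indicator_of_mem hy]
        by_cases hys : y ∈ s
        · rw [Set.indicator_of_mem hys, Pi.one_apply, one_mul]
          by_cases hI : ∀ j, y j ∈ Set.Ioo (-1 : ℝ) 1
          · have hmem : y ∈ s ∩ orderedChamber n (-1) 1 := ⟨hys, hy, hI⟩
            simp only [hw]
            rw [Set.indicator_of_mem hmem, eigenvalueWeight_of_mem hI, jacobiDensity,
              ENNReal.ofReal_mul (mul_nonneg hC (vandermondeSq_pos hy).le),
              ENNReal.ofReal_mul hC, mul_assoc]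
          · have hmem : y ∉ s ∩ orderedChamber n (-1) 1 := fun h => hI h.2.2
            simp only [hw]
            rw [Set.indicator_of_notMem hmem, eigenvalueWeight_of_notMem hI]
            simp
        · rw [Set.indicator_of_notMem hys, Set.indicator_of_notMem fun h => hys h.1]
          simp
      · rw [Set.indicator_of_notMem hy, Set.indicator_of_notMem fun h => hy h.2.1, mul_zero]
    · exact (hV.mul ((measurable_one.indicator hs).mul hwm)).indicator
        (measurableSet_setOf_strictMono n)
  set J := ∫⁻ y in {y | StrictMono y}, ENNReal.ofReal (vandermondeSq y) * w y with hJ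
  have hKJ : K * J = 1 := by
    rw [← h1, key _ MeasurableSet.univ, hJ]
    simp
  have hZ : jacobiPartition n (N + 1 - x - n) (x - 1) = c * J := by
    rw [jacobiPartition, hJ, ← hW w hwm]
    simp only [jacobiWeight_eq, hw]
  have hJ0 : J ≠ 0 := right_ne_zero_of_mul_eq_one hKJ
  have hJt : J ≠ ∞ := by
    intro h
    have hK0 : K ≠ 0 := left_ne_zero_of_mul_eq_one hKJ
    rw [h, ENNReal.mul_top hK0] at hKJ
    exact ENNReal.top_ne_one hKJ
  have hKinv : K = J⁻¹ := ENNReal.eq_inv_of_mul_eq_one_left hKJ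
  refine ⟨?_, ?_, measurable_orderedEigenvalues.aemeasurable, ?_⟩
  · rw [hZ]; exact mul_ne_zero hc0 hJ0
  · rw [hZ]; exact ENNReal.mul_ne_top hct hJt
  · ext s hs
    have hmeas := measurable_orderedEigenvalues (n := n)
    rw [Measure.map_apply hmeas hs, jacobiUnitaryEnsemble, Measure.smul_apply, smul_eq_mul,
      withDensity_apply _ (hmeas hs), ← lintegral_indicator (hmeas hs), key s hs, hZ]
    have h2 : ∀ M : HermitianMatrix n,
        ((fun M : HermitianMatrix n => orderedEigenvalues M) ⁻¹' s).indicator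
          (fun M => ENNReal.ofReal (jacobiWeight (N + 1 - x - n) (x - 1) M)) M =
        (fun y => s.indicator 1 y * w y) (orderedEigenvalues M) := fun M => by
      by_cases hM : orderedEigenvalues M ∈ s
      · rw [Set.indicator_of_mem (s := (fun M : HermitianMatrix n => orderedEigenvalues M) ⁻¹' s) hM]
        simp only [Set.indicator_of_mem hM, Pi.one_apply, one_mul, hw, jacobiWeight_eq]
      · rw [Set.indicator_of_notMem
          (s := (fun M : HermitianMatrix n => orderedEigenvalues M) ⁻¹' s) hM]
        simp only [Set.indicator_of_notMem hM, zero_mul]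
    simp only [h2]
    rw [hW (fun y => s.indicator 1 y * w y) ((measurable_one.indicator hs).mul hwm), hKinv,
      ENNReal.mul_inv (Or.inl hc0) (Or.inl hct), mul_comm c⁻¹, mul_assoc, ← mul_assoc c⁻¹,
      ENNReal.inv_mul_cancel hc0 hct, one_mul]

/-! ### Secular coordinates -/

section Secular

variable {n : ℕ}

/-- The characteristic polynomial, at `t`, of a matrix obtained by bordering a diagonal matrix with
diagonal entries `lam`: `u 0` is the new diagonal entry, and `u i.succ` is the squared modulus of
the `i`-th entry of the new row. -/
noncomputable def secularFun (lam : Fin n → ℝ) (u : Fin (n + 1) → ℝ) (t : ℝ) : ℝ :=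
  (t - u 0) * ∏ i, (t - lam i) - ∑ i, u i.succ * ∏ k ∈ {i}ᶜ, (t - lam k)

/-- The parameters `u` for which `secularFun lam u` has the roots `μ`. -/
noncomputable def secularCoords (lam : Fin n → ℝ) (μ : Fin (n + 1) → ℝ) : Fin (n + 1) → ℝ :=
  Fin.cons (∑ j, μ j - ∑ i, lam i)
    fun i => -(∏ j, (lam i - μ j)) / ∏ k ∈ {i}ᶜ, (lam i - lam k)

lemma prod_compl_sub_ne_zero {lam : Fin n → ℝ} (hlam : Function.Injective lam) (i : Fin n) :
    ∏ k ∈ {i}ᶜ, (lam i - lam k) ≠ 0 :=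
  Finset.prod_ne_zero_iff.2 fun k hk => sub_ne_zero.2 fun h => by
    rw [hlam h] at hk; simp at hk

lemma secularFun_apply_self (lam : Fin n → ℝ) (u : Fin (n + 1) → ℝ) (i : Fin n) :
    secularFun lam u (lam i) = -(u i.succ * ∏ k ∈ {i}ᶜ, (lam i - lam k)) := by
  rw [secularFun, Finset.prod_eq_zero (Finset.mem_univ i) (sub_self _), mul_zero, zero_sub,
    Finset.sum_eq_single i (fun k _ hk => ?_) (fun h => absurd (Finset.mem_univ i) h)]
  rw [Finset.prod_eq_zero (i := i) (by simpa using hk.symm) (sub_self _), mul_zero]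

lemma continuous_secularFun (lam : Fin n → ℝ) (u : Fin (n + 1) → ℝ) :
    Continuous (secularFun lam u) := by
  unfold secularFun; fun_prop

/-- Lagrange interpolation at the nodes `lam`: the two monic polynomials of degree `n + 1` also
agree in the next coefficient. -/
lemma prod_sub_eq_secularFun {lam : Fin n → ℝ} (hlam : Function.Injective lam)
    (μ : Fin (n + 1) → ℝ) (t : ℝ) :
    ∏ j, (t - μ j) = secularFun lam (secularCoords lam μ) t := by
  open Polynomial in
  set c := secularCoords lam μ 0 with hc
  set p : ℝ[X] := ∏ j, (X - C (μ j)) - ∏ j, (X - C ((Fin.cons c lam : Fin (n + 1) → ℝ) j)) with hp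
  set q : ℝ[X] := -∑ i, C (secularCoords lam μ i.succ) * ∏ k ∈ {i}ᶜ, (X - C (lam k)) with hq
  have hmonic : ∀ ν : Fin (n + 1) → ℝ, (∏ j, (X - C (ν j))).coeff (n + 1) = 1 ∧
      (∏ j, (X - C (ν j))).coeff n = -∑ j, ν j ∧
      ∀ m, n + 1 < m → (∏ j, (X - C (ν j))).coeff m = 0 := by
    intro ν
    have hd : (∏ j, (X - C (ν j))).natDegree = n + 1 := by
      simp [natDegree_finsetProd_X_sub_C_eq_card]
    refine ⟨?_, ?_, fun m hm => coeff_eq_zero_of_natDegree_lt (by rwa [hd])⟩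
    · have := monic_prod_X_sub_C ν Finset.univ
      rwa [Monic, leadingCoeff, hd] at this
    · simpa using prod_X_sub_C_coeff_card_pred Finset.univ ν (by simp)
  have hpd : p.degree < (Finset.univ : Finset (Fin n)).card := by
    rw [Finset.card_fin, degree_lt_iff_coeff_zero]
    intro m hm
    obtain ⟨a1, a2, a3⟩ := hmonic μ
    obtain ⟨b1, b2, b3⟩ := hmonic (Fin.cons c lam : Fin (n + 1) → ℝ)
    rw [hp, coeff_sub]
    rcases hm.eq_or_lt with rfl | hm
    · rw [a2, b2, Fin.sum_univ_succ (Fin.cons c lam : Fin (n + 1) → ℝ)]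
      simp [hc, secularCoords]
    rcases (Nat.succ_le_of_lt hm).eq_or_lt with rfl | hm
    · rw [a1, b1, sub_self]
    · rw [a3 m hm, b3 m hm, sub_self]
  have hqd : q.degree < (Finset.univ : Finset (Fin n)).card := by
    rw [hq, degree_neg]
    refine (degree_sum_le _ _).trans_lt ((Finset.sup_lt_iff (by simp)).2 fun i _ => ?_)
    refine (degree_mul_le _ _).trans_lt ((add_le_add_left degree_C_le _).trans_lt ?_)
    rw [zero_add, degree_prod]
    simp only [degree_X_sub_C, Finset.sum_const, nsmul_eq_mul, mul_one, Finset.card_compl,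
      Finset.card_singleton, Fintype.card_fin, Finset.card_univ]
    have := i.pos
    exact_mod_cast Nat.sub_lt this one_pos
  have hpq : p = q := by
    refine eq_of_degrees_lt_of_eval_index_eq (v := lam) Finset.univ hlam.injOn hpd hqd fun i _ => ?_
    have h1 : q.eval (lam i) = secularFun lam (secularCoords lam μ) (lam i) := by
      rw [hq, secularFun, Finset.prod_eq_zero (Finset.mem_univ i) (sub_self _)]
      simp [eval_finsetSum, eval_prod]
    have h2 : p.eval (lam i) = ∏ j, (lam i - μ j) := by
      rw [hp]
      simp only [eval_sub, eval_prod, eval_X, eval_C]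
      rw [sub_eq_self]
      exact Finset.prod_eq_zero (Finset.mem_univ i.succ) (by rw [Fin.cons_succ, sub_self])
    rw [h1, h2, secularFun_apply_self]
    simp only [secularCoords, Fin.cons_succ]
    rw [div_mul_cancel₀ _ (prod_compl_sub_ne_zero hlam i), neg_neg]
  have h := congrArg (eval t) hpq
  rw [hp, hq] at h
  simp only [eval_sub, eval_neg, eval_prod, eval_X, eval_C, eval_finsetSum, eval_mul,
    Fin.prod_univ_succ (fun j => t - (Fin.cons c lam : Fin (n + 1) → ℝ) j), Fin.cons_zero,
    Fin.cons_succ] at h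
  rw [secularFun]
  linarith

lemma secularCoords_eq {lam : Fin n → ℝ} (hlam : Function.Injective lam)
    {μ u : Fin (n + 1) → ℝ} (h : ∀ t, ∏ j, (t - μ j) = secularFun lam u t) :
    secularCoords lam μ = u := by
  have hs : ∀ i : Fin n, secularCoords lam μ i.succ = u i.succ := fun i => by
    have := h (lam i)
    rw [secularFun_apply_self] at this
    simp only [secularCoords, Fin.cons_succ]
    rw [this, neg_neg, mul_div_assoc, div_self (prod_compl_sub_ne_zero hlam i), mul_one]
  refine funext fun j => Fin.cases ?_ hs j
  obtain ⟨t, ht⟩ := (Set.finite_range lam).infinite_compl.nonempty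
  have h1 := (prod_sub_eq_secularFun hlam μ t).symm.trans (h t)
  simp only [secularFun, hs] at h1
  have h2 : ∏ i, (t - lam i) ≠ 0 := Finset.prod_ne_zero_iff.2 fun i _ =>
    sub_ne_zero.2 fun h => ht ⟨i, h.symm⟩
  have h3 := mul_right_cancel₀ h2 (sub_left_injective h1)
  linarith

end Secular

/-! ### Interlacing -/

section Interlacing

variable {n : ℕ}

/-- The tuples `μ` that strictly interlace with `lam`: `μ₀ < lam₀ < μ₁ < ⋯ < lamₙ₋₁ < μₙ`. -/
def interlacingSet (lam : Fin n → ℝ) : Set (Fin (n + 1) → ℝ) :=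
  {μ | ∀ i, μ i.castSucc < lam i ∧ lam i < μ i.succ}

lemma strictMono_of_mem_interlacingSet {lam : Fin n → ℝ} {μ : Fin (n + 1) → ℝ}
    (h : μ ∈ interlacingSet lam) : StrictMono μ :=
  Fin.strictMono_iff_lt_succ.2 fun i => (h i).1.trans (h i).2

lemma strictMono_left_of_mem_interlacingSet {lam : Fin n → ℝ} {μ : Fin (n + 1) → ℝ}
    (h : μ ∈ interlacingSet lam) : StrictMono lam := fun i j hij =>
  (h i).2.trans_le (((strictMono_of_mem_interlacingSet h).monotone
    (by rw [Fin.le_def]; simpa using hij)).trans (h j).1.le)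

lemma measurableSet_interlacingSet_uncurry :
    MeasurableSet {p : (Fin n → ℝ) × (Fin (n + 1) → ℝ) | p.2 ∈ interlacingSet p.1} := by
  have h : {p : (Fin n → ℝ) × (Fin (n + 1) → ℝ) | p.2 ∈ interlacingSet p.1} =
      ⋂ i : Fin n, {p : (Fin n → ℝ) × (Fin (n + 1) → ℝ) | p.2 i.castSucc < p.1 i} ∩
        {p | p.1 i < p.2 i.succ} := by
    ext p; simp [interlacingSet]
  rw [h]
  refine .iInter fun i => (measurableSet_lt ?_ ?_).inter (measurableSet_lt ?_ ?_) <;> fun_prop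

lemma measurableSet_interlacingSet (lam : Fin n → ℝ) : MeasurableSet (interlacingSet lam) :=
  measurable_prodMk_left (measurableSet_interlacingSet_uncurry (n := n))

lemma secularCoords_pos {lam : Fin n → ℝ} {μ : Fin (n + 1) → ℝ} (h : μ ∈ interlacingSet lam)
    (i : Fin n) : 0 < secularCoords lam μ i.succ := by
  have hlam := strictMono_left_of_mem_interlacingSet h
  have hμ := strictMono_of_mem_interlacingSet h
  simp only [secularCoords, Fin.cons_succ]
  rw [Fin.prod_univ_succAbove _ i.succ, ← Finset.mul_prod_erase _ _ (Finset.mem_univ i),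
    ← Finset.compl_singleton, neg_div, ← neg_div, ← neg_mul, neg_sub, ← mul_assoc, mul_div_assoc,
    ← Finset.prod_div_distrib]
  have h1 : i.succ.succAbove i = i.castSucc :=
    Fin.succAbove_of_castSucc_lt _ _ (Fin.castSucc_lt_succ)
  rw [h1]
  refine mul_pos (mul_pos (sub_pos.2 (h i).2) (sub_pos.2 (h i).1)) (Finset.prod_pos fun k hk => ?_)
  rcases lt_or_gt_of_ne (show k ≠ i by simpa using hk) with hk | hk
  · rw [Fin.succAbove_of_castSucc_lt _ _ (by rw [Fin.lt_def]; simp; omega)]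
    exact div_pos (sub_pos.2 ((h k).1.trans (hlam hk))) (sub_pos.2 (hlam hk))
  · rw [Fin.succAbove_of_le_castSucc _ _ (by rw [Fin.le_def]; simp; omega)]
    exact div_pos_of_neg_of_neg (sub_neg.2 ((hlam hk).trans (h k).2)) (sub_neg.2 (hlam hk))

lemma neg_one_pow_mul_prod_sub_pos {ι : Type*} (s : Finset ι) (ν : ι → ℝ) (t : ℝ)
    (h : ∀ j ∈ s, t ≠ ν j) : 0 < (-1) ^ (s.filter fun j => t < ν j).card * ∏ j ∈ s, (t - ν j) := by
  have h1 : ((-1 : ℝ)) ^ (s.filter fun j => t < ν j).card = ∏ j ∈ s, if t < ν j then -1 else 1 := by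
    rw [Finset.prod_ite, Finset.prod_const, Finset.prod_const_one, mul_one]
  rw [h1, ← Finset.prod_mul_distrib]
  refine Finset.prod_pos fun j hj => ?_
  split_ifs with hlt
  · linarith
  · rw [one_mul]; exact sub_pos.2 (lt_of_le_of_ne (not_lt.1 hlt) (h j hj).symm)

/-- The signs of the polynomial with roots `μ` at the nodes `lam` alternate, so that the number of
roots above `lam i` changes its parity with `i`; this leaves one possibility. -/
lemma mem_interlacingSet_of_pos {lam : Fin n → ℝ} (hlam : StrictMono lam) {μ : Fin (n + 1) → ℝ}
    (hμ : Monotone μ) (hpos : ∀ i : Fin n, 0 < secularCoords lam μ i.succ) :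
    μ ∈ interlacingSet lam := by
  -- The number of roots above `lam i`; interlacing amounts to `b i = n - i`.
  let b : Fin n → ℕ := fun i => (Finset.univ.filter fun j => lam i < μ j).card
  have hne : ∀ i j, lam i ≠ μ j := fun i j hij => by
    have := hpos i
    simp only [secularCoords, Fin.cons_succ] at this
    rw [Finset.prod_eq_zero (Finset.mem_univ j) (sub_eq_zero.2 hij), neg_zero, zero_div] at this
    exact lt_irrefl _ this
  have hparity : ∀ i : Fin n, Odd (b i + (n - 1 - i)) := fun i => by
    have h1 := neg_one_pow_mul_prod_sub_pos Finset.univ μ (lam i) fun j _ => hne i j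
    have h2 := neg_one_pow_mul_prod_sub_pos {i}ᶜ lam (lam i) fun k hk =>
      hlam.injective.ne fun h => by simp [h] at hk
    have h3 : (({i}ᶜ : Finset (Fin n)).filter fun k => lam i < lam k).card = n - 1 - i := by
      rw [← Fin.card_Ioi]
      congr 1
      ext k
      simp only [Finset.mem_filter, Finset.mem_compl, Finset.mem_singleton, Finset.mem_Ioi,
        hlam.lt_iff_lt]
      exact ⟨fun h => h.2, fun h => ⟨h.ne', h⟩⟩
    rw [h3] at h2
    have h4 := hpos i
    simp only [secularCoords, Fin.cons_succ] at h4
    by_contra hodd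
    rw [Nat.not_odd_iff_even] at hodd
    have h5 := mul_pos h1 h2
    rw [mul_mul_mul_comm, ← pow_add, hodd.neg_one_pow, one_mul] at h5
    rw [neg_div, Left.neg_pos_iff] at h4
    rcases div_neg_iff.1 h4 with ⟨ha, hb⟩ | ⟨ha, hb⟩
    · exact absurd h5 (mul_neg_of_pos_of_neg ha hb).not_gt
    · exact absurd h5 (mul_neg_of_neg_of_pos ha hb).not_gt
  have hle : ∀ i, b i ≤ n + 1 := fun i => (Finset.card_filter_le _ _).trans (by simp)
  have hanti : ∀ i j, i ≤ j → b j ≤ b i := fun i j hij =>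
    Finset.card_le_card (Finset.monotone_filter_right _ fun k _ hk =>
      (hlam.monotone hij).trans_lt hk)
  have hupper : ∀ k (hk : k < n), b ⟨k, hk⟩ ≤ n - k := by
    intro k
    induction k with
    | zero =>
      intro hk
      have h1 := hparity ⟨0, hk⟩
      have h2 := hle ⟨0, hk⟩
      rw [Nat.odd_iff] at h1
      simp only at h1
      omega
    | succ k ih =>
      intro hk
      have h1 := hparity ⟨k, by omega⟩
      have h2 := hparity ⟨k + 1, hk⟩
      have h3 := ih (by omega)
      have h4 := hanti ⟨k, by omega⟩ ⟨k + 1, hk⟩ (by rw [Fin.le_def]; simp)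
      rw [Nat.odd_iff] at h1 h2
      simp only at h1 h2
      omega
  have hlower : ∀ k (hk : k < n), n - k ≤ b ⟨k, hk⟩ := by
    intro k hk
    induction hm : n - 1 - k generalizing k with
    | zero =>
      have h1 := hparity ⟨k, hk⟩
      rw [Nat.odd_iff] at h1
      simp only at h1
      omega
    | succ m ih =>
      have h1 := hparity ⟨k, hk⟩
      have h2 := hparity ⟨k + 1, by omega⟩
      have h3 := ih (k + 1) (by omega) (by omega)
      have h4 := hanti ⟨k, by omega⟩ ⟨k + 1, by omega⟩ (by rw [Fin.le_def]; simp)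
      rw [Nat.odd_iff] at h1 h2
      simp only at h1 h2
      omega
  intro i
  have h1 : b i ≤ n - i := hupper i i.2
  have h2 : n - i ≤ b i := hlower i i.2
  constructor
  · by_contra hcon
    have h3 : Finset.Ici i.castSucc ⊆ Finset.univ.filter fun j => lam i < μ j := fun j hj => by
      rw [Finset.mem_filter]
      exact ⟨Finset.mem_univ j, lt_of_lt_of_le (lt_of_le_of_ne (not_lt.1 hcon) (hne _ _))
        (hμ (Finset.mem_Ici.1 hj))⟩
    have h4 := Finset.card_le_card h3
    rw [Fin.card_Ici] at h4
    simp only [Fin.val_castSucc] at h4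
    have := i.2
    change _ ≤ b i at h4
    omega
  · by_contra hcon
    have h3 : (Finset.univ.filter fun j => lam i < μ j) ⊆ Finset.Ioi i.succ := fun j hj => by
      rw [Finset.mem_Ioi]
      by_contra hj'
      exact absurd (Finset.mem_filter.1 hj).2 (not_lt.2 ((hμ (not_lt.1 hj')).trans (not_lt.1 hcon)))
    have h4 := Finset.card_le_card h3
    rw [Fin.card_Ioi] at h4
    simp only [Fin.val_succ] at h4
    have := i.2
    change b i ≤ _ at h4
    omega

end Interlacing

/-! ### The Jacobian of the secular coordinates -/

section SecularJacobian

variable {n : ℕ}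

lemma abs_prod_prod_compl_sub (v : Fin n → ℝ) :
    |∏ i, ∏ k ∈ {i}ᶜ, (v i - v k)| = (Matrix.vandermonde v).det ^ 2 := by
  rw [← Finset.prod_prod_Ioi_mul_eq_prod_prod_off_diag (fun k i => v i - v k), ← abs_sq,
    Matrix.det_vandermonde, ← Finset.prod_pow, Finset.abs_prod, Finset.abs_prod]
  refine Finset.prod_congr rfl fun i _ => ?_
  rw [← Finset.prod_pow, Finset.abs_prod, Finset.abs_prod]
  refine Finset.prod_congr rfl fun j _ => ?_
  rw [← neg_sub (v j) (v i), abs_mul, abs_neg, abs_sq, ← abs_mul, ← sq, abs_sq]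

/-- The Jacobian matrix of `secularCoords lam`. -/
noncomputable def secularJacobian (lam : Fin n → ℝ) (μ : Fin (n + 1) → ℝ) :
    Matrix (Fin (n + 1)) (Fin (n + 1)) ℝ :=
  Matrix.of (Fin.cons (fun _ => 1)
    fun i j => (∏ k ∈ {j}ᶜ, (lam i - μ k)) / ∏ k ∈ {i}ᶜ, (lam i - lam k))

lemma hasFDerivAt_secularCoords (lam : Fin n → ℝ) (μ : Fin (n + 1) → ℝ) :
    HasFDerivAt (secularCoords lam) (Matrix.toLin' (secularJacobian lam μ)).toContinuousLinearMap
      μ := by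
  rw [hasFDerivAt_pi']
  intro i
  refine Fin.cases ?_ (fun i => ?_) i
  · have h : HasFDerivAt (fun μ : Fin (n + 1) → ℝ => ∑ j, μ j - ∑ i, lam i)
        (∑ j, (ContinuousLinearMap.proj j : (Fin (n + 1) → ℝ) →L[ℝ] ℝ)) μ :=
      (HasFDerivAt.fun_sum fun j _ => hasFDerivAt_apply j μ).sub_const _
    refine h.congr_fderiv ?_
    ext v
    simp [secularJacobian, Matrix.mulVec, dotProduct]
  · have h1 : HasFDerivAt (fun μ : Fin (n + 1) → ℝ => ∏ j, (lam i - μ j))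
        (∑ j, (∏ k ∈ Finset.univ.erase j, (lam i - μ k)) •
          -(ContinuousLinearMap.proj j : (Fin (n + 1) → ℝ) →L[ℝ] ℝ)) μ :=
      HasFDerivAt.finsetProd fun j _ => (hasFDerivAt_apply j μ).const_sub _
    have h := (h1.neg.mul_const (∏ k ∈ {i}ᶜ, (lam i - lam k))⁻¹)
    refine h.congr_fderiv ?_
    ext v
    simp only [secularJacobian, Finset.compl_singleton]
    simp [Finset.mul_sum, div_eq_mul_inv, mul_comm, mul_left_comm,
      Matrix.mulVec, dotProduct]

/-- The rows of the Jacobian matrix are the values, at the leading coefficient functional and the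
normalized evaluations at the nodes `lam`, of the polynomials `∏ (X - μ k)` with one factor left
out; evaluating these polynomials at the nodes `μ` instead gives a diagonal matrix. -/
lemma abs_det_secularJacobian {lam : Fin n → ℝ} (hlam : StrictMono lam) {μ : Fin (n + 1) → ℝ}
    (hμ : StrictMono μ) : |(secularJacobian lam μ).det| =
      (Matrix.vandermonde μ).det / (Matrix.vandermonde lam).det := by
  open Polynomial in
  set p : Fin (n + 1) → ℝ[X] := fun j => ∏ k ∈ {j}ᶜ, (X - C (μ k)) with hp
  have hdeg : ∀ j, (p j).natDegree = n := fun j => by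
    rw [hp, natDegree_finsetProd_X_sub_C_eq_card, Finset.card_compl, Finset.card_singleton,
      Fintype.card_fin, Nat.add_sub_cancel]
  have heval : ∀ j t, (p j).eval t = ∑ k : Fin (n + 1), t ^ (k : ℕ) * (p j).coeff k := fun j t => by
    rw [eval_eq_sum_range, hdeg, Finset.sum_range]
    simp only [mul_comm]
  set Q : Matrix (Fin (n + 1)) (Fin (n + 1)) ℝ := Matrix.of fun k j => (p j).coeff k with hQ
  set R : Matrix (Fin (n + 1)) (Fin (n + 1)) ℝ := Matrix.of (Fin.cons (Pi.single (Fin.last n) 1)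
    fun i k => (∏ k ∈ {i}ᶜ, (lam i - lam k))⁻¹ * lam i ^ (k : ℕ)) with hR
  have hJ : secularJacobian lam μ = R * Q := by
    ext i j
    rw [Matrix.mul_apply]
    refine Fin.cases ?_ (fun i => ?_) i
    · have h1 : (p j).coeff n = 1 := by
        have := monic_prod_X_sub_C μ ({j}ᶜ : Finset (Fin (n + 1)))
        rw [Monic, leadingCoeff] at this
        rwa [← hdeg j]
      simp [secularJacobian, hR, hQ, Pi.single_apply, h1]
    · have h1 : ∏ k ∈ {j}ᶜ, (lam i - μ k) = (p j).eval (lam i) := by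
        rw [hp, eval_prod]; simp
      simp only [secularJacobian, hR, hQ, Matrix.of_apply, Fin.cons_succ]
      rw [h1, heval, div_eq_inv_mul, Finset.mul_sum]
      simp only [mul_assoc]
  have hdQ : (Matrix.vandermonde μ).det * Q.det = ∏ j, ∏ k ∈ {j}ᶜ, (μ j - μ k) := by
    have h1 : Matrix.vandermonde μ * Q = Matrix.diagonal fun j => ∏ k ∈ {j}ᶜ, (μ j - μ k) := by
      ext i j
      simp only [Matrix.mul_apply, Matrix.vandermonde_apply, hQ, Matrix.of_apply]
      rw [← heval, hp]
      simp only [eval_prod, eval_sub, eval_X, eval_C]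
      by_cases hij : i = j
      · subst hij; rw [Matrix.diagonal_apply_eq]
      · rw [Matrix.diagonal_apply_ne _ hij]
        exact Finset.prod_eq_zero (i := i) (by simpa using hij) (sub_self _)
    rw [← Matrix.det_mul, h1, Matrix.det_diagonal]
  have hdR : R.det = (-1) ^ n * ((∏ i, ∏ k ∈ {i}ᶜ, (lam i - lam k))⁻¹ *
      (Matrix.vandermonde lam).det) := by
    rw [Matrix.det_succ_row_zero, Finset.sum_eq_single (Fin.last n)]
    · have h1 : R.submatrix Fin.succ (Fin.last n).succAbove = Matrix.of fun i j =>
          (∏ k ∈ {i}ᶜ, (lam i - lam k))⁻¹ * Matrix.vandermonde lam i j := by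
        ext i j
        simp [hR]
      rw [h1, Matrix.det_mul_column, Finset.prod_inv_distrib]
      simp [hR]
    · intro j _ hj
      simp [hR, hj]
    · simp
  have hVμ := det_vandermonde_pos hμ
  have hVl := det_vandermonde_pos hlam
  have h2 := congrArg abs hdQ
  rw [abs_mul, abs_prod_prod_compl_sub, abs_of_pos hVμ, sq] at h2
  rw [hJ, Matrix.det_mul, abs_mul, mul_left_cancel₀ hVμ.ne' h2, hdR, abs_mul, abs_pow, abs_neg,
    abs_one, one_pow, one_mul, abs_mul, abs_inv, abs_prod_prod_compl_sub, abs_of_pos hVl]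
  field_simp

lemma injOn_secularCoords {lam : Fin n → ℝ} (hlam : StrictMono lam) :
    Set.InjOn (secularCoords lam) (interlacingSet lam) := fun μ hμ ν hν h =>
  eq_of_prod_sub_eq (strictMono_of_mem_interlacingSet hμ).monotone
    (strictMono_of_mem_interlacingSet hν).monotone Set.infinite_univ fun t _ => by
      rw [prod_sub_eq_secularFun hlam.injective, prod_sub_eq_secularFun hlam.injective, h]

lemma lintegral_secularCoords_image {lam : Fin n → ℝ} (hlam : StrictMono lam)
    (H : (Fin (n + 1) → ℝ) → ℝ≥0∞) :
    ∫⁻ u in secularCoords lam '' interlacingSet lam, H u =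
      ∫⁻ μ in interlacingSet lam, ENNReal.ofReal ((Matrix.vandermonde μ).det /
        (Matrix.vandermonde lam).det) * H (secularCoords lam μ) := by
  rw [lintegral_image_eq_lintegral_abs_det_fderiv_mul volume (measurableSet_interlacingSet lam)
    (fun μ _ => (hasFDerivAt_secularCoords lam μ).hasFDerivWithinAt) (injOn_secularCoords hlam)]
  refine setLIntegral_congr_fun (measurableSet_interlacingSet lam) fun μ hμ => ?_
  rw [← abs_det_secularJacobian hlam (strictMono_of_mem_interlacingSet hμ)]
  congr 3
  exact (LinearMap.det_toContinuousLinearMap _).trans (LinearMap.det_toLin' _)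

/-- The Vandermonde determinant of `μ` is, up to the factor `n!`, the integral of the Vandermonde
determinant over the tuples interlacing with `μ`. -/
lemma lintegral_vandermonde_interlacing {μ : Fin (n + 1) → ℝ} (hμ : StrictMono μ) :
    ∫⁻ lam in {lam : Fin n → ℝ | μ ∈ interlacingSet lam},
      ENNReal.ofReal (Matrix.vandermonde lam).det =
        ENNReal.ofReal ((n ! : ℝ)⁻¹ * (Matrix.vandermonde μ).det) := by
  have hset : {lam : Fin n → ℝ | μ ∈ interlacingSet lam} =
      Set.univ.pi fun i => Set.Ioo (μ i.castSucc) (μ i.succ) := by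
    ext lam; simp [interlacingSet]
  have hint : ∀ i j : Fin n, Integrable (fun s : ℝ => s ^ (j : ℕ))
      (volume.restrict (Set.Ioo (μ i.castSucc) (μ i.succ))) := fun i j =>
    ((continuous_pow (j : ℕ)).integrableOn_Icc).mono_set Set.Ioo_subset_Icc_self
  have hmeas : MeasurableSet {lam : Fin n → ℝ | μ ∈ interlacingSet lam} := by
    rw [hset]; exact MeasurableSet.univ_pi fun i => measurableSet_Ioo
  have h := lintegral_det_of_rows (ν := fun i => volume.restrict
    (Set.Ioo (μ (Fin.castSucc i)) (μ (Fin.succ i)))) (f := fun _ (j : Fin n) s => s ^ (j : ℕ)) hint ?_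
  · rw [← Measure.restrict_pi_pi, ← hset] at h
    refine h.trans ?_
    congr 1
    have h1 : ∀ i j : Fin n, ∫ s in Set.Ioo (μ i.castSucc) (μ i.succ), s ^ (j : ℕ) =
        ((j : ℝ) + 1)⁻¹ * (μ i.succ ^ ((j : ℕ) + 1) - μ i.castSucc ^ ((j : ℕ) + 1)) := fun i j => by
      rw [← integral_Ioc_eq_integral_Ioo,
        ← intervalIntegral.integral_of_le (hμ Fin.castSucc_lt_succ).le, integral_pow,
        div_eq_inv_mul]
    simp only [h1]
    have h2 : ∏ j : Fin n, ((j : ℝ) + 1)⁻¹ = (n ! : ℝ)⁻¹ := by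
      rw [Finset.prod_inv_distrib, ← Finset.prod_range_add_one_eq_factorial,
        Fin.prod_univ_eq_prod_range (fun j => (j : ℝ) + 1) n]
      push_cast; rfl
    rw [← h2]
    refine (Matrix.det_mul_row _ (Matrix.of fun i j : Fin n =>
      μ i.succ ^ ((j : ℕ) + 1) - μ i.castSucc ^ ((j : ℕ) + 1))).trans ?_
    congr 1
    set B : Matrix (Fin (n + 1)) (Fin (n + 1)) ℝ := Matrix.of (Fin.cons (fun k => μ 0 ^ (k : ℕ))
      fun i k => μ i.succ ^ (k : ℕ) - μ i.castSucc ^ (k : ℕ)) with hB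
    have h3 : (Matrix.vandermonde μ).det = B.det :=
      Matrix.det_eq_of_forall_row_eq_smul_add_pred (fun _ => 1)
        (fun j => by simp [hB]) fun i j => by simp [hB]
    rw [h3, Matrix.det_succ_column_zero, Fin.sum_univ_succ, Finset.sum_eq_zero fun i _ => ?_]
    · simp [hB, Matrix.submatrix]
    · simp [hB]
  · rw [← Measure.restrict_pi_pi, ← hset]
    refine (ae_restrict_mem hmeas).mono fun lam hlam => ?_
    exact (det_vandermonde_pos (strictMono_left_of_mem_interlacingSet hlam)).le

end SecularJacobian

/-! ### Bordered Hermitian matrices -/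

section Bordered

variable {n : ℕ}

/-- The Hermitian matrix with first diagonal entry `c`, with `b` in the remainder of its first row,
and with lower right block `A`. -/
def borderedMatrix (A : HermitianMatrix n) (c : ℝ) (b : Fin n → ℂ) : HermitianMatrix (n + 1) :=
  ⟨Matrix.of (Fin.cons (Fin.cons (c : ℂ) b) fun i => Fin.cons (star (b i)) (A.1 i)), by
    ext i j
    refine Fin.cases ?_ (fun i => ?_) i <;> refine Fin.cases ?_ (fun j => ?_) j
    · simp
    · simp
    · simp
    · simpa using congrFun (congrFun A.2 i) j⟩

/-- The real diagonal matrix with entries `lam`, as a Hermitian matrix. -/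
def diagonalHermitian (lam : Fin n → ℝ) : HermitianMatrix n :=
  ⟨Matrix.diagonal fun i => (lam i : ℂ), by
    rw [Matrix.IsHermitian, Matrix.diagonal_conjTranspose]
    congr 1; ext i; simp⟩

/-- The spectral theorem, with the eigenvalues in nondecreasing order. -/
lemma exists_unitary_orderedEigenvalues (A : HermitianMatrix n) :
    ∃ U ∈ Matrix.unitaryGroup (Fin n) ℂ,
      A.1 = U * Matrix.diagonal (fun i => (orderedEigenvalues A i : ℂ)) * star U := by
  set e : Fin n ≃ Fin n := (Fin.revPerm.trans (finCongr (Fintype.card_fin n).symm)).trans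
    (Fintype.equivOfCardEq (Fintype.card_fin _)) with he
  have hlam : ∀ i, A.2.eigenvalues (e i) = orderedEigenvalues A i := fun i => by
    simp [Matrix.IsHermitian.eigenvalues, orderedEigenvalues, he]
  set V := A.2.eigenvectorUnitary with hV
  have hVs : star (V : Matrix (Fin n) (Fin n) ℂ) * V = 1 := Unitary.star_mul_self_of_mem V.2
  have hstar : star ((V : Matrix (Fin n) (Fin n) ℂ).submatrix id e) =
      (star (V : Matrix (Fin n) (Fin n) ℂ)).submatrix e id := rfl
  refine ⟨(V : Matrix (Fin n) (Fin n) ℂ).submatrix id e, ?_, ?_⟩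
  · rw [Matrix.mem_unitaryGroup_iff', hstar,
      ← Matrix.submatrix_mul _ _ e id e Function.bijective_id, hVs]
    exact Matrix.submatrix_one_equiv e
  · have hd : (Matrix.diagonal fun i => (orderedEigenvalues A i : ℂ)) =
        (Matrix.diagonal fun i => (A.2.eigenvalues i : ℂ)).submatrix e e := by
      rw [Matrix.submatrix_diagonal_equiv]
      congr 1; ext i; simp [hlam]
    rw [hd, hstar, Matrix.submatrix_mul_equiv, Matrix.submatrix_mul_equiv, Matrix.submatrix_id_id]
    have := A.2.spectral_theorem
    rw [Unitary.conjStarAlgAut_apply] at this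
    exact this

/-- The Schur complement formula for the characteristic polynomial of a bordered matrix. -/
lemma det_sub_borderedMatrix_aux {A : HermitianMatrix n} {lam : Fin n → ℝ}
    {U : Matrix (Fin n) (Fin n) ℂ} (hU : U ∈ Matrix.unitaryGroup (Fin n) ℂ)
    (hA : A.1 = U * Matrix.diagonal (fun i => (lam i : ℂ)) * star U) (c : ℝ) (b : Fin n → ℂ)
    {t : ℝ} (ht : ∀ i, t ≠ lam i) :
    ((t : ℂ) • 1 - (borderedMatrix A c b).1).det =
      (secularFun lam (Fin.cons c fun i => Complex.normSq (Matrix.vecMul b U i)) t : ℂ) := by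
  open Matrix in
  have hU1 : star U * U = 1 := Unitary.star_mul_self_of_mem hU
  have hU2 : U * star U = 1 := Unitary.mul_star_self_of_mem hU
  have ht' : ∀ i, ((t : ℂ) - lam i) ≠ 0 := fun i => by
    rw [← Complex.ofReal_sub]; exact_mod_cast sub_ne_zero.2 (ht i)
  set D : Matrix (Fin n) (Fin n) ℂ := diagonal fun i => (t : ℂ) - lam i with hD
  set D' : Matrix (Fin n) (Fin n) ℂ := diagonal fun i => ((t : ℂ) - lam i)⁻¹ with hD'
  have hDD : D * D' = 1 := by
    rw [hD, hD', diagonal_mul_diagonal, ← diagonal_one]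
    congr 1; ext i; exact mul_inv_cancel₀ (ht' i)
  have hE : (t : ℂ) • 1 - A.1 = U * D * star U := by
    have : D = (t : ℂ) • 1 - diagonal (fun i => (lam i : ℂ)) := by
      ext i j
      by_cases hij : i = j
      · subst hij; simp [hD]
      · simp [hD, hij]
    rw [this, mul_sub, sub_mul, ← hA, Matrix.mul_smul, mul_one, Matrix.smul_mul, hU2]
  have hinv : ((t : ℂ) • 1 - A.1) * (U * D' * star U) = 1 := by
    rw [hE, show U * D * star U * (U * D' * star U) = U * (D * (star U * U) * D') * star U by
      simp only [mul_assoc], hU1, mul_one, hDD, mul_one, hU2]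
  have hdet : ((t : ℂ) • 1 - A.1).det = ∏ i, ((t : ℂ) - lam i) := by
    rw [hE, det_mul, det_mul, mul_right_comm, ← det_mul, hU2, det_one, one_mul, det_diagonal]
  -- The block `A` occupies the last `n` indices of the bordered matrix, the entry `c` the first.
  let e : Fin n ⊕ PUnit.{1} ≃ Fin (n + 1) :=
    ((finSuccEquiv n).trans (Equiv.optionEquivSumPUnit (Fin n))).symm
  have hblock : ((t : ℂ) • 1 - (borderedMatrix A c b).1).submatrix e e =
      fromBlocks ((t : ℂ) • 1 - A.1) (of fun i _ => -star (b i)) (of fun _ i => -b i)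
        (of fun _ _ => (t : ℂ) - c) := by
    ext i j
    rcases i with i | i <;> rcases j with j | j <;>
      simp [e, borderedMatrix, Matrix.one_apply, Fin.succ_ne_zero, (Fin.succ_ne_zero _).symm]
  let _ : Invertible ((t : ℂ) • 1 - A.1) :=
    invertibleOfRightInverse _ _ hinv
  rw [← det_submatrix_equiv_self e, hblock, det_fromBlocks₁₁, hdet, det_unique]
  have hinv' : ⅟((t : ℂ) • 1 - A.1) = U * D' * star U := rfl
  have hent : ((of fun (_ : PUnit.{1}) i => -b i) * (U * D' * star U) *
      (of fun i (_ : PUnit.{1}) => -star (b i))) PUnit.unit PUnit.unit =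
      ∑ i, (Complex.normSq ((b ᵥ* U) i) : ℂ) * ((t : ℂ) - lam i)⁻¹ := by
    have h1 : (of fun (_ : PUnit.{1}) i => -b i) * U = of fun _ i => -(b ᵥ* U) i := by
      ext i j; simp [mul_apply, vecMul, dotProduct]
    have h2 : star U * (of fun i (_ : PUnit.{1}) => -star (b i)) =
        of fun i _ => -star ((b ᵥ* U) i) := by
      ext i j; simp [mul_apply, vecMul, dotProduct, mul_comm]
    rw [← Matrix.mul_assoc, Matrix.mul_assoc, ← Matrix.mul_assoc _ U, h1, h2, hD', Matrix.mul_apply]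
    refine Finset.sum_congr rfl fun i _ => ?_
    rw [mul_diagonal]
    simp only [of_apply, ← Complex.mul_conj, starRingEnd_apply]
    ring
  rw [Matrix.sub_apply, hinv']
  simp only [default]
  rw [hent, secularFun]
  simp only [of_apply, Fin.cons_zero, Fin.cons_succ]
  push_cast
  rw [mul_sub, mul_comm, Finset.mul_sum]
  congr 1
  refine Finset.sum_congr rfl fun i _ => ?_
  rw [← Finset.mul_prod_erase _ _ (Finset.mem_univ i), Finset.compl_singleton]
  have := ht' i
  field_simp

lemma prod_sub_orderedEigenvalues_borderedMatrix {A : HermitianMatrix n} {lam : Fin n → ℝ}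
    {U : Matrix (Fin n) (Fin n) ℂ} (hU : U ∈ Matrix.unitaryGroup (Fin n) ℂ)
    (hA : A.1 = U * Matrix.diagonal (fun i => (lam i : ℂ)) * star U) (c : ℝ) (b : Fin n → ℂ)
    (t : ℝ) : ∏ j, (t - orderedEigenvalues (borderedMatrix A c b) j) =
      secularFun lam (Fin.cons c fun i => Complex.normSq (Matrix.vecMul b U i)) t := by
  refine congrFun (Continuous.ext_on ((Set.finite_range lam).countable.dense_compl ℝ)
    (continuous_finsetProd _ fun j _ => continuous_id.sub continuous_const)
    (continuous_secularFun _ _) fun s hs => ?_) t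
  have h := det_sub_borderedMatrix_aux hU hA c b (t := s) fun i hi => hs ⟨i, hi.symm⟩
  rw [det_sub_eq] at h
  exact_mod_cast h

/-- The ordered roots of `secularFun lam u`, for nonnegative `u i.succ`. -/
noncomputable def secularRoots (lam : Fin n → ℝ) (u : Fin (n + 1) → ℝ) : Fin (n + 1) → ℝ :=
  orderedEigenvalues (borderedMatrix (diagonalHermitian lam) (u 0) fun i => (√(u i.succ) : ℂ))

lemma prod_sub_secularRoots (lam : Fin n → ℝ) {u : Fin (n + 1) → ℝ} (hu : ∀ i : Fin n, 0 ≤ u i.succ)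
    (t : ℝ) : ∏ j, (t - secularRoots lam u j) = secularFun lam u t := by
  rw [secularRoots, prod_sub_orderedEigenvalues_borderedMatrix (U := 1) (lam := lam)
    (one_mem _) (by simp [diagonalHermitian])]
  congr 1
  refine funext fun j => Fin.cases rfl (fun i => ?_) j
  simp [Complex.normSq_ofReal, Real.mul_self_sqrt (hu i)]

lemma monotone_secularRoots (lam : Fin n → ℝ) (u : Fin (n + 1) → ℝ) :
    Monotone (secularRoots lam u) :=
  monotone_orderedEigenvalues _

lemma orderedEigenvalues_borderedMatrix {A : HermitianMatrix n} {lam : Fin n → ℝ}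
    {U : Matrix (Fin n) (Fin n) ℂ} (hU : U ∈ Matrix.unitaryGroup (Fin n) ℂ)
    (hA : A.1 = U * Matrix.diagonal (fun i => (lam i : ℂ)) * star U) (c : ℝ) (b : Fin n → ℂ) :
    orderedEigenvalues (borderedMatrix A c b) =
      secularRoots lam (Fin.cons c fun i => Complex.normSq (Matrix.vecMul b U i)) :=
  eq_of_prod_sub_eq (monotone_orderedEigenvalues _) (monotone_secularRoots _ _) Set.infinite_univ
    fun t _ => by
      rw [prod_sub_orderedEigenvalues_borderedMatrix hU hA, prod_sub_secularRoots]
      intro i; rw [Fin.cons_succ]; exact Complex.normSq_nonneg _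

lemma secularRoots_secularCoords {lam : Fin n → ℝ} {μ : Fin (n + 1) → ℝ}
    (hμ : μ ∈ interlacingSet lam) : secularRoots lam (secularCoords lam μ) = μ :=
  eq_of_prod_sub_eq (monotone_secularRoots _ _) (strictMono_of_mem_interlacingSet hμ).monotone
    Set.infinite_univ fun t _ => by
      rw [prod_sub_secularRoots lam (fun i => (secularCoords_pos hμ i).le),
        prod_sub_eq_secularFun (strictMono_left_of_mem_interlacingSet hμ).injective]

lemma image_secularCoords {lam : Fin n → ℝ} (hlam : StrictMono lam) :
    secularCoords lam '' interlacingSet lam = {u | ∀ i : Fin n, 0 < u i.succ} := by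
  ext u
  constructor
  · rintro ⟨μ, hμ, rfl⟩
    exact secularCoords_pos hμ
  · intro hu
    have h := secularCoords_eq hlam.injective (prod_sub_secularRoots lam fun i => (hu i).le)
    exact ⟨secularRoots lam u,
      mem_interlacingSet_of_pos hlam (monotone_secularRoots _ _) (by rwa [h]), h⟩

lemma measurable_hermitian {α : Type*} [MeasurableSpace α] {f : α → HermitianMatrix n}
    (h : ∀ i j, Measurable fun a => (f a).1 i j) : Measurable f :=
  measurable_comap_iff.2 (measurable_pi_lambda _ fun p => h p.1 p.2)

lemma measurable_borderedMatrix :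
    Measurable fun p : HermitianMatrix n × ℝ × (Fin n → ℂ) => borderedMatrix p.1 p.2.1 p.2.2 := by
  refine measurable_hermitian fun i j => ?_
  refine Fin.cases ?_ (fun i => ?_) i <;> refine Fin.cases ?_ (fun j => ?_) j
  · simp only [borderedMatrix, Matrix.of_apply, Fin.cons_zero]
    exact Complex.measurable_ofReal.comp (measurable_fst.comp measurable_snd)
  · simp only [borderedMatrix, Matrix.of_apply, Fin.cons_zero, Fin.cons_succ]
    fun_prop
  · simp only [borderedMatrix, Matrix.of_apply, Fin.cons_zero, Fin.cons_succ]
    exact Complex.continuous_conj.measurable.comp (by fun_prop)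
  · simp only [borderedMatrix, Matrix.of_apply, Fin.cons_succ]
    exact (measurable_entry i j).comp measurable_fst

lemma measurable_secularRoots (lam : Fin n → ℝ) : Measurable (secularRoots lam) := by
  have h : Measurable fun u : Fin (n + 1) → ℝ =>
      (diagonalHermitian lam, u 0, fun i : Fin n => (√(u i.succ) : ℂ)) := by
    refine measurable_const.prodMk ((measurable_pi_apply 0).prodMk
      (measurable_pi_lambda _ fun i => Complex.measurable_ofReal.comp ?_))
    exact Real.continuous_sqrt.measurable.comp (measurable_pi_apply _)
  exact measurable_orderedEigenvalues.comp (measurable_borderedMatrix.comp h)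

end Bordered

/-! ### Integration over bordered Hermitian matrices -/

section BorderedIntegral

variable {n : ℕ}

lemma map_normSq_volume : (volume : Measure ℂ).map Complex.normSq =
    NNReal.pi • volume.restrict (Set.Ioi 0) := by
  have hball : ∀ r : ℝ, 0 ≤ r → volume (Metric.ball (0 : ℂ) √r) = ENNReal.ofReal (Real.pi * r) ∧
      volume (Metric.closedBall (0 : ℂ) √r) = ENNReal.ofReal (Real.pi * r) := fun r hr => by
    rw [Complex.volume_closedBall, Complex.volume_ball, ← ENNReal.ofReal_pow (Real.sqrt_nonneg r),
      Real.sq_sqrt hr, mul_comm Real.pi, ENNReal.ofReal_mul hr, ← NNReal.coe_real_pi,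
      ENNReal.ofReal_coe_nnreal]
    exact ⟨rfl, rfl⟩
  have hmem : ∀ (r : ℝ) (z : ℂ), z ∈ Metric.ball (0 : ℂ) √r ↔ Complex.normSq z < r := fun r z => by
    rw [mem_ball_zero_iff, Complex.normSq_eq_norm_sq, Real.lt_sqrt (norm_nonneg z)]
  have hmem' : ∀ (r : ℝ), 0 ≤ r → ∀ z : ℂ, z ∈ Metric.closedBall (0 : ℂ) √r ↔
      Complex.normSq z ≤ r := fun r hr z => by
    rw [mem_closedBall_zero_iff, Complex.normSq_eq_norm_sq, Real.le_sqrt (norm_nonneg z) hr]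
  refine (Real.measure_ext_Ioo_rat fun a b => ?_).symm
  rw [Measure.map_apply Complex.continuous_normSq.measurable measurableSet_Ioo, Measure.smul_apply,
    Measure.restrict_apply measurableSet_Ioo, ENNReal.smul_def, smul_eq_mul,
    ← ENNReal.ofReal_coe_nnreal, NNReal.coe_real_pi]
  generalize (a : ℝ) = a
  generalize (b : ℝ) = b
  rcases le_or_gt b 0 with hb | hb
  · have h1 : Complex.normSq ⁻¹' Set.Ioo a b = ∅ := by
      ext z
      simpa using fun _ => hb.trans (Complex.normSq_nonneg z)
    have h2 : Set.Ioo a b ∩ Set.Ioi 0 = ∅ := by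
      ext s
      simp only [Set.mem_inter_iff, Set.mem_Ioo, Set.mem_Ioi, Set.mem_empty_iff_false, iff_false]
      rintro ⟨⟨-, h⟩, h'⟩
      linarith
    rw [h1, h2, measure_empty, measure_empty, mul_zero]
  rcases lt_or_ge a 0 with ha | ha
  · have h1 : Complex.normSq ⁻¹' Set.Ioo a b = Metric.ball 0 √b := by
      ext z
      rw [hmem, Set.mem_preimage, Set.mem_Ioo]
      exact ⟨fun h => h.2, fun h => ⟨ha.trans_le (Complex.normSq_nonneg z), h⟩⟩
    have h2 : Set.Ioo a b ∩ Set.Ioi 0 = Set.Ioo 0 b := by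
      ext s
      simp only [Set.mem_inter_iff, Set.mem_Ioo, Set.mem_Ioi]
      exact ⟨fun h => ⟨h.2, h.1.2⟩, fun h => ⟨⟨ha.trans h.1, h.2⟩, h.1⟩⟩
    rw [h1, h2, (hball b hb.le).1, Real.volume_Ioo, sub_zero, ENNReal.ofReal_mul Real.pi_pos.le]
  · rcases le_or_gt b a with hab | hab
    · rw [Set.Ioo_eq_empty (not_lt.2 hab)]
      simp
    have h1 : Complex.normSq ⁻¹' Set.Ioo a b = Metric.ball 0 √b \ Metric.closedBall 0 √a := by
      ext z
      rw [Set.mem_sdiff, hmem, hmem' a ha, Set.mem_preimage, Set.mem_Ioo, not_le, and_comm]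
    have h2 : Set.Ioo a b ∩ Set.Ioi 0 = Set.Ioo a b :=
      Set.inter_eq_left.2 fun s hs => ha.trans_lt hs.1
    have hsub : Metric.closedBall (0 : ℂ) √a ⊆ Metric.ball 0 √b := fun z hz => by
      rw [hmem' a ha] at hz
      exact (hmem b z).2 (hz.trans_lt hab)
    rw [h1, h2, measure_sdiff hsub Metric.isClosed_closedBall.measurableSet.nullMeasurableSet
      (by rw [(hball a ha).2]; exact ENNReal.ofReal_ne_top), (hball b hb.le).1, (hball a ha).2,
      ← ENNReal.ofReal_sub _ (mul_nonneg Real.pi_pos.le ha), Real.volume_Ioo,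
      ← ENNReal.ofReal_mul Real.pi_pos.le, mul_sub]

lemma measurePreserving_vecMul_unitary {U : Matrix (Fin n) (Fin n) ℂ}
    (hU : U ∈ Matrix.unitaryGroup (Fin n) ℂ) :
    MeasurePreserving (fun b : Fin n → ℂ => Matrix.vecMul b U) := by
  set f : (Fin n → ℂ) →ₗ[ℝ] (Fin n → ℂ) :=
    (Matrix.toLin' U.transpose).restrictScalars ℝ with hf
  have hdet : |LinearMap.det f| = 1 := by
    have h1 : (star U).det * U.det = 1 := by
      rw [← Matrix.det_mul, Unitary.star_mul_self_of_mem hU, Matrix.det_one]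
    rw [Matrix.star_eq_conjTranspose, Matrix.det_conjTranspose] at h1
    rw [hf, LinearMap.det_restrictScalars, LinearMap.det_toLin', Matrix.det_transpose,
      Algebra.norm_complex_eq]
    have h2 : Complex.normSq U.det = 1 := by
      have h3 := Complex.normSq_eq_conj_mul_self (z := U.det)
      rw [← starRingEnd_apply] at h1
      rw [h1] at h3
      exact_mod_cast h3
    simp [h2]
  have h0 : LinearMap.det f ≠ 0 := fun h => by rw [h, abs_zero] at hdet; exact zero_ne_one hdet
  have hfun : (fun b : Fin n → ℂ => Matrix.vecMul b U) = f := by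
    ext b i
    simp [hf, Matrix.mulVec_transpose]
  rw [hfun]
  refine ⟨(LinearMap.continuous_of_finiteDimensional f).measurable, ?_⟩
  rw [Measure.map_linearMap_addHaar_eq_smul_addHaar volume h0, abs_inv, hdet, inv_one,
    ENNReal.ofReal_one, one_smul]

lemma lintegral_normSq_vecMul {U : Matrix (Fin n) (Fin n) ℂ}
    (hU : U ∈ Matrix.unitaryGroup (Fin n) ℂ) {H : (Fin n → ℝ) → ℝ≥0∞} (hH : Measurable H) :
    ∫⁻ b : Fin n → ℂ, H (fun i => Complex.normSq (Matrix.vecMul b U i)) =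
      (NNReal.pi : ℝ≥0∞) ^ n * ∫⁻ r in {r : Fin n → ℝ | ∀ i, 0 < r i}, H r := by
  have hm : Measurable fun (b : Fin n → ℂ) i => Complex.normSq (b i) :=
    measurable_pi_lambda _ fun i => Complex.continuous_normSq.measurable.comp (measurable_pi_apply i)
  have hset : {r : Fin n → ℝ | ∀ i, 0 < r i} = Set.univ.pi fun _ => Set.Ioi 0 := by
    ext r; simp
  rw [(measurePreserving_vecMul_unitary hU).lintegral_comp
    (f := fun b => H fun i => Complex.normSq (b i)) (hH.comp hm), ← lintegral_map hH hm]
  have hsf : ∀ _ : Fin n, SigmaFinite ((volume : Measure ℂ).map Complex.normSq) := fun _ => by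
    rw [map_normSq_volume]
    infer_instance
  have hmap : (volume : Measure (Fin n → ℂ)).map (fun b i => Complex.normSq (b i)) =
      (NNReal.pi : ℝ≥0∞) ^ n • volume.restrict {r : Fin n → ℝ | ∀ i, 0 < r i} := by
    have h1 := Measure.pi_map_pi (μ := fun _ : Fin n => (volume : Measure ℂ))
      (f := fun _ => Complex.normSq) (hμ := hsf)
      fun _ => Complex.continuous_normSq.measurable.aemeasurable
    refine h1.trans ?_
    rw [hset, volume_pi, Measure.restrict_pi_pi]
    refine @Measure.pi_eq _ _ _ _ _ hsf _ fun s hs => ?_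
    rw [Measure.smul_apply, Measure.pi_pi, smul_eq_mul]
    simp only [map_normSq_volume, Measure.smul_apply, ENNReal.smul_def, smul_eq_mul,
      Finset.prod_mul_distrib,
      Finset.prod_const, Finset.card_fin]
  rw [hmap, lintegral_smul_measure, smul_eq_mul]

lemma measurable_hermitianOfCoords :
    Measurable (hermitianOfCoords : HermitianCoords n → HermitianMatrix n) := by
  refine measurable_hermitian fun i j => ?_
  simp only [hermitianOfCoords, Matrix.of_apply]
  have hmk : ∀ f g : HermitianCoords n → ℝ, Measurable f → Measurable g →
      Measurable fun c => (⟨f c, g c⟩ : ℂ) := fun f g hf hg =>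
    Complex.measurableEquivRealProd.symm.measurable.comp (hf.prodMk hg)
  split_ifs
  · exact hmk _ _ (by fun_prop) (by fun_prop)
  · exact hmk _ _ (by fun_prop) (by fun_prop)
  · exact Complex.measurable_ofReal.comp (by fun_prop)

lemma upperPair_cases {P : UpperPair (n + 1) → Prop}
    (h0 : ∀ j : Fin n, P ⟨(0, j.succ), j.succ_pos⟩)
    (hs : ∀ p : UpperPair n, P ⟨(p.1.1.succ, p.1.2.succ), Fin.succ_lt_succ_iff.2 p.2⟩) (p) :
    P p := by
  obtain ⟨⟨i, j⟩, h⟩ := p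
  obtain ⟨j, rfl⟩ := Fin.exists_succ_eq.2 (Fin.ne_zero_of_lt h)
  induction i using Fin.cases with
  | zero => exact h0 j
  | succ i => exact hs ⟨(i, j), Fin.succ_lt_succ_iff.1 h⟩

/-- The coordinates of the lower right block of a Hermitian matrix, its first diagonal entry, and
the remainder of its first row, in terms of the coordinates of the matrix. -/
def splitCoords (n : ℕ) : HermitianCoords (n + 1) →ₗ[ℝ] HermitianCoords n × ℝ × (Fin n → ℂ) where
  toFun C := ((fun i => C.1 i.succ,
    fun p => C.2.1 ⟨(p.1.1.succ, p.1.2.succ), Fin.succ_lt_succ_iff.2 p.2⟩,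
    fun p => C.2.2 ⟨(p.1.1.succ, p.1.2.succ), Fin.succ_lt_succ_iff.2 p.2⟩),
    C.1 0, fun i => ⟨C.2.1 ⟨(0, i.succ), i.succ_pos⟩, C.2.2 ⟨(0, i.succ), i.succ_pos⟩⟩)
  map_add' C D := rfl
  map_smul' a C := by
    refine Prod.ext rfl (Prod.ext rfl (funext fun i => ?_))
    apply Complex.ext <;> simp

/-- Extension by the first row of a function on the index pairs above the diagonal. -/
def consUpperPair (r : Fin n → ℝ) (a : UpperPair n → ℝ) (p : UpperPair (n + 1)) : ℝ :=
  if h : p.1.1 = 0 then r (p.1.2.pred (Fin.ne_zero_of_lt p.2))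
  else a ⟨(p.1.1.pred h, p.1.2.pred (Fin.ne_zero_of_lt p.2)), 
    (Fin.pred_lt_pred_iff (ha := h) (hb := Fin.ne_zero_of_lt p.2)).2 p.2⟩

lemma bijective_splitCoords (n : ℕ) : Function.Bijective (splitCoords n) := by
  refine Function.bijective_iff_has_inverse.2 ⟨fun D => (Fin.cons D.2.1 D.1.1,
    consUpperPair (fun i => (D.2.2 i).re) D.1.2.1,
    consUpperPair (fun i => (D.2.2 i).im) D.1.2.2), ?_, ?_⟩
  · rintro ⟨d, a, a'⟩
    refine Prod.ext (Fin.cons_self_tail d) (Prod.ext (funext ?_) (funext ?_))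
    · exact upperPair_cases (fun j => by simp [splitCoords, consUpperPair])
        fun p => by simp [splitCoords, consUpperPair, Fin.succ_ne_zero]
    · exact upperPair_cases (fun j => by simp [splitCoords, consUpperPair])
        fun p => by simp [splitCoords, consUpperPair, Fin.succ_ne_zero]
  · rintro ⟨⟨d, a, a'⟩, c, b⟩
    simp [splitCoords, consUpperPair, Fin.succ_ne_zero]

lemma hermitianOfCoords_eq_borderedMatrix (C : HermitianCoords (n + 1)) :
    hermitianOfCoords C = borderedMatrix (hermitianOfCoords (splitCoords n C).1)
      (splitCoords n C).2.1 (splitCoords n C).2.2 := by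
  refine Subtype.ext ?_
  ext i j
  refine Fin.cases ?_ (fun i => ?_) i <;> refine Fin.cases ?_ (fun j => ?_) j
  · simp [hermitianOfCoords, borderedMatrix, splitCoords]
  · simp [hermitianOfCoords, borderedMatrix, splitCoords]
  · simp [hermitianOfCoords, borderedMatrix, splitCoords, Complex.ext_iff]
  · simp [hermitianOfCoords, borderedMatrix, splitCoords, Fin.succ_lt_succ_iff]

lemma measurable_lintegral_borderedMatrix {g : HermitianMatrix (n + 1) → ℝ≥0∞}
    (hg : Measurable g) :
    Measurable fun A : HermitianMatrix n =>
      ∫⁻ c : ℝ, ∫⁻ b : Fin n → ℂ, g (borderedMatrix A c b) := by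
  have h : Measurable fun p : (HermitianMatrix n × ℝ) × (Fin n → ℂ) =>
      g (borderedMatrix p.1.1 p.1.2 p.2) :=
    hg.comp ((measurable_borderedMatrix (n := n)).comp
      (MeasurableEquiv.prodAssoc (α := HermitianMatrix n) (β := ℝ) (γ := Fin n → ℂ)).measurable)
  exact h.lintegral_prod_right'.lintegral_prod_right'

instance isAddHaarMeasure_volume_hermitianCoords (n : ℕ) :
    (volume : Measure (HermitianCoords n)).IsAddHaarMeasure :=
  have _h : (volume : Measure ((UpperPair n → ℝ) × (UpperPair n → ℝ))).IsAddHaarMeasure :=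
    Measure.prod.instIsAddHaarMeasure _ _
  Measure.prod.instIsAddHaarMeasure _ _

/-- The constant is left unspecified: a linear isomorphism maps Lebesgue measure to some multiple of
Lebesgue measure. -/
lemma exists_lintegral_hermitianVolume_succ (n : ℕ) : ∃ K : ℝ≥0∞, K ≠ 0 ∧ K ≠ ∞ ∧
    ∀ g : HermitianMatrix (n + 1) → ℝ≥0∞, Measurable g →
      ∫⁻ M, g M ∂(hermitianVolume (n + 1)) =
        K * ∫⁻ A, (∫⁻ c : ℝ, ∫⁻ b : Fin n → ℂ, g (borderedMatrix A c b)) ∂(hermitianVolume n) := by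
  let e := (LinearEquiv.ofBijective _ (bijective_splitCoords n)).toContinuousLinearEquiv
  have hhaar : ((volume : Measure (HermitianCoords (n + 1))).map e).IsAddHaarMeasure :=
    e.isAddHaarMeasure_map _
  have _hadd : MeasurableAdd (HermitianCoords n) :=
    ⟨fun c => (continuous_const.add continuous_id).measurable,
      fun c => (continuous_id.add continuous_const).measurable⟩
  have hhaar' : (volume : Measure (HermitianCoords n × ℝ × (Fin n → ℂ))).IsAddHaarMeasure :=
    have h : (volume : Measure (ℝ × (Fin n → ℂ))).IsAddHaarMeasure :=
      Measure.prod.instIsAddHaarMeasure _ _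
    Measure.prod.instIsAddHaarMeasure _ _
  obtain ⟨k, hk, hk'⟩ : ∃ k : ℝ≥0, k ≠ 0 ∧
      (volume : Measure (HermitianCoords (n + 1))).map e = k • volume :=
    ⟨_, (Measure.addHaarScalarFactor_pos_of_isAddHaarMeasure _ _).ne',
      Measure.isAddLeftInvariant_eq_smul _ _⟩
  refine ⟨k, ENNReal.coe_ne_zero.2 hk, ENNReal.coe_ne_top, fun g hg => ?_⟩
  have hG : Measurable fun D : HermitianCoords n × ℝ × (Fin n → ℂ) =>
      g (borderedMatrix (hermitianOfCoords D.1) D.2.1 D.2.2) := by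
    have h1 : Measurable fun D : HermitianCoords n × ℝ × (Fin n → ℂ) =>
        (hermitianOfCoords D.1, D.2) :=
      (measurable_hermitianOfCoords.comp measurable_fst).prodMk measurable_snd
    exact hg.comp (measurable_borderedMatrix.comp h1)
  rw [hermitianVolume, lintegral_map hg measurable_hermitianOfCoords]
  simp only [hermitianOfCoords_eq_borderedMatrix]
  have h1 := lintegral_map (μ := (volume : Measure (HermitianCoords (n + 1)))) hG
    e.continuous.measurable
  refine h1.symm.trans ?_
  rw [hk', lintegral_smul_measure, ENNReal.smul_def, smul_eq_mul]
  congr 1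
  rw [Measure.volume_eq_prod, lintegral_prod _ hG.aemeasurable, hermitianVolume]
  rw [lintegral_map (measurable_lintegral_borderedMatrix hg) measurable_hermitianOfCoords]
  refine lintegral_congr fun C => ?_
  rw [Measure.volume_eq_prod, lintegral_prod]
  exact (hG.comp measurable_prodMk_left).aemeasurable

end BorderedIntegral

/-! ### The Weyl integration formula -/

section Weyl

variable {n : ℕ}

lemma continuous_det_vandermonde (n : ℕ) :
    Continuous fun y : Fin n → ℝ => (Matrix.vandermonde y).det := by
  simp only [Matrix.det_vandermonde]
  fun_prop

/-- The distribution of the eigenvalues of a bordered matrix, for a uniformly distributed border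
and a given lower right block with simple spectrum. -/
lemma lintegral_orderedEigenvalues_borderedMatrix {A : HermitianMatrix n}
    (hA : StrictMono (orderedEigenvalues A)) {f : (Fin (n + 1) → ℝ) → ℝ≥0∞} (hf : Measurable f) :
    ∫⁻ c : ℝ, ∫⁻ b : Fin n → ℂ, f (orderedEigenvalues (borderedMatrix A c b)) =
      (NNReal.pi : ℝ≥0∞) ^ n * ∫⁻ μ in interlacingSet (orderedEigenvalues A),
        ENNReal.ofReal ((Matrix.vandermonde μ).det /
          (Matrix.vandermonde (orderedEigenvalues A)).det) * f μ := by
  obtain ⟨U, hU, hAU⟩ := exists_unitary_orderedEigenvalues A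
  set lam := orderedEigenvalues A with hlam
  have hfs : Measurable fun u => f (secularRoots lam u) := hf.comp (measurable_secularRoots lam)
  have hcons : ∀ c : ℝ, Measurable fun r : Fin n → ℝ =>
      f (secularRoots lam (Fin.cons c r : Fin (n + 1) → ℝ)) := fun c => by
    refine hfs.comp (measurable_pi_lambda _ fun i => Fin.cases ?_ (fun i => ?_) i)
    · exact measurable_const
    · exact measurable_pi_apply i
  have h1 : ∀ c : ℝ, ∫⁻ b : Fin n → ℂ, f (orderedEigenvalues (borderedMatrix A c b)) =
      (NNReal.pi : ℝ≥0∞) ^ n * ∫⁻ r in {r : Fin n → ℝ | ∀ i, 0 < r i},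
        f (secularRoots lam (Fin.cons c r : Fin (n + 1) → ℝ)) := fun c => by
    rw [← lintegral_normSq_vecMul hU (hcons c)]
    simp only [orderedEigenvalues_borderedMatrix hU hAU]
  have hpos : MeasurableSet {r : Fin n → ℝ | ∀ i, 0 < r i} := by
    simp only [Set.ofPred_forall]
    exact .iInter fun i => measurableSet_lt measurable_const (measurable_pi_apply i)
  have hpos' : MeasurableSet {u : Fin (n + 1) → ℝ | ∀ i : Fin n, 0 < u i.succ} := by
    simp only [Set.ofPred_forall]
    exact .iInter fun i => measurableSet_lt measurable_const (measurable_pi_apply i.succ)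
  simp only [h1]
  rw [lintegral_const_mul' _ _ (ENNReal.pow_ne_top ENNReal.coe_ne_top)]
  congr 1
  have h2 : ∫⁻ u in {u : Fin (n + 1) → ℝ | ∀ i : Fin n, 0 < u i.succ}, f (secularRoots lam u) =
      ∫⁻ c : ℝ, ∫⁻ r in {r : Fin n → ℝ | ∀ i, 0 < r i},
        f (secularRoots lam (Fin.cons c r : Fin (n + 1) → ℝ)) := by
    rw [← lintegral_indicator hpos', volume_pi, lintegral_pi_fin_succ _ (hfs.indicator hpos')]
    refine lintegral_congr fun c => ?_
    rw [← lintegral_indicator hpos, volume_pi]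
    refine lintegral_congr fun r => ?_
    simp only [Set.indicator, Set.mem_ofPred_eq, Fin.cons_succ]
  rw [← h2, ← image_secularCoords hA, lintegral_secularCoords_image hA]
  refine setLIntegral_congr_fun (measurableSet_interlacingSet lam) fun μ hμ => ?_
  simp only [secularRoots_secularCoords hμ]

/-- The Weyl integration formula: the joint density of the ordered eigenvalues of Hermitian
matrices is proportional to `vandermondeSq`. -/
theorem exists_lintegral_orderedEigenvalues (n : ℕ) : ∃ c : ℝ≥0∞, c ≠ 0 ∧ c ≠ ∞ ∧
    ∀ f : (Fin n → ℝ) → ℝ≥0∞, Measurable f →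
      ∫⁻ M : HermitianMatrix n, f (orderedEigenvalues M) ∂(hermitianVolume n) =
        c * ∫⁻ y in {y | StrictMono y}, ENNReal.ofReal (vandermondeSq y) * f y := by
  induction n with
  | zero =>
    refine ⟨1, one_ne_zero, ENNReal.one_ne_top, fun f _ => ?_⟩
    have h1 : ∀ M : HermitianMatrix 0, f (orderedEigenvalues M) = f 0 := fun M => by
      rw [Subsingleton.elim (orderedEigenvalues M) 0]
    have h2 : ∀ y : Fin 0 → ℝ, ENNReal.ofReal (vandermondeSq y) * f y = f 0 := fun y => by
      rw [Subsingleton.elim y 0]; simp [vandermondeSq]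
    have h3 : {y : Fin 0 → ℝ | StrictMono y} = Set.univ := by
      ext y; simp [Subsingleton.strictMono]
    have h4 : hermitianVolume 0 Set.univ = 1 := by
      rw [hermitianVolume, Measure.map_apply measurable_hermitianOfCoords MeasurableSet.univ,
        Set.preimage_univ, Measure.volume_eq_prod, ← Set.univ_prod_univ, Measure.prod_prod,
        Measure.volume_eq_prod, ← Set.univ_prod_univ, Measure.prod_prod]
      simp [volume_pi]
    simp only [h1, h2, h3, lintegral_const, h4, Measure.restrict_univ]
    simp [volume_pi]
  | succ n ih =>
    obtain ⟨c, hc0, hct, ih⟩ := ih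
    obtain ⟨K, hK0, hKt, hK⟩ := exists_lintegral_hermitianVolume_succ n
    have hfac : (0 : ℝ) < (n ! : ℝ)⁻¹ := by positivity
    have hpi : (NNReal.pi : ℝ≥0∞) ^ n ≠ ∞ := ENNReal.pow_ne_top ENNReal.coe_ne_top
    refine ⟨K * (c * ((NNReal.pi : ℝ≥0∞) ^ n * ENNReal.ofReal (n ! : ℝ)⁻¹)), ?_, ?_, ?_⟩
    · have hpi0 : (NNReal.pi : ℝ≥0∞) ≠ 0 := ENNReal.coe_ne_zero.2 NNReal.pi_ne_zero
      exact mul_ne_zero hK0 (mul_ne_zero hc0 (mul_ne_zero (pow_ne_zero _ hpi0)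
        (ENNReal.ofReal_pos.2 hfac).ne'))
    · exact ENNReal.mul_ne_top hKt (ENNReal.mul_ne_top hct
        (ENNReal.mul_ne_top hpi ENNReal.ofReal_ne_top))
    intro f hf
    -- The spectrum of the lower right block is almost surely simple.
    have hae : ∀ᵐ A ∂(hermitianVolume n), StrictMono (orderedEigenvalues A) := by
      have hm := (measurableSet_setOf_strictMono n).compl
      have h := ih ({y | StrictMono y}ᶜ.indicator 1) (measurable_one.indicator hm)
      have h0 : ∫⁻ y in {y : Fin n → ℝ | StrictMono y}, ENNReal.ofReal (vandermondeSq y) *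
          {y | StrictMono y}ᶜ.indicator 1 y = 0 := by
        refine (setLIntegral_congr_fun (measurableSet_setOf_strictMono n)
          (g := fun _ => 0) fun y hy => ?_).trans (by simp)
        simp only
        rw [Set.indicator_of_notMem (s := {y : Fin n → ℝ | StrictMono y}ᶜ) (fun h => h hy), mul_zero]
      rw [h0, mul_zero] at h
      have hm' : Measurable fun A : HermitianMatrix n =>
          ({y | StrictMono y}ᶜ.indicator 1 (orderedEigenvalues A) : ℝ≥0∞) :=
        (measurable_one.indicator hm).comp measurable_orderedEigenvalues
      filter_upwards [(lintegral_eq_zero_iff hm').1 h] with A hA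
      by_contra hcon
      simp only [Pi.zero_apply] at hA
      rw [Set.indicator_of_mem (s := {y : Fin n → ℝ | StrictMono y}ᶜ) hcon] at hA
      exact one_ne_zero hA
    set V : ∀ k, (Fin k → ℝ) → ℝ := fun k y => (Matrix.vandermonde y).det with hV
    have hVm : ∀ k, Measurable (V k) := fun k => (continuous_det_vandermonde k).measurable
    set F : (Fin n → ℝ) → ℝ≥0∞ := fun lam => (NNReal.pi : ℝ≥0∞) ^ n *
      ∫⁻ μ in interlacingSet lam, ENNReal.ofReal (V _ μ / V _ lam) * f μ with hF
    have hFm : Measurable F := by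
      have h : Measurable ({p : (Fin n → ℝ) × (Fin (n + 1) → ℝ) |
          p.2 ∈ interlacingSet p.1}.indicator fun p =>
            ENNReal.ofReal (V _ p.2 / V _ p.1) * f p.2) := by
        refine Measurable.indicator ?_ measurableSet_interlacingSet_uncurry
        exact ((((hVm _).comp measurable_snd).div ((hVm _).comp measurable_fst)).ennreal_ofReal).mul
          (hf.comp measurable_snd)
      refine Measurable.const_mul ?_ _
      simp only [← lintegral_indicator (measurableSet_interlacingSet _)]
      exact h.lintegral_prod_right' (ν := volume)
    refine (hK _ (hf.comp measurable_orderedEigenvalues)).trans ?_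
    have h1 : ∫⁻ A, (∫⁻ c : ℝ, ∫⁻ b : Fin n → ℂ, f (orderedEigenvalues (borderedMatrix A c b)))
        ∂(hermitianVolume n) = ∫⁻ A, F (orderedEigenvalues A) ∂(hermitianVolume n) :=
      lintegral_congr_ae (hae.mono fun A hA => lintegral_orderedEigenvalues_borderedMatrix hA hf)
    -- One of the two Vandermonde factors of `lam` cancels against the density of `μ` given `lam`.
    set G : (Fin n → ℝ) × (Fin (n + 1) → ℝ) → ℝ≥0∞ :=
      {p : (Fin n → ℝ) × (Fin (n + 1) → ℝ) | p.2 ∈ interlacingSet p.1}.indicator fun p =>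
        ENNReal.ofReal (V _ p.1) * (ENNReal.ofReal (V _ p.2) * f p.2) with hG
    have hGm : Measurable G := by
      refine Measurable.indicator ?_ measurableSet_interlacingSet_uncurry
      exact ((hVm _).comp measurable_fst).ennreal_ofReal.mul
        (((hVm _).comp measurable_snd).ennreal_ofReal.mul (hf.comp measurable_snd))
    have h2 : ∫⁻ lam in {y | StrictMono y}, ENNReal.ofReal (vandermondeSq lam) * F lam =
        (NNReal.pi : ℝ≥0∞) ^ n * ∫⁻ lam, ∫⁻ μ, G (lam, μ) := by
      rw [← lintegral_const_mul _ hGm.lintegral_prod_right',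
        ← lintegral_indicator (measurableSet_setOf_strictMono n)]
      refine lintegral_congr fun lam => ?_
      by_cases hlam : StrictMono lam
      · rw [Set.indicator_of_mem (s := {y : Fin n → ℝ | StrictMono y}) hlam, hF]
        simp only
        rw [mul_left_comm, ← lintegral_const_mul' _ _ ENNReal.ofReal_ne_top,
          ← lintegral_indicator (measurableSet_interlacingSet lam)]
        congr 1
        refine lintegral_congr fun μ => ?_
        by_cases hμ : μ ∈ interlacingSet lam
        · rw [Set.indicator_of_mem hμ, hG, Set.indicator_of_mem
            (s := {p : (Fin n → ℝ) × (Fin (n + 1) → ℝ) | p.2 ∈ interlacingSet p.1}) hμ]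
          simp only
          have hpos := det_vandermonde_pos hlam
          rw [← mul_assoc, ← mul_assoc, vandermondeSq_eq_det_sq,
            ← ENNReal.ofReal_mul (by positivity),
            ← ENNReal.ofReal_mul hpos.le]
          congr 2
          simp only [hV]
          field_simp
        · rw [Set.indicator_of_notMem hμ, hG, Set.indicator_of_notMem
            (s := {p : (Fin n → ℝ) × (Fin (n + 1) → ℝ) | p.2 ∈ interlacingSet p.1}) hμ]
      · rw [Set.indicator_of_notMem (s := {y : Fin n → ℝ | StrictMono y}) hlam]
        have h0 : ∀ μ, G (lam, μ) = 0 := fun μ => Set.indicator_of_notMem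
          (s := {p : (Fin n → ℝ) × (Fin (n + 1) → ℝ) | p.2 ∈ interlacingSet p.1})
          (fun hμ => hlam (strictMono_left_of_mem_interlacingSet hμ)) _
        simp [h0]
    have h3 : ∫⁻ μ, ∫⁻ lam, G (lam, μ) = ENNReal.ofReal (n ! : ℝ)⁻¹ *
        ∫⁻ μ in {y | StrictMono y}, ENNReal.ofReal (vandermondeSq μ) * f μ := by
      rw [← lintegral_const_mul' _ _ ENNReal.ofReal_ne_top,
        ← lintegral_indicator (measurableSet_setOf_strictMono (n + 1))]
      refine lintegral_congr fun μ => ?_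
      by_cases hμ : StrictMono μ
      · have hm : MeasurableSet {lam : Fin n → ℝ | μ ∈ interlacingSet lam} :=
          measurable_prodMk_right (measurableSet_interlacingSet_uncurry (n := n))
        have hg : ∀ lam, G (lam, μ) = {lam : Fin n → ℝ | μ ∈ interlacingSet lam}.indicator
            (fun lam => ENNReal.ofReal (V _ lam) * (ENNReal.ofReal (V _ μ) * f μ)) lam := by
          intro lam
          simp only [hG, Set.indicator, Set.mem_ofPred_eq]
        simp only [hg]
        rw [lintegral_indicator hm, lintegral_mul_const _ (hVm n).ennreal_ofReal,
          lintegral_vandermonde_interlacing hμ,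
          Set.indicator_of_mem (s := {y : Fin (n + 1) → ℝ | StrictMono y}) hμ, ← mul_assoc,
          ← mul_assoc, vandermondeSq_eq_det_sq, ENNReal.ofReal_mul hfac.le,
          ENNReal.ofReal_pow (det_vandermonde_pos hμ).le, sq, ← mul_assoc]
      · rw [Set.indicator_of_notMem (s := {y : Fin (n + 1) → ℝ | StrictMono y}) hμ]
        have h0 : ∀ lam, G (lam, μ) = 0 := fun lam => Set.indicator_of_notMem
          (s := {p : (Fin n → ℝ) × (Fin (n + 1) → ℝ) | p.2 ∈ interlacingSet p.1})
          (fun h => hμ (strictMono_of_mem_interlacingSet h)) _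
        simp [h0]
    refine (congrArg (K * ·) h1).trans ?_
    rw [ih F hFm, h2, lintegral_lintegral_swap (f := fun lam μ => G (lam, μ)) hGm.aemeasurable, h3]
    ring

end Weyl

/-! ### Arrival times and the Jacobi Unitary Ensemble -/

lemma measurable_unitDensity (N n x : ℕ) : Measurable (unitDensity N n x) :=
  ((continuous_vandermondeSq n).measurable.const_mul _).mul (by fun_prop)

lemma measurable_jacobiDensity (N n x : ℕ) : Measurable (jacobiDensity N n x) :=
  ((continuous_vandermondeSq n).measurable.const_mul _).mul (by fun_prop)

lemma hasLaw_affine {Ω : Type*} [MeasurableSpace Ω] {Q : Measure Ω} {n : ℕ} {X : Ω → Fin n → ℝ}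
    {a : ℝ} (ha : 0 < a) (b c d : ℝ) {f g : (Fin n → ℝ) → ℝ} (hg : Measurable g)
    (hfg : ∀ t, f t = a ^ n * g fun j => a * t j + b)
    (hX : HasLaw X (orderedDensityMeasure n c d f) Q) :
    HasLaw (fun ω j => a * X ω j + b) (orderedDensityMeasure n (a * c + b) (a * d + b) g) Q := by
  have hm : Measurable fun (t : Fin n → ℝ) j => a * t j + b := by fun_prop
  refine ⟨hm.comp_aemeasurable hX.aemeasurable, ?_⟩
  rw [← map_affine_orderedDensityMeasure ha b c d hg hfg, ← hX.map_eq,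
    AEMeasurable.map_map_of_aemeasurable hm.aemeasurable hX.aemeasurable]
  rfl

lemma busConstant'_nonneg {Ω : Type*} [MeasurableSpace Ω] {P : Measure Ω} [IsProbabilityMeasure P]
    {N m : ℕ} {T : ℝ≥0} {L : Fin (m + 1) → ℝ≥0 → Ω → ℤ} (hL : IsBusProcess P (m + 1) L)
    (hN : m < N) (hT : 0 < T) (x : ℕ) : 0 ≤ busConstant' N (m + 1) x := by
  refine mul_nonneg (by positivity) (mul_nonneg (Finset.prod_nonneg fun i _ => by positivity)
    (inv_nonneg.2 ?_))
  have h := measure_nonIntersectionEvent_ne_zero hL hN hT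
  rw [measure_nonIntersectionEvent hL hN hT, det_divPow_eq hN] at h
  by_contra! hneg
  have hT' : (0 : ℝ) < T := NNReal.coe_pos.2 hT
  rw [ENNReal.ofReal_eq_zero.2 (mul_nonpos_of_nonneg_of_nonpos (by positivity) hneg.le),
    mul_zero] at h
  exact h rfl

theorem mainTheorem2
    {Ω : Type*} [MeasurableSpace Ω] (P : Measure Ω) [IsProbabilityMeasure P]
    (n N x : ℕ) (T : ℝ≥0) (L : Fin n → ℝ≥0 → Ω → ℤ)
    (hn : 1 ≤ n) (hN : n < N) (hT : 0 < T) (hx : 1 ≤ x) (hxN : x + n ≤ N + 1)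
    (hL : IsBusProcess P n L) :
    -- the conditioning event has positive probability
    P (nonIntersectionEvent L N T) ≠ 0 ∧
    -- the arrival times at `x`
    HasLaw (fun ω j => arrivalTime (L j) x ω)
      (orderedDensityMeasure n 0 T
        fun t => ((T : ℝ) ^ n)⁻¹ * unitDensity N n x fun j => t j / T)
      (cond P (nonIntersectionEvent L N T)) ∧
    -- the arrival times divided by `T`
    HasLaw (fun ω j => arrivalTime (L j) x ω / T)
      (orderedDensityMeasure n 0 1 (unitDensity N n x))
      (cond P (nonIntersectionEvent L N T)) ∧
    -- the arrival times rescaled to `(-1, 1)`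
    HasLaw (fun ω j => 2 * arrivalTime (L j) x ω / T - 1)
      (orderedDensityMeasure n (-1) 1 (jacobiDensity N n x))
      (cond P (nonIntersectionEvent L N T)) ∧
    -- the eigenvalues of the Jacobi Unitary Ensemble
    jacobiPartition n (N + 1 - x - n) (x - 1) ≠ 0 ∧
    jacobiPartition n (N + 1 - x - n) (x - 1) ≠ ∞ ∧
    HasLaw (fun M : HermitianMatrix n => orderedEigenvalues M)
      (orderedDensityMeasure n (-1) 1 (jacobiDensity N n x))
      (jacobiUnitaryEnsemble n (N + 1 - x - n) (x - 1)) := by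
  obtain ⟨m, rfl⟩ : ∃ m, n = m + 1 := ⟨n - 1, by omega⟩
  have hN' : m < N := by omega
  have hT' : (0 : ℝ) < T := NNReal.coe_pos.2 hT
  have hP := measure_nonIntersectionEvent_ne_zero hL hN' hT
  have h2 : HasLaw (fun ω j => arrivalTime (L j) x ω)
      (orderedDensityMeasure (m + 1) 0 T
        fun t => ((T : ℝ) ^ (m + 1))⁻¹ * unitDensity N (m + 1) x fun j => t j / T)
      (cond P (nonIntersectionEvent L N T)) := by
    have h := hasLaw_arrivalTime hL hN' hT hx hxN
    simpa only [arrivalWeight_div_eq hT' hN' hx hxN] using h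
  have h3 : HasLaw (fun ω j => arrivalTime (L j) x ω / T)
      (orderedDensityMeasure (m + 1) 0 1 (unitDensity N (m + 1) x))
      (cond P (nonIntersectionEvent L N T)) := by
    have h := hasLaw_affine (inv_pos.2 hT') 0 _ _ (measurable_unitDensity N (m + 1) x)
      (fun t => by simp only [inv_pow, add_zero, div_eq_inv_mul]) h2
    simpa only [add_zero, mul_zero, inv_mul_cancel₀ hT'.ne', ← div_eq_inv_mul] using h
  have h4 : HasLaw (fun ω j => 2 * arrivalTime (L j) x ω / T - 1)
      (orderedDensityMeasure (m + 1) (-1) 1 (jacobiDensity N (m + 1) x))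
      (cond P (nonIntersectionEvent L N T)) := by
    have h := hasLaw_affine two_pos (-1) _ _ (measurable_jacobiDensity N (m + 1) x)
      (fun t => by
        rw [unitDensity_eq_jacobiDensity hx hxN]
        simp only [← sub_eq_add_neg]) h3
    norm_num [← sub_eq_add_neg, ← mul_div_assoc] at h
    exact h
  have hprob : IsProbabilityMeasure (cond P (nonIntersectionEvent L N T)) :=
    cond_isProbabilityMeasure hP
  -- The law of the rescaled arrival times has total mass one; this is the normalization of the
  -- Jacobi density.
  have hmass : orderedDensityMeasure (m + 1) (-1) 1 (jacobiDensity N (m + 1) x) Set.univ = 1 := by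
    rw [← h4.map_eq]
    exact (Measure.isProbabilityMeasure_map h4.aemeasurable).measure_univ
  obtain ⟨c, hc0, hct, hW⟩ := exists_lintegral_orderedEigenvalues (m + 1)
  exact ⟨hP, h2, h3, h4, hasLaw_orderedEigenvalues_of_weyl hc0 hct hW
    (busConstant'_nonneg hL hN' hT x) hmass⟩
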